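/- Let $\Sigma$ be a finite alphabet with two distinguished distinct letters $0,1$. For a relation $R\subseteq\Sigma^*\times\Sigma^*$ put $W_R(x)=\{y : (x,y)\in R\}$; all relations are assumed to have fixed witness length, i.e. any two elements of $W_R(x)$ have the same length (for example, $|y|=q(|x|)$ for all $(x,y)\in R$, with $q$ a polynomial). An *NL-transducer* is a nondeterministic Turing machine $M$ with a read-only input tape, a write-only output tape and one work tape such that, for some $f(n)\in O(\log n)$, every run on every input $x$ uses only the first $f(|x|)$ cells of the work tape. $M(x)$ is the set of strings $y$ for which some run on input $x$ halts in an accepting state with $y$ on the output tape. $M$ is a *UL-transducer* if, moreover, for every $x$ and every $y\in M(x)$ there is exactly one such run. $\mathrm{RelationNL}$ (resp. $\mathrm{RelationUL}$) is the class of relations of fixed witness length of the form $\{(x,y): y\in M(x)\}$ with $M$ an NL-transducer (resp. a UL-transducer). An NFA (finite set of states, sets of initial and final states, no $\varepsilon$-transitions) is *unambiguous* if each word it accepts has exactly one accepting run. Encode a pair $(A,0^k)$, where $A$ is an NFA over $\Sigma$ with states $0,\dots,n-1$, as a string over $\Sigma$: the number $n$, the list of transitions, the lists of initial and of final states (states written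 in unary), then $0^k$. Let $$\text{MEM-NFA}=\{((A,0^k),w) : A \text{ an NFA over }\Sigma,\ w\in\Sigma^k,\ w \text{ is accepted by } A\},$$ and let MEM-UFA be the same relation restricted to unambiguous $A$; strings that do not encode such a pair have no witnesses. A *reduction* from $R$ to $S$ is a polynomial-time computable $f:\Sigma^*\to\Sigma^*$ with $W_R(x)=W_S(f(x))$ for every $x\in\Sigma^*$. Then: 1. MEM-NFA is complete for RelationNL: $\text{MEM-NFA}\in\mathrm{RelationNL}$, and every $R\in\mathrm{RelationNL}$ has a reduction to MEM-NFA. 2. MEM-UFA is complete for RelationUL in the following sense. Every $R\in\mathrm{RelationUL}$ has a reduction $f$ to MEM-UFA, and $f$ can be chosen such that $f(x)$ encodes a pair $(A,0^k)$ with $A$ unambiguous for every $x\in\Sigma^*$. Moreover, MEM-UFA is accepted by an unambiguous logspace transducer under the promise that the automaton is unambiguous: there is an NL-transducer $M$ such that, for every $x$ that encodes a pair $(A,0^k)$ with $A$ unambiguous, $M(x)=W_{\text{MEM-UFA}}(x)$ and every $y\in M(x)$ is produced by exactly one accepting run of $M$ on $x$. -/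

import Mathlib

open Filter Asymptotics

namespace LogspaceRelations

/-- A relation between inputs and witnesses, both strings over `α`. -/
abbrev Rel (α : Type) := Set (List α × List α)

/-- The witness set `W_R(x)`. -/
def witnesses {α : Type} (R : Rel α) (x : List α) : Set (List α) := {y | (x, y) ∈ R}

/-- All witnesses of one input have the same length. -/
def FixedLength {α : Type} (R : Rel α) : Prop :=
  ∀ x y y', (x, y) ∈ R → (x, y') ∈ R → y.length = y'.length

/-! ### Nondeterministic transducers -/

/-- Head movements. -/
inductive Dir
  | left
  | stay
  | right

/-- New position of a head on cells `0, 1, 2, …`; there is no move to the left of cell `0`. -/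
def Dir.move : Dir → ℕ → Option ℕ
  | .left, 0 => none
  | .left, i + 1 => some i
  | .stay, i => some i
  | .right, i => some (i + 1)

/-- What the head of the input tape sees: a letter of the input or one of the two end markers. -/
inductive InSym (α : Type)
  | leftEnd
  | letter (a : α)
  | rightEnd

/-- The input tape with content `x`: the left end marker in cell `0`, the letters of `x` in
cells `1, …, |x|`, the right end marker in cell `|x| + 1`. -/
def readInput {α : Type} (x : List α) : ℕ → InSym α
  | 0 => .leftEnd
  | i + 1 =>
    match x[i]? with
    | some a => .letter a
    | none => .rightEnd

/-- One instruction: the next state, the symbol written on the work tape, the movements of the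
input head and of the work head, and the letter (if any) that is appended to the output. -/
structure Action (α Q Γ : Type) where
  state : Q
  write : Γ
  inputDir : Dir
  workDir : Dir
  emit : Option α

/-- A nondeterministic Turing machine with a read-only input tape, one work tape and a write-only
output tape, with input and output alphabet `α`. -/
structure Transducer (α : Type) where
  /-- states -/
  Q : Type
  [finQ : Fintype Q]
  /-- work alphabet -/
  Γ : Type
  [finΓ : Fintype Γ]
  blank : Γ
  start : Q
  accepting : Set Q
  /-- the transition relation -/
  δ : Q → InSym α → Γ → Set (Action α Q Γ)

namespace Transducer

variable {α : Type} (M : Transducer α)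

/-- Configurations, including what has been written on the output tape so far. -/
structure Cfg where
  state : M.Q
  inputPos : ℕ
  workPos : ℕ
  work : ℕ → M.Γ
  output : List α

/-- Both heads are in the first cell that holds content, the work tape is blank and the output
tape is empty. -/
def initial : M.Cfg where
  state := M.start
  inputPos := 1
  workPos := 0
  work := fun _ => M.blank
  output := []

/-- One step on input `x`. The input head stays between the end markers. -/
def Step (x : List α) (c d : M.Cfg) : Prop :=
  ∃ a ∈ M.δ c.state (readInput x c.inputPos) (c.work c.workPos),
    d.state = a.state ∧
    a.inputDir.move c.inputPos = some d.inputPos ∧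
    d.inputPos ≤ x.length + 1 ∧
    a.workDir.move c.workPos = some d.workPos ∧
    d.work = Function.update c.work c.workPos a.write ∧
    d.output = c.output ++ a.emit.toList

/-- `c` halts: no step is possible. -/
def Halted (x : List α) (c : M.Cfg) : Prop := ∀ d, ¬ M.Step x c d

/-- `ρ` is a run on input `x`, given as its sequence of configurations, that halts in an accepting
state with `y` on the output tape. -/
def IsAcceptingRun (x y : List α) (ρ : List M.Cfg) : Prop :=
  ρ.IsChain (M.Step x) ∧ ρ.head? = some M.initial ∧
    ∃ c, ρ.getLast? = some c ∧ M.Halted x c ∧ c.state ∈ M.accepting ∧ c.output = y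

/-- The set `M(x)` of outputs on input `x`. -/
def outputs (x : List α) : Set (List α) := {y | ∃ ρ, M.IsAcceptingRun x y ρ}

/-- The relation accepted by `M`. -/
def relation : Rel α := {p | p.2 ∈ M.outputs p.1}

/-- `M` is an NL-transducer: for some `f(n) ∈ O(log n)`, no run on an input `x` leaves the first
`f(|x|)` cells of the work tape. -/
def IsNL : Prop :=
  ∃ f : ℕ → ℕ, (fun n => (f n : ℝ)) =O[atTop] (fun n => Real.log (n : ℝ)) ∧
    ∀ x c, Relation.ReflTransGen (M.Step x) M.initial c → c.workPos < f x.length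

/-- On input `x`, every output is produced by exactly one accepting run. -/
def UnambiguousOn (x : List α) : Prop :=
  ∀ y ∈ M.outputs x, ∃! ρ, M.IsAcceptingRun x y ρ

/-- `M` is a UL-transducer. -/
def IsUL : Prop := M.IsNL ∧ ∀ x, M.UnambiguousOn x

end Transducer

/-- The class of relations accepted by NL-transducers. -/
def RelationNL (α : Type) : Set (Rel α) :=
  {R | FixedLength R ∧ ∃ M : Transducer α, M.IsNL ∧ M.relation = R}

/-- The class of relations accepted by UL-transducers. -/
def RelationUL (α : Type) : Set (Rel α) :=
  {R | FixedLength R ∧ ∃ M : Transducer α, M.IsUL ∧ M.relation = R}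

/-! ### Reductions -/

/-- `f` is computable by a Turing machine in polynomial time. -/
def PolyTime {α : Type} (f : List α → List α) : Prop :=
  Nonempty (Turing.TM2ComputableInPolyTime (id : List α → List α) (id : List α → List α) f)

/-- `f` is a witness-preserving polynomial-time reduction from `R` to `S`. -/
def IsReduction {α : Type} (f : List α → List α) (R S : Rel α) : Prop :=
  PolyTime f ∧ ∀ x, witnesses R x = witnesses S (f x)

/-- `S` is complete for the class `C`. -/
def IsComplete {α : Type} (C : Set (Rel α)) (S : Rel α) : Prop :=
  S ∈ C ∧ ∀ R ∈ C, ∃ f, IsReduction f R S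

/-! ### Automata as strings -/

/-- An NFA is unambiguous if every accepted word has exactly one accepting run. -/
def Unambiguous {α σ : Type} (A : NFA α σ) : Prop :=
  ∀ w ∈ A.accepts, ∃! r : (Σ s t, A.Path s t w), r.1 ∈ A.start ∧ r.2.1 ∈ A.accept

/-- An NFA with states `0, …, n - 1`, whose transitions, initial states and final states are
listed. -/
structure ListedNFA (α : Type) where
  n : ℕ
  trans : List (Fin n × α × Fin n)
  starts : List (Fin n)
  finals : List (Fin n)

/-- The automaton that is described by the lists. -/
def ListedNFA.toNFA {α : Type} (A : ListedNFA α) : NFA α (Fin A.n) where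
  step p a := {q | (p, a, q) ∈ A.trans}
  start := {p | p ∈ A.starts}
  accept := {p | p ∈ A.finals}

section Encoding

variable {α : Type} (zero one : α)

/-- The number `m` as `1^m 0`. -/
def encodeNat (m : ℕ) : List α := List.replicate m one ++ [zero]

/-- A list: each entry is preceded by `1`, and `0` marks the end. -/
def encodeList {β : Type} (e : β → List α) (l : List β) : List α :=
  l.flatMap (fun b => one :: e b) ++ [zero]

/-- The pair `(A, 0^k)` as a string: the number of states, the transitions, the initial states and
the final states of `A`, followed by `0^k`. -/
def encodeInstance (A : ListedNFA α) (k : ℕ) : List α :=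
  encodeNat zero one A.n ++
  encodeList zero one
    (fun t : Fin A.n × α × Fin A.n =>
      encodeNat zero one t.1 ++ [t.2.1] ++ encodeNat zero one t.2.2) A.trans ++
  encodeList zero one (fun p : Fin A.n => encodeNat zero one p) A.starts ++
  encodeList zero one (fun p : Fin A.n => encodeNat zero one p) A.finals ++
  List.replicate k zero

/-- `MEM-NFA`. -/
def memNFA : Rel α :=
  {p | ∃ (A : ListedNFA α) (k : ℕ), p.1 = encodeInstance zero one A k ∧
    p.2.length = k ∧ p.2 ∈ A.toNFA.accepts}

/-- `MEM-UFA`. -/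
def memUFA : Rel α :=
  {p | ∃ (A : ListedNFA α) (k : ℕ), p.1 = encodeInstance zero one A k ∧
    Unambiguous A.toNFA ∧ p.2.length = k ∧ p.2 ∈ A.toNFA.accepts}

/-- The strings that encode a pair `(A, 0^k)` in which `A` is unambiguous. -/
def ufaInstances : Set (List α) :=
  {x | ∃ (A : ListedNFA α) (k : ℕ), x = encodeInstance zero one A k ∧ Unambiguous A.toNFA}

end Encoding

end LogspaceRelations

/-! Hardness rests on the configuration graph. Without its output tape, a configuration of a
logspace transducer `M` on `x` consists of a state, two head positions and `O(log |x|)` work cells,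
so polynomially many are reachable. They become the states of an NFA: there is a transition from `r`
to `r'` with letter `a` if a path of steps without emission leads from `r` to a configuration that
has a step to `r'` emitting `a`; and `r` is final if such a silent path leads to an accepting
halting configuration. The accepted words are the outputs of `M` on `x`. Since all witnesses have
one length, `k` can be read off from any reachable accepting halting configuration, provided that
the graph search records with each configuration the length of one output with which it is reached.

An accepting run of this automaton amounts to the list of configurations directly after each
emission, and every such list lifts to a run of `M` (`NodeRun.exists_run`). Two automaton runs on
one word would therefore give two runs of `M` with the same output, so a UL-transducer yields an
unambiguous automaton (`UnambiguousOn.nodeRun_unique`). Hence `Bounds.Fits.reduction_spec` serves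
both hardness statements.

Polynomial time means a concrete multi-stack machine. It is obtained from a small calculus:
structured stack programs with step counts are compiled (`Eval.stepsTo`); data are binary trees in
Polish notation on one stack; and the functions computable in this way (`PolyFun`) are closed under
composition, pairing, case distinction, equality tests and iteration along a list with polynomially
bounded intermediate values. The reachable configurations, and the pairs connected silently, are
closures under a successor function; enough rounds are those that exceed the number of possible
elements (`closed_close`).

Membership is shown by one machine, `memProg`, for NFAs and unambiguous NFAs alike. In each pass it
guesses the next state `r` in a binary counter and reads the whole input. It checks the syntax and
that `r` is initial or, with `p` the previous state and `a` the letter written last, that `(p, a,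
r)` is listed. Then it compares the number of written letters with `k`: at `k` it accepts if `r` is
final, below `k` it writes a guessed letter and starts the next pass. All counters are tracks of a
work tape as long as the binary expansion of `|x|`. Apart from the guesses the machine is
deterministic; every state is guessed by exactly one sequence of choices, and guessed letters are
visible in the output. So accepting runs with output `w` correspond to accepting automaton runs on
`w` (`acc_guess`, `atMostOne_guess`). -/

namespace LogspaceRelations

/-! ### Structured stack programs -/

section StackPrograms

/-- Structured programs over the stacks `K` with a finite memory `σ`. -/
inductive StackProg (K : Type) (Γ : K → Type) (σ : Type) : Type
  | push (k : K) (f : σ → Γ k)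
  | pop (k : K) (f : σ → Option (Γ k) → σ)
  | load (f : σ → σ)
  | seq (p q : StackProg K Γ σ)
  | ite (c : σ → Bool) (p q : StackProg K Γ σ)
  | loop (c : σ → Bool) (p : StackProg K Γ σ)

namespace StackProg

variable {K : Type} [DecidableEq K] {Γ : K → Type} {σ : Type}

/-- `Eval p v S n v' S'`: started with memory `v` and stacks `S`, the program `p` ends after `n`
steps with memory `v'` and stacks `S'`. -/
inductive Eval : StackProg K Γ σ → σ → (∀ k, List (Γ k)) → ℕ → σ → (∀ k, List (Γ k)) → Prop
  | push (k f v S) : Eval (push k f) v S 1 v (Function.update S k (f v :: S k))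
  | pop (k f v S) :
      Eval (pop k f) v S 1 (f v (S k).head?) (Function.update S k (S k).tail)
  | load (f v S) : Eval (load f) v S 1 (f v) S
  | seq {p q v S n v' S' m v'' S''} : Eval p v S n v' S' → Eval q v' S' m v'' S'' →
      Eval (seq p q) v S (m + n) v'' S''
  | iteTrue {c p q v S n v' S'} : c v = true → Eval p v S n v' S' →
      Eval (ite c p q) v S (n + 1) v' S'
  | iteFalse {c p q v S n v' S'} : c v = false → Eval q v S n v' S' →
      Eval (ite c p q) v S (n + 1) v' S'
  | loopDone {c p v S} : c v = false → Eval (loop c p) v S 1 v S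
  | loopNext {c p v S n v' S' m v'' S''} : c v = true → Eval p v S n v' S' →
      Eval (loop c p) v' S' m v'' S'' → Eval (loop c p) v S (m + (n + 1)) v'' S''

/-- The labels of the compiled program. -/
def Lab : StackProg K Γ σ → Type
  | push _ _ => Unit
  | pop _ _ => Unit
  | load _ => Unit
  | seq p q => p.Lab ⊕ q.Lab
  | ite _ p q => Option (p.Lab ⊕ q.Lab)
  | loop _ p => Option p.Lab

instance finiteLab : (p : StackProg K Γ σ) → Finite p.Lab
  | push _ _ => inferInstanceAs (Finite Unit)
  | pop _ _ => inferInstanceAs (Finite Unit)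
  | load _ => inferInstanceAs (Finite Unit)
  | seq p q => by
      have := finiteLab p; have := finiteLab q
      exact inferInstanceAs (Finite (p.Lab ⊕ q.Lab))
  | ite _ p q => by
      have := finiteLab p; have := finiteLab q
      exact inferInstanceAs (Finite (Option (p.Lab ⊕ q.Lab)))
  | loop _ p => by
      have := finiteLab p
      exact inferInstanceAs (Finite (Option p.Lab))

/-- The first label. -/
def entry : (p : StackProg K Γ σ) → p.Lab
  | push _ _ => ()
  | pop _ _ => ()
  | load _ => ()
  | seq p _ => Sum.inl p.entry
  | ite _ _ _ => none
  | loop _ _ => none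

/-- The statements of the compiled program, with labels embedded into `Λ` by `emb`. -/
def code {Λ : Type} : (p : StackProg K Γ σ) → (p.Lab → Λ) → Λ → p.Lab → Turing.TM2.Stmt Γ Λ σ
  | push k f, _, exit, _ => .push k f (.goto fun _ => exit)
  | pop k f, _, exit, _ => .pop k f (.goto fun _ => exit)
  | load f, _, exit, _ => .load f (.goto fun _ => exit)
  | seq p q, emb, exit, l =>
      Sum.rec (fun l => code p (fun l => emb (Sum.inl l)) (emb (Sum.inr q.entry)) l)
        (fun l => code q (fun l => emb (Sum.inr l)) exit l) l
  | ite c p q, emb, exit, l =>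
      Option.rec (.branch c (.goto fun _ => emb (some (Sum.inl p.entry)))
          (.goto fun _ => emb (some (Sum.inr q.entry))))
        (fun l => Sum.rec (fun l => code p (fun l => emb (some (Sum.inl l))) exit l)
          (fun l => code q (fun l => emb (some (Sum.inr l))) exit l) l) l
  | loop c p, emb, exit, l =>
      Option.rec (.branch c (.goto fun _ => emb (some p.entry)) (.goto fun _ => exit))
        (fun l => code p (fun l => emb (some l)) (emb none) l) l

/-- `n` steps of the machine `m` lead from `c` to `d`. -/
def StepsTo {Λ : Type} (m : Λ → Turing.TM2.Stmt Γ Λ σ) (n : ℕ) (c d : Turing.TM2.Cfg Γ Λ σ) : Prop :=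
  (flip Bind.bind (Turing.TM2.step m))^[n] (some c) = some d

theorem StepsTo.trans {Λ : Type} {m : Λ → Turing.TM2.Stmt Γ Λ σ} {n n' : ℕ}
    {c d e : Turing.TM2.Cfg Γ Λ σ} (h : StepsTo m n c d) (h' : StepsTo m n' d e) :
    StepsTo m (n' + n) c e := by
  unfold StepsTo at *
  rw [Function.iterate_add_apply, h, h']

theorem stepsTo_one {Λ : Type} {m : Λ → Turing.TM2.Stmt Γ Λ σ} {c d : Turing.TM2.Cfg Γ Λ σ}
    (h : Turing.TM2.step m c = some d) : StepsTo m 1 c d := h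

/-- The compiled program simulates the structured one. -/
theorem Eval.stepsTo {p : StackProg K Γ σ} {v : σ} {S : ∀ k, List (Γ k)} {n : ℕ} {v' : σ}
    {S' : ∀ k, List (Γ k)} (h : Eval p v S n v' S') {Λ : Type} (m : Λ → Turing.TM2.Stmt Γ Λ σ)
    (emb : p.Lab → Λ) (exit : Λ) (hm : ∀ l, m (emb l) = code p emb exit l) :
    StepsTo m n ⟨some (emb p.entry), v, S⟩ ⟨some exit, v', S'⟩ := by
  induction h generalizing exit with
  | push k f v S => exact stepsTo_one (by simp [hm, code])
  | pop k f v S => exact stepsTo_one (by simp [hm, code])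
  | load f v S => exact stepsTo_one (by simp [hm, code])
  | @seq p q v S n v' S' k v'' S'' _ _ ih1 ih2 =>
    exact (ih1 (fun l => emb (Sum.inl l)) (emb (Sum.inr q.entry)) fun l => hm (Sum.inl l)).trans
      (ih2 (fun l => emb (Sum.inr l)) exit fun l => hm (Sum.inr l))
  | @iteTrue c p q v S n v' S' hc _ ih =>
    refine StepsTo.trans (stepsTo_one ?_)
      (ih (fun l => emb (some (Sum.inl l))) exit fun l => hm (some (Sum.inl l)))
    rw [Turing.TM2.step, hm]; simp [code, entry, hc]
  | @iteFalse c p q v S n v' S' hc _ ih =>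
    refine StepsTo.trans (stepsTo_one ?_)
      (ih (fun l => emb (some (Sum.inr l))) exit fun l => hm (some (Sum.inr l)))
    rw [Turing.TM2.step, hm]; simp [code, entry, hc]
  | @loopDone c p v S hc =>
    refine stepsTo_one ?_
    rw [Turing.TM2.step, hm]; simp [code, entry, hc]
  | @loopNext c p v S n v' S' k v'' S'' hc _ _ ih1 ih2 =>
    -- The exit of the body is the label of the loop test itself, so the second induction hypothesis
    -- starts where the body ends.
    refine StepsTo.trans (StepsTo.trans (stepsTo_one ?_)
      (ih1 (fun l => emb (some l)) (emb none) fun l => hm (some l))) (ih2 emb exit hm)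
    rw [Turing.TM2.step, hm]; simp [code, entry, hc]

/-- The machine that runs `p`, resets its memory and halts. -/
noncomputable def toTM [Fintype K] [Fintype σ] (p : StackProg K Γ σ) (v₀ : σ) (k₀ k₁ : K)
    [Fintype (Γ k₀)] : Turing.FinTM2 where
  K := K
  k₀ := k₀
  k₁ := k₁
  Γ := Γ
  Λ := Option p.Lab
  main := some p.entry
  ΛFin := Fintype.ofFinite _
  σ := σ
  initialState := v₀
  m l := Option.rec (.load (fun _ => v₀) .halt) (fun l => code p some none l) l

/-- `initList` and `haltList` fill one stack by a dependent `if`; an `update` is easier to compare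
with other descriptions of the stacks. -/
theorem dite_eq_update (k₀ : K) (s : List (Γ k₀)) :
    (fun k => if h : k = k₀ then (by rw [h]; exact s : List (Γ k)) else []) =
      Function.update (fun _ => []) k₀ s := by
  funext k
  by_cases hk : k = k₀
  · subst hk; simp
  · simp [hk]

/-- The additional step is the final `load`, which restores the initial memory because `haltList`
demands it. -/
theorem Eval.tm_outputs [Fintype K] [Fintype σ] {p : StackProg K Γ σ} {v₀ : σ} {k₀ k₁ : K}
    [Fintype (Γ k₀)] {x : List (Γ k₀)} {y : List (Γ k₁)} {n : ℕ} {v' : σ} {S S' : ∀ k, List (Γ k)}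
    (h : Eval p v₀ S n v' S')
    (hS : S = Function.update (fun _ => []) k₀ x) (hS' : S' = Function.update (fun _ => []) k₁ y) :
    (flip Bind.bind (p.toTM v₀ k₀ k₁).step)^[n + 1] (some (Turing.initList (p.toTM v₀ k₀ k₁) x)) =
      some (Turing.haltList (p.toTM v₀ k₀ k₁) y) := by
  have h1 : StepsTo (p.toTM v₀ k₀ k₁).m n ⟨some (some p.entry), v₀, S⟩ ⟨some none, v', S'⟩ :=
    h.stepsTo (p.toTM v₀ k₀ k₁).m some none fun l => rfl
  have e1 : Turing.initList (p.toTM v₀ k₀ k₁) x =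
      (⟨some (some p.entry), v₀, S⟩ : Turing.TM2.Cfg Γ (Option p.Lab) σ) := by
    subst hS
    unfold Turing.initList
    congr 1
    exact dite_eq_update k₀ x
  have e2 : Turing.haltList (p.toTM v₀ k₀ k₁) y =
      (⟨none, v₀, S'⟩ : Turing.TM2.Cfg Γ (Option p.Lab) σ) := by
    subst hS'
    unfold Turing.haltList
    congr 1
    exact dite_eq_update k₁ y
  rw [e1, e2, add_comm]
  refine h1.trans (stepsTo_one ?_)
  rfl

end StackProg

end StackPrograms

end LogspaceRelations

namespace LogspaceRelations

/-! ### Trees on a stack -/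

section TreeMachine

/-- Binary trees with leaves in `A`. -/
inductive PTree (A : Type) : Type
  | leaf (a : A)
  | node (x y : PTree A)

namespace PTree

variable {A : Type}

/-- Polish notation: `none` announces an inner node. -/
def ser : PTree A → List (Option A)
  | leaf a => [some a]
  | node x y => none :: (x.ser ++ y.ser)

/-- The length of the Polish notation. -/
def size (d : PTree A) : ℕ := d.ser.length

@[simp] theorem size_leaf (a : A) : (leaf a).size = 1 := rfl

@[simp] theorem size_node (x y : PTree A) : (node x y).size = x.size + y.size + 1 := by
  simp [size, ser]

theorem size_pos (d : PTree A) : 0 < d.size := by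
  cases d <;> simp

/-- Polish notation is prefix-free: the first token tells a leaf from a node, and the subtrees
follow one after the other. Hence a tree on top of a stack needs no delimiter. -/
theorem ser_append_inj : ∀ {d e : PTree A} {l l' : List (Option A)},
    d.ser ++ l = e.ser ++ l' → d = e ∧ l = l'
  | leaf a, leaf b, l, l', h => by simpa [ser] using h
  | leaf a, node _ _, l, l', h => by simp [ser] at h
  | node _ _, leaf a, l, l', h => by simp [ser] at h
  | node x y, node x' y', l, l', h => by
    simp only [ser, List.cons_append, List.append_assoc, List.cons.injEq, true_and] at h
    obtain ⟨h1, h⟩ := ser_append_inj h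
    obtain ⟨h2, h⟩ := ser_append_inj h
    exact ⟨by rw [h1, h2], h⟩

theorem ser_injective : Function.Injective (ser (A := A)) := fun d e h =>
  (ser_append_inj (l := []) (l' := []) (by simpa using h)).1

end PTree

/-- The stacks of the tree machine: input, output, the stack of values, two auxiliary stacks and
a counter. -/
inductive Stk
  | inp
  | out
  | main
  | aux (b : Bool)
  | cnt
  deriving DecidableEq

instance : Finite Stk :=
  Finite.of_injective (fun k : Stk => match k with
    | .inp => (0 : Fin 6) | .out => 1 | .main => 2 | .aux true => 3 | .aux false => 4 | .cnt => 5)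
    (by rintro (_ | _ | _ | ⟨_ | _⟩ | _) (_ | _ | _ | ⟨_ | _⟩ | _) <;> simp)

noncomputable instance : Fintype Stk := Fintype.ofFinite _

/-- The stack alphabets; on the auxiliary stacks `none` is a delimiter. -/
def StkΓ (α A : Type) : Stk → Type
  | .inp => α
  | .out => α
  | .main => Option A
  | .aux _ => Option (Option A)
  | .cnt => Unit

/-- The finite memory: two registers for stack symbols, a flag and a register for a letter. -/
structure Mem (α A : Type) where
  -- The outer `none` stands for a pop from an empty stack, `some none` for the delimiter, `some
  -- (some t)` for a token `t` of Polish notation.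
  r : Bool → Option (Option (Option A))
  flag : Bool
  letter : Option α

instance (α A : Type) [Finite α] [Finite A] : Finite (Mem α A) :=
  Finite.of_injective (fun v : Mem α A => (v.r, v.flag, v.letter)) (by
    rintro ⟨_, _, _⟩ ⟨_, _, _⟩ h; simpa using h)

noncomputable instance (α A : Type) [Finite α] [Finite A] : Fintype (Mem α A) :=
  Fintype.ofFinite _

variable {α A : Type}

/-- Programs of the tree machine. -/
abbrev TProg (α A : Type) := StackProg Stk (StkΓ α A) (Mem α A)

/-- The contents of all stacks. -/
def mkS (i o : List α) (m : List (Option A)) (s : Bool → List (Option (Option A)))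
    (c : List Unit) : ∀ k, List (StkΓ α A k)
  | .inp => i
  | .out => o
  | .main => m
  | .aux b => s b
  | .cnt => c

namespace TProg
open StackProg

variable {i o : List α} {m : List (Option A)} {s : Bool → List (Option (Option A))}
  {c : List Unit} {v : Mem α A}

theorem _root_.LogspaceRelations.StackProg.Eval.congr_right {p : TProg α A} {v v' : Mem α A} {n : ℕ}
    {S S1 S2 : ∀ k, List (StkΓ α A k)} (h : Eval p v S n v' S1) (e : S1 = S2) :
    Eval p v S n v' S2 := e ▸ h

theorem update_inp (l : List α) :
    Function.update (mkS i o m s c) Stk.inp l = mkS l o m s c := by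
  funext k; cases k <;> rfl

theorem update_out (l : List α) :
    Function.update (mkS i o m s c) Stk.out l = mkS i l m s c := by
  funext k; cases k <;> rfl

theorem update_main (l : List (Option A)) :
    Function.update (mkS i o m s c) Stk.main l = mkS i o l s c := by
  funext k; cases k <;> rfl

theorem update_cnt (l : List Unit) :
    Function.update (mkS i o m s c) Stk.cnt l = mkS i o m s l := by
  funext k; cases k <;> rfl

theorem update_aux (b : Bool) (l : List (Option (Option A))) :
    Function.update (mkS i o m s c) (Stk.aux b) l = mkS i o m (Function.update s b l) c := by
  funext k; cases k <;> try rfl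
  cases b <;> rename_i b' <;> cases b' <;> rfl

/-- The token in a register. -/
def tok (b : Bool) (v : Mem α A) : Option A := ((v.r b).getD none).getD none

/-- Set a register. -/
def setR (b : Bool) (v : Mem α A) (x : Option (Option (Option A))) : Mem α A :=
  { v with r := Function.update v.r b x }

@[simp] theorem tok_setR (b : Bool) (t : Option A) : tok b (setR b v (some (some t))) = t := by
  simp [tok, setR]

@[simp] theorem setR_flag (b : Bool) (x) : (setR b v x).flag = v.flag := rfl
@[simp] theorem setR_r (b : Bool) (x) : (setR b v x).r b = x := by simp [setR]
@[simp] theorem setR_r_not (b : Bool) (x) : (setR b v x).r (!b) = v.r (!b) := by simp [setR]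

/-- Pop a token from the main stack into the first register. -/
def popMain : TProg α A := pop Stk.main fun v t => setR true v (t.map some)

/-- Push a token on the main stack. -/
def pushMain (f : Mem α A → Option A) : TProg α A := push Stk.main f

/-- Pop a symbol from an auxiliary stack into a register. -/
def popAux (b : Bool) : TProg α A := pop (Stk.aux b) fun v t => setR b v t

/-- Push a symbol on an auxiliary stack. -/
def pushAux (b : Bool) (f : Mem α A → Option (Option A)) : TProg α A := push (Stk.aux b) f

theorem eval_popMain (t : Option A) :
    Eval popMain v (mkS i o (t :: m) s c) 1 (setR true v (some (some t))) (mkS i o m s c) := by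
  exact (Eval.pop Stk.main (fun v t => setR true v (t.map some)) v (mkS i o (t :: m) s c)).congr_right (update_main _)

theorem eval_pushMain (f : Mem α A → Option A) :
    Eval (pushMain f) v (mkS i o m s c) 1 v (mkS i o (f v :: m) s c) := by
  exact (Eval.push Stk.main f v (mkS i o m s c)).congr_right (update_main _)

theorem eval_popAux (b : Bool) (t : Option (Option A)) (l) (h : s b = t :: l) :
    Eval (popAux b) v (mkS i o m s c) 1 (setR b v (some t))
      (mkS i o m (Function.update s b l) c) := by
  have := (Eval.pop (Stk.aux b) (fun v t => setR b v t) v (mkS i o m s c)).congr_right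
    (update_aux b _)
  simp only [mkS, h] at this
  exact this

theorem eval_pushAux (b : Bool) (f : Mem α A → Option (Option A)) :
    Eval (pushAux b f) v (mkS i o m s c) 1 v
      (mkS i o m (Function.update s b (f v :: s b)) c) := by
  exact (Eval.push (Stk.aux b) f v (mkS i o m s c)).congr_right (update_aux b _)

theorem eval_pushCnt :
    Eval (push Stk.cnt fun _ => ()) v (mkS i o m s c) 1 v (mkS i o m s (() :: c)) := by
  exact (Eval.push Stk.cnt (fun _ => ()) v (mkS i o m s c)).congr_right (update_cnt _)

/-- Pop the counter; the flag is set if it was empty. -/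
def popCnt : TProg α A := pop Stk.cnt fun v t => { v with flag := t.isNone }

theorem eval_popCnt_cons (u : Unit) :
    Eval popCnt v (mkS i o m s (u :: c)) 1 { v with flag := false } (mkS i o m s c) := by
  exact (Eval.pop Stk.cnt (fun v t => { v with flag := t.isNone }) v (mkS i o m s (u :: c))).congr_right (update_cnt _)

theorem eval_popCnt_nil :
    Eval popCnt v (mkS i o m s []) 1 { v with flag := true } (mkS i o m s []) := by
  exact (Eval.pop Stk.cnt (fun v t => { v with flag := t.isNone }) v (mkS i o m s [])).congr_right (update_cnt _)

/-- Whether the token in the first register announces an inner node. -/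
def isNode (v : Mem α A) : Bool := (tok true v).isNone

/-- One step of reading a tree: read a token, process it by `w`, and count the missing trees. -/
def readBody (w : TProg α A) : TProg α A :=
  seq popMain (seq w (ite isNode (push Stk.cnt fun _ => ()) popCnt))

/-- Read the top tree of the main stack and process its tokens by `w`. -/
def readTree (w : TProg α A) : TProg α A :=
  seq (load fun v => { v with flag := false }) (loop (fun v => !v.flag) (readBody w))

/-- `w` processes the token in the first register by the state change `g`. -/
def Writes (w : TProg α A)
    (g : Option A → (Bool → List (Option (Option A))) → Bool → List (Option (Option A))) : Prop :=
  ∀ i o m s c v, ∃ n ≤ 3, Eval w v (mkS i o m s c) n v (mkS i o m (g (tok true v) s) c)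

variable {w : TProg α A}
  {g : Option A → (Bool → List (Option (Option A))) → Bool → List (Option (Option A))}

theorem readBody_node (hw : Writes w g) (hv : v.flag = false) :
    ∃ n ≤ 7, ∃ v', v'.flag = false ∧ Eval (readBody w) v (mkS i o (none :: m) s c) n v'
      (mkS i o m (g none s) (() :: c)) := by
  obtain ⟨n, hn, h⟩ := hw i o m s c (setR true v (some (some none)))
  rw [tok_setR] at h
  refine ⟨_, ?_, setR true v (some (some none)), hv, (eval_popMain none).seq (h.seq
    ((eval_pushCnt).iteTrue (by simp [isNode])))⟩
  omega

theorem readBody_leaf (hw : Writes w g) (a : A) :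
    ∃ n ≤ 7, ∃ v', v'.flag = false ∧ Eval (readBody w) v (mkS i o (some a :: m) s (() :: c)) n v'
      (mkS i o m (g (some a) s) c) := by
  obtain ⟨n, hn, h⟩ := hw i o m s (() :: c) (setR true v (some (some (some a))))
  rw [tok_setR] at h
  exact ⟨_, by omega, _, rfl, (eval_popMain (some a)).seq (h.seq
    ((eval_popCnt_cons ()).iteFalse (by simp [isNode])))⟩

theorem readBody_last (hw : Writes w g) (a : A) :
    ∃ n ≤ 7, ∃ v', v'.flag = true ∧ Eval (readBody w) v (mkS i o (some a :: m) s []) n v'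
      (mkS i o m (g (some a) s) []) := by
  obtain ⟨n, hn, h⟩ := hw i o m s [] (setR true v (some (some (some a))))
  rw [tok_setR] at h
  exact ⟨_, by omega, _, rfl, (eval_popMain (some a)).seq (h.seq
    ((eval_popCnt_nil).iteFalse (by simp [isNode])))⟩

/-- The counter holds the number of trees still missing after the current one. If it is not empty,
the end of `d` does not end the loop; so the lemma is stated with a continuation, the behaviour of
the loop once `d` is read and one tree less is missing. Each token costs one round of at most `8`
steps. -/
theorem readLoop_inner (hw : Writes w g) (d : PTree A) {N : ℕ} {S'} :
    ∀ {v : Mem α A} {m s c}, v.flag = false →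
    (∀ v' : Mem α A, v'.flag = false → ∃ n ≤ N, ∃ v'', Eval (loop (fun v => !v.flag) (readBody w)) v'
      (mkS i o m (d.ser.foldl (fun s t => g t s) s) c) n v'' S') →
    ∃ n ≤ N + 8 * d.size, ∃ v'', Eval (loop (fun v => !v.flag) (readBody w)) v
      (mkS i o (d.ser ++ m) s (() :: c)) n v'' S' := by
  induction d generalizing N with
  | leaf a =>
    intro v m s c hv h
    obtain ⟨n1, hn1, v1, hv1, h1⟩ := readBody_leaf (i := i) (o := o) (m := m) (s := s) (c := c)
      (v := v) hw a
    obtain ⟨n2, hn2, v2, h2⟩ := h v1 hv1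
    exact ⟨_, by simp; omega, v2, Eval.loopNext (by simp [hv]) h1 h2⟩
  | node x y ihx ihy =>
    intro v m s c hv h
    obtain ⟨n1, hn1, v1, hv1, h1⟩ := readBody_node (i := i) (o := o) (m := x.ser ++ (y.ser ++ m))
      (s := s) (c := () :: c) (v := v) hw hv
    obtain ⟨n2, hn2, v2, h2⟩ := ihx (v := v1) (m := y.ser ++ m) (s := g none s) (c := () :: c) hv1
      (N := N + 8 * y.size) fun v' hv' => ihy hv' (by
        simpa [PTree.ser, List.foldl_append] using h)
    refine ⟨_, ?_, v2, by
      simpa [PTree.ser] using Eval.loopNext (c := fun v : Mem α A => !v.flag) (by simp [hv]) h1 h2⟩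
    simp; omega

/-- With an empty counter, the last leaf is recognised by the failing pop that sets the flag. In a
node only the right subtree is read in this situation; the left one has a tree pending behind it and
falls under `readLoop_inner`. -/
theorem readLoop_last (hw : Writes w g) (d : PTree A) :
    ∀ {v : Mem α A} {m s}, v.flag = false →
    ∃ n ≤ 8 * d.size + 1, ∃ v', Eval (loop (fun v => !v.flag) (readBody w)) v
      (mkS i o (d.ser ++ m) s []) n v' (mkS i o m (d.ser.foldl (fun s t => g t s) s) []) := by
  induction d with
  | leaf a =>
    intro v m s hv
    obtain ⟨n1, hn1, v1, hv1, h1⟩ := readBody_last (i := i) (o := o) (m := m) (s := s) (v := v) hw a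
    exact ⟨_, by simp; omega, v1, Eval.loopNext (by simp [hv]) h1 (Eval.loopDone (by simp [hv1]))⟩
  | node x y ihx ihy =>
    intro v m s hv
    obtain ⟨n1, hn1, v1, hv1, h1⟩ := readBody_node (i := i) (o := o) (m := x.ser ++ (y.ser ++ m))
      (s := s) (c := []) (v := v) hw hv
    obtain ⟨n2, hn2, v2, h2⟩ := readLoop_inner (i := i) (o := o) hw x (v := v1) (m := y.ser ++ m)
      (s := g none s) (c := []) hv1 fun v' hv' => ihy hv'
    refine ⟨_, ?_, v2, by
      simpa [PTree.ser] using Eval.loopNext (c := fun v : Mem α A => !v.flag) (by simp [hv]) h1 h2⟩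
    simp; omega

theorem eval_readTree (hw : Writes w g) (d : PTree A) (v : Mem α A) (i o m s) :
    ∃ n ≤ 8 * d.size + 2, ∃ v', Eval (readTree w) v
      (mkS i o (d.ser ++ m) s []) n v' (mkS i o m (d.ser.foldl (fun s t => g t s) s) []) := by
  obtain ⟨n, hn, v', h⟩ := readLoop_last (i := i) (o := o) hw d (m := m) (s := s)
    (v := { v with flag := false }) rfl
  exact ⟨_, by omega, v', (Eval.load _ _ _).seq h⟩

/-- Remove the top tree. -/
def dropTree : TProg α A := readTree (load id)

theorem eval_dropTree (d : PTree A) (v : Mem α A) (i o m s) :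
    ∃ n ≤ 8 * d.size + 2, ∃ v', Eval dropTree v (mkS i o (d.ser ++ m) s []) n v'
      (mkS i o m s []) := by
  have hw : Writes (α := α) (load id : TProg α A) (fun _ s => s) := fun i o m s c v =>
    ⟨1, by omega, Eval.load _ _ _⟩
  have := eval_readTree hw d v i o m s
  have e : d.ser.foldl (fun s _ => s) s = s := by
    induction d.ser <;> simp_all
  rwa [e] at this

/-- Move the top tree to an auxiliary stack, with a delimiter below. -/
def stash (b : Bool) : TProg α A :=
  seq (pushAux b fun _ => none) (readTree (pushAux b fun v => some (tok true v)))

theorem foldl_update (b : Bool) (l : List (Option A)) : ∀ s : Bool → List (Option (Option A)),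
    l.foldl (fun s t => Function.update s b (some t :: s b)) s =
      Function.update s b (l.reverse.map some ++ s b) := by
  induction l with
  | nil => simp
  | cons t l ih => intro s; simp [ih]

theorem eval_stash (b : Bool) (d : PTree A) (v : Mem α A) (i o m s) :
    ∃ n ≤ 8 * d.size + 3, ∃ v', Eval (stash b) v (mkS i o (d.ser ++ m) s []) n v'
      (mkS i o m (Function.update s b (d.ser.reverse.map some ++ none :: s b)) []) := by
  have hw : Writes (α := α) (pushAux b fun v => some (tok true v) : TProg α A)
    (fun t s => Function.update s b (some t :: s b)) := fun i o m s c v =>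
    ⟨1, by omega, eval_pushAux _ _⟩
  obtain ⟨n, hn, v', h⟩ := eval_readTree hw d v i o m (Function.update s b (none :: s b))
  rw [foldl_update] at h
  refine ⟨_, ?_, v', (eval_pushAux b _).seq (m := n) (by simpa using h)⟩
  omega

/-- Move the top tree to both auxiliary stacks. -/
def stashBoth : TProg α A :=
  seq (pushAux true fun _ => none) (seq (pushAux false fun _ => none)
    (readTree (seq (pushAux true fun v => some (tok true v))
      (pushAux false fun v => some (tok true v)))))

theorem foldl_update_both (l : List (Option A)) : ∀ s : Bool → List (Option (Option A)),
    l.foldl (fun s t b => some t :: s b) s = fun b => l.reverse.map some ++ s b := by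
  induction l with
  | nil => simp
  | cons t l ih => intro s; simp [ih]

theorem update_both (s : Bool → List (Option (Option A))) (x y) :
    Function.update (Function.update s true x) false y = fun b => cond b x y := by
  funext b; cases b <;> simp

theorem eval_stashBoth (d : PTree A) (v : Mem α A) (i o m s) :
    ∃ n ≤ 8 * d.size + 4, ∃ v', Eval stashBoth v (mkS i o (d.ser ++ m) s []) n v'
      (mkS i o m (fun b => d.ser.reverse.map some ++ none :: s b) []) := by
  have hw : Writes (α := α) (seq (pushAux true fun v => some (tok true v))
      (pushAux false fun v => some (tok true v)) : TProg α A)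
    (fun t s b => some t :: s b) := fun i o m s c v => by
      refine ⟨2, by omega, ?_⟩
      have := (eval_pushAux (i := i) (o := o) (m := m) (s := s) (c := c) (v := v) true
        fun v => some (tok true v)).seq (eval_pushAux false fun v => some (tok true v))
      rw [update_both] at this
      convert this using 2
      funext b; cases b <;> simp
  obtain ⟨n, hn, v', h⟩ := eval_readTree hw d v i o m (fun b => none :: s b)
  rw [foldl_update_both] at h
  refine ⟨n + 2, by omega, v', ?_⟩
  have h2 := (eval_pushAux (i := i) (o := o) (m := d.ser ++ m) (s := s) (c := []) (v := v) true
        fun _ => none).seq ((eval_pushAux false fun _ => none).seq (q := readTree _) (by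
          rw [update_both]; convert h using 2; funext b; cases b <;> simp))
  exact h2

/-- Whether a register holds a token (and not the delimiter). -/
def hasTok (b : Bool) (v : Mem α A) : Bool := ((v.r b).getD none).isSome

@[simp] theorem hasTok_setR (b : Bool) (t : Option (Option A)) :
    hasTok b (setR b v (some t)) = t.isSome := by
  simp [hasTok]

/-- Process an auxiliary stack up to the delimiter. -/
def drain (b : Bool) (w : TProg α A) : TProg α A :=
  seq (popAux b) (loop (hasTok b) (seq w (popAux b)))

/-- Move a tree back from an auxiliary stack. -/
def unstash (b : Bool) : TProg α A := drain b (pushMain (tok b))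

theorem eval_drainLoop (b : Bool) (l : List (Option A)) (a) :
    ∀ (v : Mem α A) m s, s b = l.map some ++ none :: a → ∃ n ≤ 3 * l.length + 2, ∃ v',
    Eval (unstash b) v (mkS i o m s c) n v'
      (mkS i o (l.reverse ++ m) (Function.update s b a) c) := by
  induction l with
  | nil =>
    intro v m s h
    exact ⟨2, by simp, _, (eval_popAux b none a (by simpa using h)).seq
      (Eval.loopDone (by simp))⟩
  | cons t l ih =>
    intro v m s h
    have h1 := eval_popAux (i := i) (o := o) (m := m) (c := c) (v := v) b (some t)
      (l.map some ++ none :: a) (by simpa using h)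
    obtain ⟨n, hn, v', h2⟩ := ih (setR b v (some (some t))) (t :: m)
      (Function.update s b (l.map some ++ none :: a)) (by simp)
    -- The induction hypothesis speaks of a complete `unstash`, a pop followed by the loop. Its pop
    -- is the one that ends the present round, so the two parts are separated and reassembled.
    cases h2 with
    | @seq _ _ _ _ n1 v1 S1 n2 _ _ h3 h4 =>
    refine ⟨_, ?_, v', h1.seq (Eval.loopNext (by simp) ((eval_pushMain _).seq (by
      rw [tok_setR]; exact h3)) (by simpa using h4))⟩
    simp; omega

theorem eval_unstash (b : Bool) (d : PTree A) (a) (v : Mem α A) (i o m s c)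
    (h : s b = d.ser.reverse.map some ++ none :: a) : ∃ n ≤ 3 * d.size + 2, ∃ v',
    Eval (unstash b) v (mkS i o m s c) n v'
      (mkS i o (d.ser ++ m) (Function.update s b a) c) := by
  have := eval_drainLoop (i := i) (o := o) (c := c) b d.ser.reverse a v m s h
  simpa [PTree.size] using this

/-- Duplicate the top tree. -/
def dupTree : TProg α A := seq stashBoth (seq (unstash true) (unstash false))

theorem eval_dupTree (d : PTree A) (v : Mem α A) (i o m s) :
    ∃ n ≤ 14 * d.size + 8, ∃ v', Eval dupTree v (mkS i o (d.ser ++ m) s []) n v'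
      (mkS i o (d.ser ++ (d.ser ++ m)) s []) := by
  obtain ⟨n1, hn1, v1, h1⟩ := eval_stashBoth d v i o m s
  obtain ⟨n2, hn2, v2, h2⟩ := eval_unstash true d (s true) v1 i o m
    (fun b => d.ser.reverse.map some ++ none :: s b) [] rfl
  obtain ⟨n3, hn3, v3, h3⟩ := eval_unstash false d (s false) v2 i o (d.ser ++ m) _ [] (by simp :
    Function.update (fun b => d.ser.reverse.map some ++ none :: s b) true (s true) false = _)
  refine ⟨n3 + n2 + n1, by omega, v3, h1.seq (h2.seq ?_)⟩
  convert h3 using 2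
  rw [update_both]; funext b; cases b <;> rfl

/-- Exchange the two top trees. -/
def swapTree : TProg α A :=
  seq (stash true) (seq (stash false) (seq (unstash true) (unstash false)))

theorem eval_swapTree (d e : PTree A) (v : Mem α A) (i o m s) :
    ∃ n ≤ 11 * (d.size + e.size) + 10, ∃ v', Eval swapTree v
      (mkS i o (d.ser ++ (e.ser ++ m)) s []) n v' (mkS i o (e.ser ++ (d.ser ++ m)) s []) := by
  obtain ⟨n1, hn1, v1, h1⟩ := eval_stash true d v i o (e.ser ++ m) s
  obtain ⟨n2, hn2, v2, h2⟩ := eval_stash false e v1 i o m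
    (Function.update s true (d.ser.reverse.map some ++ none :: s true))
  obtain ⟨n3, hn3, v3, h3⟩ := eval_unstash true d (s true) v2 i o m _ [] (by simp :
    Function.update (Function.update s true (d.ser.reverse.map some ++ none :: s true)) false
      (e.ser.reverse.map some ++ none :: Function.update s true
        (d.ser.reverse.map some ++ none :: s true) false) true = _)
  obtain ⟨n4, hn4, v4, h4⟩ := eval_unstash false e (s false) v3 i o (d.ser ++ m) _ [] (by simp :
    Function.update (Function.update (Function.update s true
      (d.ser.reverse.map some ++ none :: s true)) false
      (e.ser.reverse.map some ++ none :: Function.update s true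
        (d.ser.reverse.map some ++ none :: s true) false)) true (s true) false = _)
  refine ⟨n4 + n3 + n2 + n1, by omega, v4, h1.seq (h2.seq (h3.seq ?_))⟩
  convert h4 using 2
  funext b; cases b <;> simp

end TProg
end TreeMachine
end LogspaceRelations

namespace LogspaceRelations

/-! ### Polynomial-time functions on encoded data -/

section PolyFunctions

theorem polynomial_eval_mono (p : Polynomial ℕ) : Monotone fun n => p.eval n := by
  intro a b h
  simp only [Polynomial.eval_eq_sum, Polynomial.sum]
  exact Finset.sum_le_sum fun i _ => Nat.mul_le_mul_left _ (Nat.pow_le_pow_left h i)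

/-- An injective encoding of `T` by trees with leaves in `A`. -/
class Enc (A T : Type) where
  enc : T → PTree A
  inj : Function.Injective enc

/-- An embedding of a type into the set of leaves. -/
class Atoms (A T : Type) where
  atom : T → A
  inj : Function.Injective atom


open Enc (enc)

variable {α A : Type} {S T U V W : Type}

instance [Atoms A T] : Enc A T where
  enc x := .leaf (Atoms.atom x)
  inj _ _ h := Atoms.inj (PTree.leaf.inj h)

instance [Enc A T] [Enc A U] : Enc A (T × U) where
  enc x := .node (Enc.enc x.1) (Enc.enc x.2)
  inj x y h := by
    obtain ⟨h1, h2⟩ := PTree.node.inj h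
    exact Prod.ext (Enc.inj h1) (Enc.inj h2)

/-- The encoding of lists as nested pairs. -/
def encL [Atoms A Bool] [Enc A T] : List T → PTree A
  -- Any leaf would do: a nonempty list is an inner node.
  | [] => .leaf (Atoms.atom true)
  | x :: l => .node (Enc.enc x) (encL l)

theorem encL_injective [Atoms A Bool] [Enc A T] : Function.Injective (encL (A := A) (T := T)) := by
  intro l
  induction l with
  | nil => intro l' h; cases l' <;> simp_all [encL]
  | cons x l ih =>
    intro l' h
    cases l' with
    | nil => simp [encL] at h
    | cons y l' =>
      obtain ⟨h1, h2⟩ := PTree.node.inj h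
      rw [Enc.inj h1, ih h2]

instance [Atoms A Bool] [Enc A T] : Enc A (List T) where
  enc := encL
  inj := encL_injective

/-- The size of an encoded object. -/
def sz (A : Type) [Enc A T] (x : T) : ℕ := (Enc.enc x : PTree A).size

theorem sz_pos [Enc A T] (x : T) : 0 < sz A x := PTree.size_pos _
@[simp] theorem sz_atom [Atoms A T] (x : T) : sz A x = 1 := rfl
@[simp] theorem sz_pair [Enc A T] [Enc A U] (x : T × U) : sz A x = sz A x.1 + sz A x.2 + 1 :=
  PTree.size_node _ _
@[simp] theorem sz_nil [Atoms A Bool] [Enc A T] : sz A ([] : List T) = 1 := rfl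
@[simp] theorem sz_cons [Atoms A Bool] [Enc A T] (x : T) (l : List T) :
    sz A (x :: l) = sz A x + sz A l + 1 := PTree.size_node _ _

variable (α A) in
/-- `f` is computed by a program of the tree machine in polynomial time. -/
def PolyFun [Enc A T] [Enc A U] (f : T → U) : Prop :=
  ∃ (p : TProg α A) (t : Polynomial ℕ), ∀ x : T, sz A (f x) ≤ t.eval (sz A x) ∧
    ∀ i o m s v, ∃ n ≤ t.eval (sz A x), ∃ v',
      StackProg.Eval p v (mkS i o ((enc x).ser ++ m) s []) n v' (mkS i o ((enc (f x)).ser ++ m) s [])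

namespace PolyFun
open StackProg TProg

variable [Enc A S] [Enc A T] [Enc A U] [Enc A V] [Enc A W]

theorem id : PolyFun α A (fun x : T => x) :=
  ⟨.load _root_.id, Polynomial.X + 1, fun x => ⟨by simp, fun i o m s v =>
    ⟨1, by simp, v, Eval.load _ _ _⟩⟩⟩

/-- The size bound in `PolyFun` is needed here: the second program takes time polynomial in the size
of the intermediate value. -/
theorem comp {g : U → V} {f : T → U} (hg : PolyFun α A g) (hf : PolyFun α A f) :
    PolyFun α A (fun x => g (f x)) := by
  obtain ⟨p, t, hf⟩ := hf
  obtain ⟨q, t', hg⟩ := hg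
  refine ⟨.seq p q, t'.comp t + t, fun x => ?_⟩
  have hm := polynomial_eval_mono t' (hf x).1
  simp only [Polynomial.eval_add, Polynomial.eval_comp] at *
  refine ⟨((hg (f x)).1.trans hm).trans (Nat.le_add_right _ _), fun i o m s v => ?_⟩
  obtain ⟨n, hn, v1, h1⟩ := (hf x).2 i o m s v
  obtain ⟨n', hn', v2, h2⟩ := (hg (f x)).2 i o m s v1
  exact ⟨_, by omega, v2, h1.seq h2⟩

theorem of_eq {f g : T → U} (hf : PolyFun α A f) (h : ∀ x, f x = g x) : PolyFun α A g :=
  (funext h : f = g) ▸ hf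

/-- Push a fixed string on the main stack. -/
def pushList (l : List (Option A)) : TProg α A :=
  l.foldr (fun t p => .seq p (pushMain fun _ => t)) (.load _root_.id)

theorem eval_pushList (l : List (Option A)) (v : Mem α A) (i o m s c) :
    Eval (pushList l) v (mkS i o m s c) (l.length + 1) v (mkS i o (l ++ m) s c) := by
  induction l with
  | nil => exact Eval.load _ _ _
  | cons t l ih => rw [List.length_cons, add_comm _ 1]; exact ih.seq (eval_pushMain _)

theorem const (u : U) : PolyFun α A (fun _ : T => u) := by
  refine ⟨.seq dropTree (pushList (enc u).ser), 8 * Polynomial.X + Polynomial.C (sz A u + 3),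
    fun x => ⟨by simp; omega, fun i o m s v => ?_⟩⟩
  obtain ⟨n, hn, v', h⟩ := eval_dropTree (enc x) v i o m s
  refine ⟨_, ?_, v', h.seq (eval_pushList _ _ _ _ _ _ _)⟩
  simp [sz, PTree.size] at *; omega

/-- On the stack the first component has to lie above the second, and the node token above both. So
`g` is computed first, on a copy of the argument; after a swap `f` consumes the original, and the
token is pushed last. -/
theorem pair {f : T → U} {g : T → V} (hf : PolyFun α A f) (hg : PolyFun α A g) :
    PolyFun α A (fun x => (f x, g x)) := by
  obtain ⟨p, t, hf⟩ := hf
  obtain ⟨q, t', hg⟩ := hg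
  refine ⟨.seq dupTree (.seq q (.seq swapTree (.seq p (pushMain fun _ => none)))),
    14 * Polynomial.X + 11 * (Polynomial.X + t') + t + t' + 20, fun x => ?_⟩
  have h1 := (hf x).1
  have h2 := (hg x).1
  simp only [sz_pair, Polynomial.eval_add, Polynomial.eval_mul, Polynomial.eval_ofNat,
    Polynomial.eval_X]
  refine ⟨by omega, fun i o m s v => ?_⟩
  obtain ⟨n1, hn1, v1, e1⟩ := eval_dupTree (enc x) v i o m s
  obtain ⟨n2, hn2, v2, e2⟩ := (hg x).2 i o ((enc x).ser ++ m) s v1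
  obtain ⟨n3, hn3, v3, e3⟩ := eval_swapTree (enc (g x)) (enc x) v2 i o m s
  obtain ⟨n4, hn4, v4, e4⟩ := (hf x).2 i o ((enc (g x)).ser ++ m) s v3
  refine ⟨_, ?_, v4, e1.seq (e2.seq (e3.seq (e4.seq (by
    simpa [enc, PTree.ser] using eval_pushMain (fun _ => none)))))⟩
  simp only [sz] at *; omega

theorem fst : PolyFun α A (fun x : T × U => x.1) := by
  refine ⟨.seq popMain (.seq swapTree dropTree), 20 * Polynomial.X + 20, fun x => ?_⟩
  simp only [sz_pair, Polynomial.eval_add, Polynomial.eval_mul, Polynomial.eval_ofNat,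
    Polynomial.eval_X]
  refine ⟨by omega, fun i o m s v => ?_⟩
  have e1 := eval_popMain (i := i) (o := o) (s := s) (c := []) (v := v)
    (m := (enc x.1).ser ++ ((enc x.2).ser ++ m)) none
  obtain ⟨n2, hn2, v2, e2⟩ := eval_swapTree (enc x.1) (enc x.2) (setR true v (some (some none)))
    i o m s
  obtain ⟨n3, hn3, v3, e3⟩ := eval_dropTree (enc x.2) v2 i o ((enc x.1).ser ++ m) s
  refine ⟨_, ?_, v3, Eval.seq (by simpa [enc, PTree.ser] using e1) (e2.seq e3)⟩
  simp only [sz] at *; omega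

theorem snd : PolyFun α A (fun x : T × U => x.2) := by
  refine ⟨.seq popMain dropTree, 20 * Polynomial.X + 20, fun x => ?_⟩
  simp only [sz_pair, Polynomial.eval_add, Polynomial.eval_mul, Polynomial.eval_ofNat,
    Polynomial.eval_X]
  refine ⟨by omega, fun i o m s v => ?_⟩
  have e1 := eval_popMain (i := i) (o := o) (s := s) (c := []) (v := v)
    (m := (enc x.1).ser ++ ((enc x.2).ser ++ m)) none
  obtain ⟨n3, hn3, v3, e3⟩ := eval_dropTree (enc x.1) (setR true v (some (some none))) i o
    ((enc x.2).ser ++ m) s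
  refine ⟨_, ?_, v3, Eval.seq (by simpa [enc, PTree.ser] using e1) e3⟩
  simp only [sz] at *; omega

/-- A computation on an encoding is one on every object with that encoding. -/
theorem of_enc {f : T → U} (hf : PolyFun α A f) {g : S → U} (e : S → T)
    (he : ∀ x : S, (enc x : PTree A) = enc (e x)) (hg : ∀ x, g x = f (e x)) : PolyFun α A g := by
  obtain ⟨p, t, hf⟩ := hf
  refine ⟨p, t, fun x => ?_⟩
  have hs : sz A x = sz A (e x) := congrArg PTree.size (he x)
  rw [hg, hs, he]
  exact hf (e x)

/-- Constructing a list. -/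
theorem cons [Atoms A Bool] {f : T → U} {g : T → List U} (hf : PolyFun α A f)
    (hg : PolyFun α A g) : PolyFun α A (fun x => f x :: g x) := by
  obtain ⟨p, t, h⟩ := pair hf hg
  exact ⟨p, t, h⟩

/-- Copy the top token of the main stack into the first register. -/
def peekMain : TProg α A := .seq popMain (pushMain (tok true))

theorem eval_peekMain (t : Option A) (v : Mem α A) (i o m s c) :
    Eval peekMain v (mkS i o (t :: m) s c) 2 (setR true v (some (some t)))
      (mkS i o (t :: m) s c) := by
  have := (eval_popMain (v := v) (i := i) (o := o) (m := m) (s := s) (c := c) t).seq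
    (eval_pushMain (tok true))
  rw [tok_setR] at this
  exact this

/-- Case distinction on a list. -/
theorem listCases [Atoms A Bool] {f : T → List U} {g : T → V} {h : (U × List U) × T → V}
    (hf : PolyFun α A f) (hg : PolyFun α A g) (hh : PolyFun α A h) :
    PolyFun α A (fun x => match f x with
      | [] => g x
      | a :: l => h ((a, l), x)) := by
  suffices H : PolyFun α A (fun y : List U × T => match y.1 with
      | [] => g y.2
      | a :: l => h ((a, l), y.2)) from H.comp (hf.pair id)
  obtain ⟨p, t, hg⟩ := hg.comp (snd (T := List U) (U := T))
  obtain ⟨q, t', hh⟩ := hh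
  -- The node token of the pair is lifted to see the first token of the list and is put back. No
  -- rearrangement is needed in the second case, since a list cell is encoded like the pair of its
  -- head and tail.
  refine ⟨.seq popMain (.seq peekMain (.seq (pushMain fun _ => none) (.ite isNode q p))),
    t + t' + 5, fun y => ?_⟩
  simp only [Polynomial.eval_add, Polynomial.eval_ofNat]
  obtain ⟨l, x⟩ := y
  cases l with
  | nil =>
    have hg := hg ([], x)
    refine ⟨by have := hg.1; dsimp only at *; omega, fun i o m s v => ?_⟩
    have e1 := eval_popMain (i := i) (o := o) (s := s) (c := []) (v := v)
      (m := some (Atoms.atom true) :: ((enc x).ser ++ m)) none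
    have e2 := eval_peekMain (some (Atoms.atom true)) (setR true v (some (some none))) i o
      ((enc x).ser ++ m) s []
    obtain ⟨n, hn, v', e3⟩ := hg.2 i o m s
      (setR true (setR true v (some (some none))) (some (some (some (Atoms.atom true)))))
    refine ⟨_, ?_, v', Eval.seq (by simpa [enc, encL, PTree.ser] using e1) (e2.seq
      ((eval_pushMain _).seq ((Eval.iteFalse (by simp [isNode])
        (by simpa [enc, encL, PTree.ser] using e3)))))⟩
    omega
  | cons a l =>
    have hh := hh ((a, l), x)
    refine ⟨by simp at *; omega, fun i o m s v => ?_⟩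
    have e1 := eval_popMain (i := i) (o := o) (s := s) (c := []) (v := v)
      (m := none :: ((enc a).ser ++ (((enc l).ser ++ ((enc x).ser ++ m))))) none
    have e2 := eval_peekMain none (setR true v (some (some none))) i o
      ((enc a).ser ++ (((enc l).ser ++ ((enc x).ser ++ m)))) s []
    obtain ⟨n, hn, v', e3⟩ := hh.2 i o m s
      (setR true (setR true v (some (some none))) (some (some none)))
    refine ⟨_, ?_, v', Eval.seq (by simpa [enc, encL, PTree.ser] using e1) (e2.seq
      ((eval_pushMain _).seq ((Eval.iteTrue (by simp [isNode])
        (by simpa [enc, encL, PTree.ser] using e3)))))⟩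
    simp at *; omega

/-- Case distinction on an element of a finite type. -/
theorem finCases {F : Type} [Finite F] [Atoms A F] {k : T → F} {f : F → T → U}
    (hk : PolyFun α A k) (hf : ∀ a, PolyFun α A (f a)) : PolyFun α A (fun x => f (k x) x) := by
  classical
  suffices H : PolyFun α A (fun y : F × T => f y.1 y.2) from H.comp (hk.pair id)
  -- A chain of tests against the members of `l`, one after the other; the enumeration of `F` is
  -- inserted at the end. The time bounds of the branches add up to one polynomial because `F` is
  -- finite.
  have key : ∀ l : List F, ∃ (p : TProg α A) (t : Polynomial ℕ), ∀ a ∈ l, ∀ x : T,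
      sz A (f a x) ≤ t.eval (sz A x) ∧
      ∀ i o m s v, tok true v = some (Atoms.atom a) → ∃ n ≤ t.eval (sz A x), ∃ v',
      StackProg.Eval p v (mkS i o ((enc x).ser ++ m) s []) n v'
        (mkS i o ((enc (f a x)).ser ++ m) s []) := by
    intro l
    induction l with
    | nil => exact ⟨.load _root_.id, 0, by simp⟩
    | cons b l ih =>
      obtain ⟨p, t, hp⟩ := ih
      obtain ⟨q, t', hq⟩ := hf b
      refine ⟨.ite (fun v => tok true v = some (Atoms.atom b)) q p, t + t' + 1, ?_⟩
      intro a ha x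
      simp only [Polynomial.eval_add, Polynomial.eval_one]
      by_cases hab : a = b
      · subst hab
        refine ⟨by have := (hq x).1; omega, fun i o m s v hv => ?_⟩
        obtain ⟨n, hn, v', h⟩ := (hq x).2 i o m s v
        exact ⟨_, by omega, v', Eval.iteTrue (by simp [hv]) h⟩
      · have ha' : a ∈ l := by simpa [hab] using ha
        refine ⟨by have := (hp a ha' x).1; omega, fun i o m s v hv => ?_⟩
        obtain ⟨n, hn, v', h⟩ := (hp a ha' x).2 i o m s v hv
        exact ⟨_, by omega, v', Eval.iteFalse (by
          simp only [hv, Option.some.injEq, decide_eq_false_iff_not]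
          exact fun h => hab (Atoms.inj h)) h⟩
  have := Fintype.ofFinite F
  obtain ⟨p, t, hp⟩ := key Finset.univ.toList
  refine ⟨.seq popMain (.seq popMain p), t + 2, fun y => ?_⟩
  obtain ⟨a, x⟩ := y
  obtain ⟨h1, h2⟩ := hp a (by simp) x
  have hm := polynomial_eval_mono t (show sz A x ≤ sz A (a, x) by simp; omega)
  simp only [Polynomial.eval_add, Polynomial.eval_ofNat] at *
  refine ⟨by omega, fun i o m s v => ?_⟩
  have e1 := eval_popMain (i := i) (o := o) (s := s) (c := []) (v := v)
    (m := some (Atoms.atom a) :: ((enc x).ser ++ m)) none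
  have e2 := eval_popMain (i := i) (o := o) (s := s) (c := []) (v := setR true v (some (some none)))
    (m := (enc x).ser ++ m) (some (Atoms.atom a))
  obtain ⟨n, hn, v', e3⟩ := h2 i o m s _ (tok_setR true (v := setR true v (some (some none))) _)
  refine ⟨_, ?_, v', Eval.seq (by simpa [enc, PTree.ser] using e1) (e2.seq e3)⟩
  omega

/-- Compare the strings above the delimiters of the auxiliary stacks. -/
def cmpLoop [DecidableEq A] : TProg α A :=
  .loop (fun v => decide (v.r true = v.r false) && hasTok true v)
    (.seq (popAux true) (popAux false))

/-- The loop stops at the first difference or at a common delimiter, so at the end the two registers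
agree exactly if the strings do. In the invariant each register counts as the top of its stack. The
remainders `k` and `k'` above the delimiters are left to `eval_clear`. -/
theorem eval_cmpLoop [DecidableEq A] (l l' : List (Option A)) (a b i o m) :
    ∀ (s) (v : Mem α A) (x y : Option (Option A)), v.r true = some x → v.r false = some y →
    x :: s true = l.map some ++ none :: a → y :: s false = l'.map some ++ none :: b →
    ∃ n ≤ 3 * l.length + 3, ∃ (v' : Mem α A) (x' y' : Option (Option A))
      (s' : Bool → List (Option (Option A))) (k k' : List (Option A)),
      v'.r true = some x' ∧ v'.r false = some y' ∧ x' :: s' true = k.map some ++ none :: a ∧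
      y' :: s' false = k'.map some ++ none :: b ∧ k.length ≤ l.length ∧ k'.length ≤ l'.length ∧
      (v'.r true = v'.r false ↔ l = l') ∧
      Eval cmpLoop v (mkS i o m s []) n v' (mkS i o m s' []) := by
  induction l generalizing l' with
  | nil =>
    intro s v x y hx hy hs hs'
    have hx' : x = none := by simpa using (List.cons.inj hs).1
    refine ⟨1, by simp, v, x, y, s, [], l', hx, hy, hs, hs', le_rfl, le_rfl, ?_,
      Eval.loopDone (by simp [hasTok, hx, hx'])⟩
    cases l' with
    | nil => simp_all
    | cons t l' => simp_all
  | cons t l ih =>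
    intro s v x y hx hy hs hs'
    obtain ⟨hx', hs1⟩ := List.cons.inj hs
    by_cases hxy : x = y
    · cases l' with
      | nil =>
        obtain ⟨hy', hs2⟩ := List.cons.inj hs'
        exact absurd (hx'.symm.trans (hxy.trans hy')) (by simp)
      | cons t' l' =>
        obtain ⟨hy', hs2⟩ := List.cons.inj hs'
        have htt : t = t' := by simpa [hx', hy'] using hxy
        obtain ⟨x1, hx1⟩ : ∃ x1 r, s true = x1 :: r := by
          cases hst : s true with
          | nil => rw [hst] at hs1; simp at hs1
          | cons x1 r => exact ⟨x1, r, rfl⟩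
        obtain ⟨y1, hy1⟩ : ∃ y1 r, s false = y1 :: r := by
          cases hst : s false with
          | nil => rw [hst] at hs2; simp at hs2
          | cons x1 r => exact ⟨x1, r, rfl⟩
        obtain ⟨r1, hx1⟩ := hx1
        obtain ⟨r2, hy1⟩ := hy1
        have e1 := eval_popAux (i := i) (o := o) (m := m) (s := s) (c := []) (v := v) true x1 r1 hx1
        have e2 := eval_popAux (i := i) (o := o) (m := m) (s := Function.update s true r1) (c := [])
          (v := setR true v (some x1)) false y1 r2 (by simp [hy1])
        obtain ⟨n, hn, v', x', y', s', k, k', h1, h2, h3, h4, h5, h6, h7, e3⟩ := ih l'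
          (Function.update (Function.update s true r1) false r2)
          (setR false (setR true v (some x1)) (some y1)) x1 y1 (by simp [setR]) (by simp)
          (by simpa [hx1] using hs1) (by simpa [hy1] using hs2)
        refine ⟨n + ((1 + 1) + 1), by simp; omega, v', x', y', s', k, k', h1, h2, h3, h4, by simp; omega,
          by simp; omega, by simp [h7, htt], Eval.loopNext ?_ (e1.seq e2) e3⟩
        simp [hasTok, hx, hy, ← hxy, hx']
    · refine ⟨1, by simp, v, x, y, s, t :: l, l', hx, hy, hs, hs', le_rfl, le_rfl, ?_,
        Eval.loopDone (by simp [hx, hy, hxy])⟩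
      simp only [hx, hy, Option.some.injEq, hxy, false_iff]
      rintro rfl
      exact hxy (hx'.trans (List.cons.inj hs').1.symm)

/-- Pop an auxiliary stack up to the delimiter, starting from the symbol in the register. -/
theorem eval_clear (b : Bool) (l : List (Option A)) (a i o m) :
    ∀ (s) (v : Mem α A) (x : Option (Option A)), v.r b = some x →
    x :: s b = l.map some ++ none :: a → ∃ n ≤ 2 * l.length + 1, ∃ v' : Mem α A,
    (v'.flag = v.flag) ∧ v'.r (!b) = v.r (!b) ∧
    Eval (.loop (hasTok b) (popAux b)) v (mkS i o m s []) n v'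
      (mkS i o m (Function.update s b a) []) := by
  induction l with
  | nil =>
    intro s v x hx hs
    obtain ⟨hx', hsa⟩ := List.cons.inj hs
    have hsa : s b = a := hsa
    subst hx'
    have : Function.update s b a = s := by rw [← hsa]; simp
    rw [this]
    exact ⟨1, by simp, v, rfl, rfl, Eval.loopDone (by simp [hasTok, hx])⟩
  | cons t l ih =>
    intro s v x hx hs
    obtain ⟨hx', hs⟩ := List.cons.inj hs
    obtain ⟨y, r, hr⟩ : ∃ y r, s b = y :: r := by
      cases hst : s b with
      | nil => rw [hst] at hs; simp at hs
      | cons x1 r => exact ⟨x1, r, rfl⟩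
    have e1 := eval_popAux (i := i) (o := o) (m := m) (s := s) (c := []) (v := v) b y r hr
    obtain ⟨n, hn, v', h1, h2, e2⟩ := ih (Function.update s b r) (setR b v (some y)) y (by simp)
      (by simpa [hr] using hs)
    refine ⟨n + (1 + 1), by simp; omega, v', by simpa using h1, by simpa using h2,
      Eval.loopNext (by simp [hasTok, hx, hx']) e1 (by simpa using e2)⟩

/-- Equality test. -/
theorem eqTest [Atoms A Bool] {f g : T → U} (hf : PolyFun α A f) (hg : PolyFun α A g)
    [DecidableEq U] : PolyFun α A (fun x => decide (f x = g x)) := by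
  classical
  suffices H : PolyFun α A (fun y : U × U => decide (y.1 = y.2)) from H.comp (hf.pair hg)
  refine ⟨.seq popMain (.seq (stash true) (.seq (stash false) (.seq (.seq (popAux true) (popAux false))
    (.seq cmpLoop (.seq (.load fun v => { v with flag := decide (v.r true = v.r false) })
    (.seq (.loop (hasTok true) (popAux true)) (.seq (.loop (hasTok false) (popAux false))
    (pushMain fun v => some (Atoms.atom v.flag))))))))), 30 * Polynomial.X + 30, fun y => ?_⟩
  obtain ⟨x, y⟩ := y
  simp only [Polynomial.eval_add, Polynomial.eval_mul, Polynomial.eval_ofNat, Polynomial.eval_X]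
  refine ⟨by simp, fun i o m s v => ?_⟩
  have e1 := eval_popMain (i := i) (o := o) (s := s) (c := []) (v := v)
    (m := (enc x).ser ++ ((enc y).ser ++ m)) none
  obtain ⟨n2, hn2, v2, e2⟩ := eval_stash true (enc x) (setR true v (some (some none))) i o
    ((enc y).ser ++ m) s
  obtain ⟨n3, hn3, v3, e3⟩ := eval_stash false (enc y) v2 i o m
    (Function.update s true ((enc x).ser.reverse.map some ++ none :: s true))
  set s1 : Bool → List (Option (Option A)) := Function.update (Function.update s true
    ((enc x).ser.reverse.map some ++ none :: s true)) false
    ((enc y).ser.reverse.map some ++ none :: Function.update s true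
      ((enc x).ser.reverse.map some ++ none :: s true) false) with hs1
  have st : s1 true = (enc x).ser.reverse.map some ++ none :: s true := by simp [hs1]
  have sf : s1 false = (enc y).ser.reverse.map some ++ none :: s false := by simp [hs1]
  obtain ⟨x1, r1, hx1⟩ : ∃ x1 r, s1 true = x1 :: r := by
    cases h : s1 true with
    | nil => rw [h] at st; simp at st
    | cons x1 r => exact ⟨x1, r, rfl⟩
  obtain ⟨y1, r2, hy1⟩ : ∃ x1 r, s1 false = x1 :: r := by
    cases h : s1 false with
    | nil => rw [h] at sf; simp at sf
    | cons x1 r => exact ⟨x1, r, rfl⟩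
  have e4 := eval_popAux (i := i) (o := o) (m := m) (c := []) (v := v3) true x1 r1 hx1
  have e5 := eval_popAux (i := i) (o := o) (m := m) (s := Function.update s1 true r1) (c := [])
    (v := setR true v3 (some x1)) false y1 r2 (by simp [hy1])
  obtain ⟨n6, hn6, v6, x6, y6, s6, k, k', h1, h2, h3, h4, h5, h6, h7, e6⟩ :=
    eval_cmpLoop (α := α) (enc x).ser.reverse (enc y).ser.reverse (s true) (s false) i o m
    (Function.update (Function.update s1 true r1) false r2)
    (setR false (setR true v3 (some x1)) (some y1)) x1 y1 (by simp [setR]) (by simp)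
    (by simpa [← hx1] using st) (by simpa [← hy1] using sf)
  have e7 := Eval.load (Γ := StkΓ α A)
    (fun v : Mem α A => { v with flag := decide (v.r true = v.r false) }) v6 (mkS i o m s6 [])
  obtain ⟨n8, hn8, v8, hf8, hr8, e8⟩ := eval_clear true k (s true) i o m s6
    { v6 with flag := decide (v6.r true = v6.r false) } x6 h1 h3
  obtain ⟨n9, hn9, v9, hf9, hr9, e9⟩ := eval_clear false k' (s false) i o m
    (Function.update s6 true (s true)) v8 y6 (by simpa [h2] using hr8) (by simpa using h4)
  have hs : Function.update (Function.update s6 true (s true)) false (s false) = s := by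
    rw [update_both]; funext b; cases b <;> rfl
  rw [hs] at e9
  have e10 := eval_pushMain (i := i) (o := o) (m := m) (s := s) (c := []) (v := v9)
    fun v => some (Atoms.atom v.flag)
  have hfl : v9.flag = decide (x = y) := by
    rw [hf9, hf8]
    simp only [h7, List.reverse_inj, decide_eq_decide]
    -- Equality of token strings is equality of objects because both `ser` and `enc` are injective.
    exact ⟨fun h => Enc.inj (PTree.ser_injective h), fun h => h ▸ rfl⟩
  refine ⟨_, ?_, v9, Eval.seq (by simpa [enc, PTree.ser] using e1) (e2.seq (e3.seq ((e4.seq e5).seq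
    (e6.seq (e7.seq (e8.seq (e9.seq (by simpa [enc, PTree.ser, hfl] using e10))))))))⟩
  simp only [List.length_reverse, sz_pair] at *
  simp only [sz, PTree.size] at *
  omega

/-- Bounded iteration. -/
theorem iterate [Atoms A Bool] {f : V → V} (hf : PolyFun α A f) (q : Polynomial ℕ)
    {l : T → List U} {b : T → V} (hl : PolyFun α A l) (hb : PolyFun α A b)
    (hq : ∀ x, ∀ i ≤ (l x).length, sz A (f^[i] (b x)) ≤ q.eval (sz A x)) :
    PolyFun α A (fun x => f^[(l x).length] (b x)) := by
  obtain ⟨p1, t1, h1⟩ := hl.pair hb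
  obtain ⟨p, t, hf⟩ := hf
  have len_le : ∀ l : List U, l.length ≤ sz A l := by
    intro l
    induction l with
    | nil => simp
    | cons a l ih => simp; omega
  -- The list is only a clock. It lies above the value, so each round drops its head, stashes the
  -- rest, runs `p`, and brings the rest back. `B` bounds all intermediate values and `N` the clock;
  -- moving the clock accounts for `19 * N`.
  have loop : ∀ (i o m s) (B N : ℕ) (l : List U) (x : V) (v : Mem α A),
      (∀ i ≤ l.length, sz A (f^[i] x) ≤ B) → sz A l ≤ N → tok true v = (enc l).ser.head?.getD none →
      ∃ n ≤ l.length * (t.eval B + 19 * N + 30) + 1, ∃ v' : Mem α A,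
      Eval (.loop isNode (.seq popMain (.seq dropTree (.seq (stash true) (.seq p
        (.seq (unstash true) peekMain)))))) v (mkS i o ((enc l).ser ++ ((enc x).ser ++ m)) s [])
        n v' (mkS i o ((enc ([] : List U)).ser ++ ((enc (f^[l.length] x)).ser ++ m)) s []) := by
    intro i o m s B N l
    induction l with
    | nil =>
      intro x v _ _ hv
      exact ⟨1, by simp, v, Eval.loopDone (by simp [isNode, hv, enc, encL, PTree.ser])⟩
    | cons a l ih =>
      intro x v hB hN hv
      have e1 := eval_popMain (i := i) (o := o) (s := s) (c := []) (v := v)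
        (m := (enc a).ser ++ ((enc l).ser ++ ((enc x).ser ++ m))) none
      obtain ⟨n2, hn2, v2, e2⟩ := eval_dropTree (enc a) (setR true v (some (some none))) i o
        ((enc l).ser ++ ((enc x).ser ++ m)) s
      obtain ⟨n3, hn3, v3, e3⟩ := eval_stash true (enc l) v2 i o ((enc x).ser ++ m) s
      obtain ⟨n4, hn4, v4, e4⟩ := (hf x).2 i o m
        (Function.update s true ((enc l).ser.reverse.map some ++ none :: s true)) v3
      obtain ⟨n5, hn5, v5, e5⟩ := eval_unstash true (enc l) (s true) v4 i o ((enc (f x)).ser ++ m)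
        (Function.update s true ((enc l).ser.reverse.map some ++ none :: s true)) [] (by simp)
      have hs : Function.update (Function.update s true ((enc l).ser.reverse.map some ++ none :: s true))
        true (s true) = s := by simp
      rw [hs] at e5
      obtain ⟨t0, r0, hr0⟩ : ∃ t0 r0, (enc l : PTree A).ser = t0 :: r0 := by
        cases h : (enc l : PTree A) with
        | leaf a => exact ⟨_, _, rfl⟩
        | node x y => exact ⟨_, _, rfl⟩
      have e6 := eval_peekMain t0 v5 i o (r0 ++ ((enc (f x)).ser ++ m)) s []
      rw [← List.cons_append, ← hr0] at e6
      simp only [sz_cons] at hN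
      obtain ⟨n7, hn7, v7, e7⟩ := ih (f x) (setR true v5 (some (some t0)))
        (fun i hi => by simpa using hB (i + 1) (by simpa using hi)) (by omega) (by simp [hr0])
      refine ⟨_, ?_, v7, Eval.loopNext (by simp [isNode, hv, enc, encL, PTree.ser])
        (Eval.seq (by simpa [enc, encL, PTree.ser] using e1)
          (e2.seq (e3.seq (e4.seq (e5.seq e6))))) e7⟩
      have := polynomial_eval_mono t (hB 0 (by simp))
      simp only [Function.iterate_zero, _root_.id] at this
      rw [List.length_cons, Nat.succ_mul]
      simp only [sz] at *
      omega
  refine ⟨.seq p1 (.seq popMain (.seq peekMain (.seq (.loop isNode (.seq popMain (.seq dropTree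
    (.seq (stash true) (.seq p (.seq (unstash true) peekMain)))))) dropTree))),
    q + t1 + t1 * (t.comp q + 19 * t1 + 30) + 20, fun x => ?_⟩
  simp only [Polynomial.eval_add, Polynomial.eval_ofNat, Polynomial.eval_mul, Polynomial.eval_comp]
  refine ⟨by have := hq x _ le_rfl; omega, fun i o m s v => ?_⟩
  obtain ⟨n1, hn1, v1, e1⟩ := (h1 x).2 i o m s v
  have hsz := (h1 x).1
  have e2 := eval_popMain (i := i) (o := o) (s := s) (c := []) (v := v1)
    (m := (enc (l x)).ser ++ ((enc (b x)).ser ++ m)) none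
  obtain ⟨t0, r0, hr0⟩ : ∃ t0 r0, (enc (l x) : PTree A).ser = t0 :: r0 := by
    cases h : (enc (l x) : PTree A) with
    | leaf a => exact ⟨_, _, rfl⟩
    | node x y => exact ⟨_, _, rfl⟩
  have e3 := eval_peekMain t0 (setR true v1 (some (some none))) i o
    (r0 ++ ((enc (b x)).ser ++ m)) s []
  rw [← List.cons_append, ← hr0] at e3
  obtain ⟨n4, hn4, v4, e4⟩ := loop i o m s (q.eval (sz A x)) (t1.eval (sz A x)) (l x) (b x)
    (setR true (setR true v1 (some (some none))) (some (some t0)))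
    (fun i hi => hq x i hi) (by simp at hsz; omega) (by simp [hr0])
  obtain ⟨n5, hn5, v5, e5⟩ := eval_dropTree (enc ([] : List U)) v4 i o
    ((enc (f^[(l x).length] (b x))).ser ++ m) s
  refine ⟨_, ?_, v5, e1.seq (Eval.seq (by simpa [enc, PTree.ser] using e2) (e3.seq (e4.seq e5)))⟩
  have h6 : (l x).length ≤ t1.eval (sz A x) := (len_le _).trans (by simp at hsz; omega)
  have h7 := Nat.mul_le_mul_right (t.eval (q.eval (sz A x)) + 19 * t1.eval (sz A x) + 30) h6
  have h8 : (enc ([] : List U) : PTree A).size = 1 := rfl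
  omega

end PolyFun
end PolyFunctions
end LogspaceRelations

namespace LogspaceRelations

/-! ### From the tree machine to Turing machines on words -/

section PolyTimeFunctions

open Enc (enc)
open StackProg TProg

variable {α A : Type}

namespace TProg

/-- Pop a letter from the input stack. -/
def popInp : TProg α A := pop Stk.inp fun v t => { v with letter := t }

/-- Pop a letter from the output stack. -/
def popOut : TProg α A := pop Stk.out fun v t => { v with letter := t }

/-- Whether there is a letter in the register. -/
def hasLetter (v : Mem α A) : Bool := v.letter.isSome

theorem eval_popInp (x : List α) (v : Mem α A) (o m s c) :
    Eval popInp v (mkS x o m s c) 1 { v with letter := x.head? } (mkS x.tail o m s c) :=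
  (Eval.pop (Γ := StkΓ α A) Stk.inp (fun (v : Mem α A) t => { v with letter := t }) v (mkS x o m s c)).congr_right
    (update_inp x.tail)

theorem eval_popOut (x : List α) (v : Mem α A) (i m s c) :
    Eval popOut v (mkS i x m s c) 1 { v with letter := x.head? } (mkS i x.tail m s c) :=
  (Eval.pop (Γ := StkΓ α A) Stk.out (fun (v : Mem α A) t => { v with letter := t }) v (mkS i x m s c)).congr_right
    (update_out x.tail)

theorem eval_pushInp (f : Mem α A → α) (v : Mem α A) (i o) (m : List (Option A)) (s c) :
    Eval (push Stk.inp f) v (mkS i o m s c) 1 v (mkS (f v :: i) o m s c) :=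
  (Eval.push Stk.inp f v (mkS i o m s c)).congr_right (update_inp (f v :: i))

theorem eval_pushOut (f : Mem α A → α) (v : Mem α A) (i o) (m : List (Option A)) (s c) :
    Eval (push Stk.out f) v (mkS i o m s c) 1 v (mkS i (f v :: o) m s c) :=
  (Eval.push Stk.out f v (mkS i o m s c)).congr_right (update_out (f v :: o))

/-- Move the input stack to the output stack. -/
def inpToOut [Inhabited α] : TProg α A :=
  seq popInp (loop hasLetter (seq (push Stk.out fun v => v.letter.getD default) popInp))

theorem eval_inpToOut [Inhabited α] (x : List α) (m : List (Option A)) (s c) : ∀ (v : Mem α A) (o), ∃ v',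
    Eval inpToOut v (mkS x o m s c) (3 * x.length + 2) v' (mkS [] (x.reverse ++ o) m s c) := by
  induction x with
  | nil =>
    intro v o
    exact ⟨_, (eval_popInp [] v o m s c).seq (Eval.loopDone (by simp [hasLetter]))⟩
  | cons a x ih =>
    intro v o
    obtain ⟨v', h⟩ := ih { v with letter := some a } (a :: o)
    generalize hN : 3 * x.length + 2 = N at h
    -- As for `unstash`, the first pop of the inductive evaluation is the last action of the present
    -- round.
    cases h with
    | @seq _ _ _ _ n1 v1 S1 n2 _ _ h3 h4 =>
    refine ⟨v', ?_⟩
    have := (eval_popInp (a :: x) v o m s c).seq (Eval.loopNext (by simp [hasLetter])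
      ((eval_pushOut (fun v => v.letter.getD default) _ _ _ _ _ _).seq h3) h4)
    unfold inpToOut
    simpa [← hN, show n2 + (n1 + 1 + 1) + 1 = 3 * (a :: x).length + 2 by simp; omega] using this

variable [Atoms A α] [Atoms A Bool]

/-- Encode the word on the output stack, read from the end. -/
def encodeOut [Inhabited α] : TProg α A :=
  seq (pushMain fun _ => some (Atoms.atom true)) (seq popOut (loop hasLetter
    (seq (pushMain fun v => some (Atoms.atom (v.letter.getD default)))
      (seq (pushMain fun _ => none) popOut))))

theorem eval_encodeOut [Inhabited α] (x : List α) (i m s c) (v : Mem α A) : ∃ v',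
    Eval encodeOut v (mkS i x.reverse m s c) (4 * x.length + 3) v'
      (mkS i [] ((enc x).ser ++ m) s c) := by
  suffices H : ∀ (x y : List α) (v : Mem α A), v.letter = x.head? → ∃ v',
      Eval (loop hasLetter
        (seq (pushMain fun v => some (Atoms.atom (v.letter.getD default)))
        (seq (pushMain fun _ => none) popOut))) v (mkS i x.tail ((enc y).ser ++ m) s c)
        (4 * x.length + 1) v' (mkS i [] ((enc (x.reverse ++ y)).ser ++ m) s c) by
    obtain ⟨v', h⟩ := H x.reverse [] { v with letter := x.reverse.head? } rfl
    refine ⟨v', ?_⟩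
    have := (eval_pushMain (v := v) (i := i) (o := x.reverse) (m := m) (s := s) (c := c)
      (fun _ => some (Atoms.atom true))).seq ((eval_popOut x.reverse v i _ s c).seq h)
    unfold encodeOut
    simpa using this
  intro x
  induction x with
  | nil => intro y v hv; exact ⟨v, Eval.loopDone (by simp [hasLetter, hv])⟩
  | cons a x ih =>
    intro y v hv
    obtain ⟨v', h⟩ := ih (a :: y) { v with letter := x.head? } rfl
    refine ⟨v', ?_⟩
    have h1 := eval_pushMain (v := v) (i := i) (o := x) (m := (enc y).ser ++ m) (s := s) (c := c)
      (fun v => some (Atoms.atom (v.letter.getD default)))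
    have hv' : v.letter = some a := hv
    rw [hv', Option.getD_some] at h1
    have h2 := eval_pushMain (v := v) (i := i) (o := x) (s := s) (c := c)
      (m := some (Atoms.atom a) :: ((enc y).ser ++ m)) (fun _ => none)
    have := Eval.loopNext (c := hasLetter) (by simp [hasLetter, hv])
      (h1.seq (h2.seq (eval_popOut x v i _ s c)))
      (by simpa [enc, encL, PTree.ser] using h)
    simpa [enc, show 4 * x.length + 1 + (1 + 1 + 1 + 1) = 4 * (a :: x).length + 1 by simp; omega]
      using this

/-- The letter of a leaf. -/
noncomputable def letterOf [Inhabited α] (v : Mem α A) : α :=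
  Function.invFun (fun a : α => (some (Atoms.atom a) : Option A)) (tok true v)

/-- Write the encoded word on the input stack, reversed. -/
noncomputable def decodeMain [Inhabited α] : TProg α A :=
  seq popMain (loop isNode (seq popMain (seq (push Stk.inp letterOf) popMain)))

theorem eval_decodeMain [Inhabited α] (y : List α) (o m s c) : ∀ (v : Mem α A) (i), ∃ v',
    Eval decodeMain v (mkS i o ((enc y).ser ++ m) s c) (4 * y.length + 2) v'
      (mkS (y.reverse ++ i) o m s c) := by
  induction y with
  | nil =>
    intro v i
    exact ⟨_, (eval_popMain (some (Atoms.atom true))).seq (Eval.loopDone (by simp [isNode]))⟩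
  | cons a y ih =>
    intro v i
    set v1 := setR true (setR true v (some (some none))) (some (some (some (Atoms.atom a)))) with hv1
    have hl : letterOf v1 = a := by
      simp only [letterOf, hv1, tok_setR]
      -- Injectivity of atoms makes `invFun` recover the letter; on other tokens its value is
      -- irrelevant.
      exact Function.leftInverse_invFun (f := fun a : α => (some (Atoms.atom a) : Option A))
        (fun a b h => Atoms.inj (Option.some.inj h)) a
    obtain ⟨v', h⟩ := ih v1 (a :: i)
    generalize hN : 4 * y.length + 2 = N at h
    cases h with
    | @seq _ _ _ _ n1 v2 S1 n2 _ _ h3 h4 =>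
    refine ⟨v', ?_⟩
    have h5 := eval_pushInp letterOf v1 i o ((enc y).ser ++ m) s c
    rw [hl] at h5
    have := (eval_popMain (v := v) (i := i) (o := o) (s := s) (c := c)
      (m := some (Atoms.atom a) :: ((enc y).ser ++ m)) none).seq (Eval.loopNext (by simp [isNode])
      ((eval_popMain (some (Atoms.atom a))).seq (h5.seq h3)) h4)
    unfold decodeMain
    simpa [← hN, enc, encL, PTree.ser,
      show n2 + (n1 + 1 + 1 + 1) + 1 = 4 * (a :: y).length + 2 by simp; omega] using this

end TProg

theorem sz_word [Atoms A α] [Atoms A Bool] (x : List α) : sz A x = 2 * x.length + 1 := by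
  induction x with
  | nil => rfl
  | cons a x ih => simp [ih]; omega

theorem mkS_inp (x : List α) :
    (mkS x [] [] (fun _ => []) [] : ∀ k, List (StkΓ α A k)) =
      Function.update (β := fun k => List (StkΓ α A k)) (fun _ => []) Stk.inp x := by
  funext k; cases k <;> rfl

theorem mkS_out (x : List α) :
    (mkS [] x [] (fun _ => []) [] : ∀ k, List (StkΓ α A k)) =
      Function.update (β := fun k => List (StkΓ α A k)) (fun _ => []) Stk.out x := by
  funext k; cases k <;> rfl

/-- Functions on words that the tree machine computes in polynomial time are computed by Turing
machines in polynomial time. -/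
theorem PolyFun.polyTime [Fintype α] [Inhabited α] [Finite A] [Atoms A α] [Atoms A Bool]
    {f : List α → List α} (hf : PolyFun α A f) : PolyTime f := by
  have := Fintype.ofFinite A
  obtain ⟨p, t, hp⟩ := hf
  -- Moving the input to the second stack reverses it, so that the list cells are built from the
  -- last letter on. The result is decoded in reversed order and reversed once more by the last
  -- move.
  let P : TProg α A := seq inpToOut (seq encodeOut (seq p (seq decodeMain inpToOut)))
  let v₀ : Mem α A := ⟨fun _ => none, false, none⟩
  let _ : Fintype (StkΓ α A Stk.inp) := inferInstanceAs (Fintype α)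
  -- The size of an encoded word of length `n` is `2 * n + 1`. The term with `7` pays for reading
  -- the input; the value of `t` bounds the time of `p` and the size of the result, hence also the
  -- time for writing it.
  let T : Polynomial ℕ := 7 * Polynomial.X + 8 * t.comp (2 * Polynomial.X + 1) + 20
  have key : ∀ x : List α, ∃ n ≤ T.eval x.length, ∃ v',
      Eval P v₀ (mkS x [] [] (fun _ => []) []) n v' (mkS [] (f x) [] (fun _ => []) []) ∧
      n + 1 ≤ T.eval x.length := by
    intro x
    obtain ⟨v1, e1⟩ := eval_inpToOut (A := A) x [] (fun _ => []) [] v₀ []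
    obtain ⟨v2, e2⟩ := eval_encodeOut (A := A) x [] [] (fun _ => []) [] v1
    obtain ⟨h, hp⟩ := hp x
    obtain ⟨n3, hn3, v3, e3⟩ := hp [] [] [] (fun _ => []) v2
    obtain ⟨v4, e4⟩ := eval_decodeMain (A := A) (f x) [] [] (fun _ => []) [] v3 []
    obtain ⟨v5, e5⟩ := eval_inpToOut (A := A) (f x).reverse [] (fun _ => []) [] v4 []
    rw [sz_word] at h hn3
    rw [sz_word] at h
    have e := e1.seq ((by simpa using e2 : Eval encodeOut v1 (mkS [] (x.reverse ++ []) [] _ [])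
      _ v2 _).seq (e3.seq (e4.seq (by simpa using e5))))
    refine ⟨_, ?_, v5, e, ?_⟩ <;>
    · simp only [T, Polynomial.eval_add, Polynomial.eval_mul, Polynomial.eval_ofNat,
        Polynomial.eval_comp, Polynomial.eval_X, Polynomial.eval_one]
      omega
  refine ⟨{ tm := P.toTM v₀ Stk.inp Stk.out, inputAlphabet := Equiv.refl α
            outputAlphabet := Equiv.refl α, time := T, outputsFun := fun x => ?_ }⟩
  refine ⟨⟨(key x).choose + 1, ?_⟩, (key x).choose_spec.2.choose_spec.2⟩
  have e := (key x).choose_spec.2.choose_spec.1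
  have := Eval.tm_outputs (v₀ := v₀) (x := x) (y := f x) (k₀ := Stk.inp) (k₁ := Stk.out) e
    (mkS_inp x) (mkS_out (f x))
  have hx : ∀ l : List α, List.map (Equiv.refl α).invFun l = l := fun l => List.map_id l
  let M := P.toTM v₀ Stk.inp Stk.out
  exact (congrArg (fun l : List α => (flip Bind.bind M.step)^[(key x).choose + 1]
    (some (Turing.initList M l))) (hx x)).trans (this.trans
      (congrArg (fun l : List α => some (Turing.haltList M l)) (hx (f x))).symm)

end PolyTimeFunctions
end LogspaceRelations

namespace LogspaceRelations

/-! ### List operations in polynomial time -/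

section PolyLists

open Enc (enc)

variable {α A : Type} {S T U V W : Type}

section Sizes

variable [Atoms A Bool] [Enc A T]

theorem sz_append (l l' : List T) : sz A (l ++ l') + 1 = sz A l + sz A l' := by
  induction l with
  | nil => simp [add_comm]
  | cons a l ih => simp only [List.cons_append, sz_cons]; omega

theorem sz_reverse (l : List T) : sz A l.reverse = sz A l := by
  induction l with
  | nil => rfl
  | cons a l ih =>
    have := sz_append (A := A) l.reverse [a]
    simp only [List.reverse_cons, sz_cons, sz_nil] at *; omega

theorem length_lt_sz (l : List T) : l.length < sz A l := by
  induction l with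
  | nil => simp
  | cons a l ih => simp; omega

theorem sz_le_of_mem {l : List T} {a : T} (h : a ∈ l) : sz A a < sz A l := by
  induction l with
  | nil => simp at h
  | cons b l ih =>
    rw [sz_cons]
    rcases List.mem_cons.1 h with rfl | h
    · have := sz_pos (A := A) l; omega
    · have := ih h; omega

theorem sz_le_of_forall {l : List T} {B : ℕ} (h : ∀ a ∈ l, sz A a ≤ B) :
    sz A l ≤ l.length * (B + 1) + 1 := by
  induction l with
  | nil => simp
  | cons a l ih =>
    have h1 := h a (by simp)
    have h2 := ih fun b hb => h b (by simp [hb])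
    simp only [sz_cons, List.length_cons, Nat.succ_mul]; omega

theorem sz_take_le (l : List T) (i : ℕ) : sz A (l.take i) ≤ sz A l := by
  have := sz_append (A := A) (l.take i) (l.drop i)
  rw [List.take_append_drop] at this
  have := sz_pos (A := A) (l.drop i); omega

theorem sz_drop_le (l : List T) (i : ℕ) : sz A (l.drop i) ≤ sz A l := by
  have := sz_append (A := A) (l.take i) (l.drop i)
  rw [List.take_append_drop] at this
  have := sz_pos (A := A) (l.take i); omega

end Sizes

namespace PolyFun

variable [Enc A S] [Enc A T] [Enc A U] [Enc A V] [Enc A W]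

theorem size_le {f : T → U} (hf : PolyFun α A f) :
    ∃ t : Polynomial ℕ, ∀ x, sz A (f x) ≤ t.eval (sz A x) := by
  obtain ⟨p, t, h⟩ := hf
  exact ⟨t, fun x => (h x).1⟩

variable [Atoms A Bool]

/-- Folding over a list. -/
theorem foldl {l : T → List U} {b : T → V} {f : V → U → T → V} (hl : PolyFun α A l)
    (hb : PolyFun α A b) (hf : PolyFun α A (fun p : (V × U) × T => f p.1.1 p.1.2 p.2))
    (q : Polynomial ℕ)
    (hq : ∀ x i, sz A (((l x).take i).foldl (fun b a => f b a x) (b x)) ≤ q.eval (sz A x)) :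
    PolyFun α A (fun x => (l x).foldl (fun b a => f b a x) (b x)) := by
  -- The state of the iteration consists of the rest of the list, the accumulator and the parameter;
  -- the list itself is also the clock. Its intermediate accumulators are the folds over prefixes
  -- that `hq` bounds.
  let step : List U × (V × T) → List U × (V × T) := fun s =>
    match s.1 with
    | [] => s
    | a :: l' => (l', f s.2.1 a s.2.2, s.2.2)
  have hstep : PolyFun α A step := by
    refine (listCases (h := fun p : (U × List U) × (List U × (V × T)) =>
      (p.1.2, f p.2.2.1 p.1.1 p.2.2.2, p.2.2.2)) fst id ?_)
    refine (snd.comp fst).pair (pair (hf.comp (pair (pair ?_ ?_) ?_)) ?_)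
    · exact fst.comp (snd.comp snd)
    · exact fst.comp fst
    · exact snd.comp (snd.comp snd)
    · exact snd.comp (snd.comp snd)
  have hit : ∀ (x : T) (l : List U) (b : V) (i : ℕ), step^[i] (l, b, x) =
      (l.drop i, (l.take i).foldl (fun b a => f b a x) b, x) := by
    intro x l b i
    induction i generalizing l b with
    | zero => simp
    | succ i ih =>
      cases l with
      | nil => simpa [step] using ih [] b
      | cons a l => simpa [step] using ih l (f b a x)
  obtain ⟨t, ht⟩ := hl.size_le
  refine of_eq (fst.comp (snd.comp (iterate hstep (t + q + Polynomial.X + 2) hl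
    (hl.pair (hb.pair id)) fun x i hi => ?_))) fun x => ?_
  · rw [hit]
    simp only [sz_pair, Polynomial.eval_add, Polynomial.eval_X, Polynomial.eval_ofNat]
    have h1 := (sz_drop_le (A := A) (l x) i).trans (ht x)
    have h2 := hq x i
    omega
  · rw [hit]; simp

theorem reverse {l : T → List U} (hl : PolyFun α A l) : PolyFun α A (fun x => (l x).reverse) := by
  suffices H : PolyFun α A (fun l : List U => l.reverse) from H.comp hl
  have h : ∀ l b : List U, l.foldl (fun b a => a :: b) b = l.reverse ++ b := by
    intro l; induction l with
    | nil => simp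
    | cons a l ih => intro b; simp [ih]
  refine of_eq (foldl (f := fun (b : List U) a (_ : List U) => a :: b) (b := fun _ => []) id (const [])
    (cons (snd.comp fst) (fst.comp fst)) Polynomial.X fun l i => ?_) fun l => ?_
  · rw [h, List.append_nil, sz_reverse, Polynomial.eval_X]; exact sz_take_le l i
  · simp

theorem append {l l' : T → List U} (hl : PolyFun α A l) (hl' : PolyFun α A l') :
    PolyFun α A (fun x => l x ++ l' x) := by
  have h : ∀ l b : List U, l.foldl (fun b a => a :: b) b = l.reverse ++ b := by
    intro l; induction l with
    | nil => simp
    | cons a l ih => intro b; simp [ih]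
  obtain ⟨t, ht⟩ := hl.size_le
  obtain ⟨t', ht'⟩ := hl'.size_le
  refine of_eq (foldl (f := fun (b : List U) a (_ : T) => a :: b) hl.reverse hl'
    (cons (snd.comp fst) (fst.comp fst)) (t + t') fun x i => ?_) fun x => ?_
  · rw [h, Polynomial.eval_add]
    have h1 := sz_append (A := A) ((l x).reverse.take i).reverse (l' x)
    rw [sz_reverse] at h1
    have h2 := sz_take_le (A := A) (l x).reverse i
    rw [sz_reverse] at h2
    have := ht x; have := ht' x; omega
  · rw [h, List.reverse_reverse]

theorem flatMap {l : T → List U} {f : U → T → List V} (hl : PolyFun α A l)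
    (hf : PolyFun α A (fun p : U × T => f p.1 p.2)) :
    PolyFun α A (fun x => (l x).flatMap (fun a => f a x)) := by
  obtain ⟨t, ht⟩ := hl.size_le
  obtain ⟨t', ht'⟩ := hf.size_le
  have h : ∀ (x : T) (l : List U) (b : List V),
      l.foldl (fun b a => b ++ f a x) b = b ++ l.flatMap fun a => f a x := by
    intro x l; induction l with
    | nil => simp
    | cons a l ih => intro b; simp [ih]
  refine of_eq (foldl (f := fun (b : List V) a (x : T) => b ++ f a x) hl (const [])
    (append (fst.comp fst) (hf.comp ((snd.comp fst).pair snd)))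
    (1 + t * t'.comp (t + Polynomial.X + 1)) fun x i => ?_) fun x => ?_
  · rw [h, List.nil_append]
    simp only [Polynomial.eval_add, Polynomial.eval_mul, Polynomial.eval_comp, Polynomial.eval_X,
      Polynomial.eval_one]
    -- At most `t` entries, and each image is bounded by `t'` at the size of the pair of the entry
    -- and the parameter.
    have key : ∀ l' : List U, (∀ a ∈ l', a ∈ l x) → sz A (l'.flatMap fun a => f a x) ≤
        1 + l'.length * t'.eval (t.eval (sz A x) + sz A x + 1) := by
      intro l'
      induction l' with
      | nil => simp
      | cons a l' ih =>
        intro hl'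
        have h1 := ih fun b hb => hl' b (by simp [hb])
        have h2 := sz_append (A := A) (f a x) (l'.flatMap fun a => f a x)
        have h3 := (ht' (a, x)).trans (polynomial_eval_mono t' (show _ ≤
          t.eval (sz A x) + sz A x + 1 by
            have := sz_le_of_mem (A := A) (hl' a (by simp))
            have := ht x
            simp only [sz_pair]; omega))
        rw [List.flatMap_cons, List.length_cons, Nat.succ_mul]
        dsimp only at *
        omega
    refine (key _ fun a ha => List.mem_of_mem_take ha).trans (Nat.add_le_add_left
      (Nat.mul_le_mul_right _ ?_) _)
    have h1 := length_lt_sz (A := A) (l x)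
    have := ht x
    have := List.length_take_le' i (l x)
    omega
  · rw [h, List.nil_append]

theorem map {l : T → List U} {f : U → T → V} (hl : PolyFun α A l)
    (hf : PolyFun α A (fun p : U × T => f p.1 p.2)) :
    PolyFun α A (fun x => (l x).map (fun a => f a x)) :=
  of_eq (flatMap (f := fun a x => [f a x]) hl (cons hf (const []))) fun x => by
    induction l x <;> simp_all

theorem ite {c : T → Bool} {f g : T → U} (hc : PolyFun α A c) (hf : PolyFun α A f)
    (hg : PolyFun α A g) : PolyFun α A (fun x => if c x = true then f x else g x) :=
  of_eq (finCases (f := fun b x => if b = true then f x else g x) hc (by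
    rintro (_ | _)
    · simpa using hg
    · simpa using hf)) fun x => rfl

theorem bool₁ {c : T → Bool} (g : Bool → Bool) (hc : PolyFun α A c) :
    PolyFun α A (fun x => g (c x)) :=
  finCases (f := fun b _ => g b) hc fun _ => const _

theorem bool₂ {c d : T → Bool} (g : Bool → Bool → Bool) (hc : PolyFun α A c) (hd : PolyFun α A d) :
    PolyFun α A (fun x => g (c x) (d x)) :=
  finCases (f := fun b x => g b (d x)) hc fun b => bool₁ (g b) hd

theorem any {l : T → List U} {f : U → T → Bool} (hl : PolyFun α A l)
    (hf : PolyFun α A (fun p : U × T => f p.1 p.2)) :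
    PolyFun α A (fun x => (l x).any (fun a => f a x)) := by
  refine of_eq (foldl (f := fun (b : Bool) a (x : T) => b || f a x) hl (const false)
    (bool₂ (· || ·) (fst.comp fst) (hf.comp ((snd.comp fst).pair snd))) 1 fun x i => by simp) ?_
  intro x
  have h : ∀ (l : List U) (b : Bool), l.foldl (fun b a => b || f a x) b =
      (b || l.any fun a => f a x) := by
    intro l; induction l with
    | nil => simp
    | cons a l ih => intro b; simp [ih, Bool.or_assoc]
  rw [h, Bool.false_or]

theorem filter {l : T → List U} {f : U → T → Bool} (hl : PolyFun α A l)
    (hf : PolyFun α A (fun p : U × T => f p.1 p.2)) :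
    PolyFun α A (fun x => (l x).filter (fun a => f a x)) :=
  of_eq (flatMap (f := fun a x => if f a x = true then [a] else []) hl
    (ite hf (cons fst (const [])) (const []))) fun x => by
      induction l x with
      | nil => rfl
      | cons a l ih => by_cases h : f a x = true <;> simp_all

theorem head? {l : T → List U} {f : T → V} {g : U → V} (hl : PolyFun α A l) (hf : PolyFun α A f)
    (hg : PolyFun α A g) :
    PolyFun α A (fun x => ((l x).head?.map g).getD (f x)) :=
  of_eq (listCases hl hf (hg.comp (fst.comp fst))) fun x => by
    cases l x <;> rfl

/-- A list whose length is a given polynomial of the length of a list. -/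
theorem units {l : T → List U} (hl : PolyFun α A l) (u : V) (c d : ℕ) :
    PolyFun α A (fun x => List.replicate (c * ((l x).length + 1) ^ d) u) := by
  induction d with
  | zero => simpa using const (List.replicate c u)
  | succ d ih =>
    -- The outer list has one entry more than `l x` and so contributes one factor `(l x).length +
    -- 1`.
    refine of_eq (flatMap (f := fun _ x => List.replicate (c * ((l x).length + 1) ^ d) u)
      (cons (const u) (map (f := fun _ _ => u) hl (const u))) (ih.comp snd)) fun x => ?_
    rw [List.eq_replicate_iff]
    constructor
    · simp [List.length_flatMap, pow_succ]; ring
    · intro b hb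
      simp only [List.mem_flatMap] at hb
      obtain ⟨_, _, hb⟩ := hb
      exact List.eq_of_mem_replicate hb

end PolyFun
end PolyLists
end LogspaceRelations

namespace LogspaceRelations

/-! ### Closure of a list under a successor function -/

section Closure

variable {T K : Type} [DecidableEq K]

/-- Insert an element unless one with the same key is present. -/
def insertKey (key : T → K) (L : List T) (t : T) : List T :=
  if (L.any fun t' => decide (key t' = key t)) = true then L else t :: L

/-- Insert all successors. -/
def closeRound (key : T → K) (succ : T → List T) (L : List T) : List T :=
  (L.flatMap succ).foldl (insertKey key) L

variable {key : T → K} {succ : T → List T}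

theorem insertKey_cases (L : List T) (t : T) :
    (key t ∈ L.map key ∧ insertKey key L t = L) ∨
      (key t ∉ L.map key ∧ insertKey key L t = t :: L) := by
  unfold insertKey
  by_cases h : key t ∈ L.map key
  · left
    refine ⟨h, if_pos ?_⟩
    simpa using h
  · right
    refine ⟨h, if_neg ?_⟩
    simpa using h

theorem mem_foldl_insertKey {l L : List T} {t : T} (h : t ∈ l.foldl (insertKey key) L) :
    t ∈ L ∨ t ∈ l := by
  induction l generalizing L with
  | nil => exact Or.inl h
  | cons a l ih =>
    rcases ih h with h | h
    · rcases insertKey_cases (key := key) L a with ⟨_, h1⟩ | ⟨_, h1⟩ <;> rw [h1] at h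
      · exact Or.inl h
      · rcases List.mem_cons.1 h with rfl | h
        · exact Or.inr (by simp)
        · exact Or.inl h
    · exact Or.inr (by simp [h])

theorem suffix_foldl_insertKey (l L : List T) : L <:+ l.foldl (insertKey key) L := by
  induction l generalizing L with
  | nil => exact List.suffix_refl _
  | cons a l ih =>
    refine List.IsSuffix.trans ?_ (ih _)
    rcases insertKey_cases (key := key) L a with ⟨_, h1⟩ | ⟨_, h1⟩ <;> rw [h1]
    exact List.suffix_cons _ _

theorem key_mem_foldl_insertKey {l L : List T} {t : T} (h : t ∈ l) :
    key t ∈ (l.foldl (insertKey key) L).map key := by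
  induction l generalizing L with
  | nil => simp at h
  | cons a l ih =>
    rcases List.mem_cons.1 h with rfl | h
    · have hs := (suffix_foldl_insertKey (key := key) l (insertKey key L t)).subset
      refine List.map_subset key hs ?_
      rcases insertKey_cases (key := key) L t with ⟨h0, h1⟩ | ⟨_, h1⟩ <;> rw [h1]
      · exact h0
      · simp
    · exact ih h

theorem nodup_foldl_insertKey {l L : List T} (h : (L.map key).Nodup) :
    ((l.foldl (insertKey key) L).map key).Nodup := by
  induction l generalizing L with
  | nil => exact h
  | cons a l ih =>
    refine ih ?_
    rcases insertKey_cases (key := key) L a with ⟨_, h1⟩ | ⟨h0, h1⟩ <;> rw [h1]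
    · exact h
    · exact List.nodup_cons.2 ⟨h0, h⟩

theorem forall_close {I : T → Prop} (hI : ∀ t, I t → ∀ t' ∈ succ t, I t') {L : List T}
    (hL : ∀ t ∈ L, I t) (i : ℕ) : ∀ t ∈ (closeRound key succ)^[i] L, I t := by
  induction i with
  | zero => exact hL
  | succ i ih =>
    intro t ht
    rw [Function.iterate_succ_apply'] at ht
    rcases mem_foldl_insertKey ht with h | h
    · exact ih t h
    · obtain ⟨t0, h0, h1⟩ := List.mem_flatMap.1 h
      exact hI t0 (ih t0 h0) t h1

theorem nodup_close {L : List T} (h : (L.map key).Nodup) (i : ℕ) :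
    (((closeRound key succ)^[i] L).map key).Nodup := by
  induction i with
  | zero => exact h
  | succ i ih => rw [Function.iterate_succ_apply']; exact nodup_foldl_insertKey ih

theorem subset_close (L : List T) (i : ℕ) : L ⊆ (closeRound key succ)^[i] L := by
  induction i with
  | zero => exact List.Subset.refl _
  | succ i ih =>
    rw [Function.iterate_succ_apply']
    exact List.Subset.trans ih (suffix_foldl_insertKey _ _).subset

/-- All successors are present, up to their keys. -/
def KeyClosed (key : T → K) (succ : T → List T) (L : List T) : Prop :=
  ∀ t ∈ L, ∀ t' ∈ succ t, key t' ∈ L.map key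

theorem closeRound_eq_self {L : List T} (h : KeyClosed key succ L) : closeRound key succ L = L := by
  have : ∀ l : List T, (∀ t ∈ l, key t ∈ L.map key) → l.foldl (insertKey key) L = L := by
    intro l
    induction l with
    | nil => simp
    | cons a l ih =>
      intro hl
      rcases insertKey_cases (key := key) L a with ⟨_, h1⟩ | ⟨h0, h1⟩
      · rw [List.foldl_cons, h1]; exact ih fun t ht => hl t (by simp [ht])
      · exact absurd (hl a (by simp)) h0
  refine this _ fun t ht => ?_
  obtain ⟨t0, h0, h1⟩ := List.mem_flatMap.1 ht
  exact h t0 h0 t h1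

/-- Rounds only prepend elements. A round that prepends nothing shows that all successors were
present, and then nothing changes any more; every other round makes the list longer. -/
theorem closed_or_length_le (L : List T) (i : ℕ) :
    KeyClosed key succ ((closeRound key succ)^[i] L) ∨
      i ≤ ((closeRound key succ)^[i] L).length := by
  induction i with
  | zero => exact Or.inr (Nat.zero_le _)
  | succ i ih =>
    rw [Function.iterate_succ_apply']
    rcases ih with h | h
    · rw [closeRound_eq_self h]; exact Or.inl h
    · by_cases hc : KeyClosed key succ ((closeRound key succ)^[i] L)
      · rw [closeRound_eq_self hc]; exact Or.inl hc
      · right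
        set L' := (closeRound key succ)^[i] L
        have hs : L' <:+ closeRound key succ L' := suffix_foldl_insertKey _ _
        have hlt : L'.length < (closeRound key succ L').length := by
          refine lt_of_le_of_ne hs.length_le fun he => hc ?_
          have he' : closeRound key succ L' = L' := (hs.eq_of_length he).symm
          intro t ht t' ht'
          have : key t' ∈ (closeRound key succ L').map key :=
            key_mem_foldl_insertKey (List.mem_flatMap.2 ⟨t, ht, ht'⟩)
          rwa [he'] at this
        omega

/-- If the invariant `I` leaves room for fewer than `i` keys then `i` rounds suffice. -/
theorem closed_close {I : T → Prop} (hI : ∀ t, I t → ∀ t' ∈ succ t, I t') {L : List T}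
    (hL : ∀ t ∈ L, I t) (hn : (L.map key).Nodup) {C : Type} [Fintype C] (φ : K → C)
    (hφ : ∀ t t', I t → I t' → φ (key t) = φ (key t') → key t = key t') {i : ℕ}
    (hi : Fintype.card C < i) :
    KeyClosed key succ ((closeRound key succ)^[i] L) ∧
      ∀ j, ((closeRound key succ)^[j] L).length ≤ Fintype.card C := by
  have hlen : ∀ j, ((closeRound key succ)^[j] L).length ≤ Fintype.card C := by
    intro j
    -- The type of keys may be infinite; `φ` has to separate only keys of elements with `I`, and all
    -- elements of the closure have `I`.
    have h1 : (((closeRound key succ)^[j] L).map fun t => φ (key t)).Nodup := by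
      have h2 := nodup_close (key := key) (succ := succ) hn j
      have h3 := forall_close (key := key) hI hL j
      rw [show (fun t => φ (key t)) = φ ∘ key from rfl, ← List.map_map]
      refine List.Nodup.map_on ?_ h2
      intro x hx y hy hxy
      obtain ⟨t, ht, rfl⟩ := List.mem_map.1 hx
      obtain ⟨t', ht', rfl⟩ := List.mem_map.1 hy
      exact hφ t t' (h3 t ht) (h3 t' ht') hxy
    simpa using h1.length_le_card
  refine ⟨?_, hlen⟩
  rcases closed_or_length_le (key := key) (succ := succ) L i with h | h
  · exact h
  · have := hlen i; omega

open Enc (enc)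

variable {α A S V : Type} [Atoms A Bool] [Enc A T]

theorem sz_foldl_insertKey (l L : List T) :
    sz A (l.foldl (insertKey key) L) + 1 ≤ sz A L + sz A l := by
  induction l generalizing L with
  | nil => simp
  | cons a l ih =>
    have h := ih (insertKey key L a)
    rw [List.foldl_cons, sz_cons]
    rcases insertKey_cases (key := key) L a with ⟨_, h1⟩ | ⟨h0, h1⟩
    · rw [h1] at h ⊢; omega
    · rw [h1] at h ⊢; rw [sz_cons] at h; omega

theorem PolyFun.closeStep [Enc A K] (hkey : PolyFun α A key) (hsucc : PolyFun α A succ) :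
    PolyFun α A (closeRound key succ) := by
  obtain ⟨t, ht⟩ := (PolyFun.flatMap (f := fun a (_ : List T) => succ a) PolyFun.id
    (hsucc.comp fst)).size_le
  refine of_eq (foldl (f := fun L a (_ : List T) => insertKey key L a)
    (l := fun L => L.flatMap succ) (b := fun L => L)
    (PolyFun.flatMap (f := fun a (_ : List T) => succ a) PolyFun.id (hsucc.comp fst)) PolyFun.id
    (ite (any (f := fun (t' : T) (p : (List T × T) × List T) => decide (key t' = key p.1.2))
      (fst.comp fst)
      (eqTest (hkey.comp fst) (hkey.comp (snd.comp (fst.comp snd))))) (fst.comp fst)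
      (cons (snd.comp fst) (fst.comp fst))) (Polynomial.X + t) fun L i => ?_) fun L => rfl
  rw [Polynomial.eval_add, Polynomial.eval_X]
  have h1 := sz_foldl_insertKey (A := A) (key := key) ((L.flatMap succ).take i) L
  have h2 := (sz_take_le (A := A) (L.flatMap succ) i).trans (ht L)
  exact (Nat.le_succ _).trans (h1.trans (Nat.add_le_add_left h2 _))

/-- The closure is computed in polynomial time if there are polynomially many keys. -/
theorem PolyFun.close [Enc A K] [Enc A S] [Enc A V] (hkey : PolyFun α A key) (hsucc : PolyFun α A succ)
    {R : S → List V} {L : S → List T} (hR : PolyFun α A R) (hL : PolyFun α A L) (c : ℕ)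
    (hc : ∀ t, ∀ t' ∈ succ t, sz A t' ≤ sz A t + c) (N : Polynomial ℕ)
    (hN : ∀ x i, ((closeRound key succ)^[i] (L x)).length ≤ N.eval (sz A x)) :
    PolyFun α A (fun x => (closeRound key succ)^[(R x).length] (L x)) := by
  obtain ⟨r, hr⟩ := hR.size_le
  obtain ⟨l, hl⟩ := hL.size_le
  refine iterate (PolyFun.closeStep hkey hsucc)
    (N * (l + Polynomial.C c * r + 1) + 1) hR hL fun x i hi => ?_
  -- A round enlarges single elements by at most `c`. With the bound `N` on their number this bounds
  -- the size of the whole list, as bounded iteration requires.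
  have hsz : ∀ j, ∀ t ∈ (LogspaceRelations.closeRound key succ)^[j] (L x),
      sz A t ≤ sz A (L x) + c * j := by
    intro j
    induction j with
    | zero => intro t ht; exact (sz_le_of_mem ht).le.trans (Nat.le_add_right _ _)
    | succ j ih =>
      intro t ht
      rw [Function.iterate_succ_apply'] at ht
      rw [Nat.mul_succ]
      rcases mem_foldl_insertKey ht with h | h
      · have := ih t h; omega
      · obtain ⟨t0, h0, h1⟩ := List.mem_flatMap.1 h
        have := ih t0 h0; have := hc t0 t h1; omega
  simp only [Polynomial.eval_add, Polynomial.eval_mul, Polynomial.eval_C, Polynomial.eval_one]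
  have hi' : i ≤ r.eval (sz A x) := hi.trans ((length_lt_sz _).le.trans (hr x))
  refine (sz_le_of_forall (B := l.eval (sz A x) + c * r.eval (sz A x)) fun t ht => ?_).trans ?_
  · exact (hsz i t ht).trans (Nat.add_le_add (hl x) (Nat.mul_le_mul_left _ hi'))
  · exact Nat.add_le_add_right (Nat.mul_le_mul_right _ (hN x i)) _

end Closure
end LogspaceRelations

namespace LogspaceRelations

/-! ### Instances with states in `ℕ` -/

section RawInstances

variable {α : Type} (zero one : α)

/-- A transition as a string. -/
def encodeTrans (t : ℕ × α × ℕ) : List α :=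
  encodeNat zero one t.1 ++ [t.2.1] ++ encodeNat zero one t.2.2

/-- The string of an instance whose states are arbitrary numbers. -/
def encodeRaw (n : ℕ) (tr : List (ℕ × α × ℕ)) (st fi : List ℕ) (k : ℕ) : List α :=
  encodeNat zero one n ++ (encodeList zero one (encodeTrans zero one) tr ++
    (encodeList zero one (encodeNat zero one) st ++ (encodeList zero one (encodeNat zero one) fi ++
      List.replicate k zero)))

namespace ListedNFA

variable (A : ListedNFA α)

/-- The transitions as triples of a number, a letter and a number. -/
def rawTrans : List (ℕ × α × ℕ) := A.trans.map fun t => (t.1.1, t.2.1, t.2.2.1)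

/-- The initial states as numbers. -/
def rawStarts : List ℕ := A.starts.map fun p => p.1

/-- The final states as numbers. -/
def rawFinals : List ℕ := A.finals.map fun p => p.1

end ListedNFA

variable {zero one}

theorem encodeInstance_eq (A : ListedNFA α) (k : ℕ) :
    encodeInstance zero one A k =
      encodeRaw zero one A.n A.rawTrans A.rawStarts A.rawFinals k := by
  simp [encodeInstance, encodeRaw, encodeList, ListedNFA.rawTrans, ListedNFA.rawStarts,
    ListedNFA.rawFinals, List.flatMap_map, encodeTrans]

/-- The code is prefix-free, since the first `0` ends it. Together with the same property of
transitions and lists this makes instances uniquely decodable, from left to right. -/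
theorem encodeNat_append_inj (h01 : zero ≠ one) {m m' : ℕ} {s s' : List α}
    (h : encodeNat zero one m ++ s = encodeNat zero one m' ++ s') : m = m' ∧ s = s' := by
  induction m generalizing m' with
  | zero =>
    cases m' with
    | zero => simpa [encodeNat] using h
    | succ m' => simp [encodeNat, List.replicate_succ] at h; exact absurd h.1 h01
  | succ m ih =>
    cases m' with
    | zero => simp [encodeNat, List.replicate_succ] at h; exact absurd h.1.symm h01
    | succ m' =>
      have : encodeNat zero one m ++ s = encodeNat zero one m' ++ s' := by
        simpa [encodeNat, List.replicate_succ] using h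
      obtain ⟨rfl, h1⟩ := ih this
      exact ⟨rfl, h1⟩

theorem encodeTrans_append_inj (h01 : zero ≠ one) {t t' : ℕ × α × ℕ} {s s' : List α}
    (h : encodeTrans zero one t ++ s = encodeTrans zero one t' ++ s') : t = t' ∧ s = s' := by
  obtain ⟨p, a, q⟩ := t
  obtain ⟨p', a', q'⟩ := t'
  simp only [encodeTrans, List.append_assoc] at h
  obtain ⟨rfl, h1⟩ := encodeNat_append_inj h01 h
  simp only [List.cons_append, List.nil_append, List.cons.injEq] at h1
  obtain ⟨rfl, h2⟩ := h1
  obtain ⟨rfl, h3⟩ := encodeNat_append_inj h01 h2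
  exact ⟨rfl, h3⟩

theorem encodeList_append_inj (h01 : zero ≠ one) {β : Type} {e : β → List α}
    (he : ∀ {b b' : β} {s s' : List α}, e b ++ s = e b' ++ s' → b = b' ∧ s = s')
    {l l' : List β} {s s' : List α}
    (h : encodeList zero one e l ++ s = encodeList zero one e l' ++ s') : l = l' ∧ s = s' := by
  induction l generalizing l' with
  | nil =>
    cases l' with
    | nil => simpa [encodeList] using h
    | cons b l' => simp [encodeList] at h; exact absurd h.1 h01
  | cons b l ih =>
    cases l' with
    | nil => simp [encodeList] at h; exact absurd h.1.symm h01
    | cons b' l' =>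
      have : e b ++ (encodeList zero one e l ++ s) = e b' ++ (encodeList zero one e l' ++ s') := by
        simpa [encodeList] using h
      obtain ⟨rfl, h1⟩ := he this
      obtain ⟨rfl, h2⟩ := ih h1
      exact ⟨rfl, h2⟩

theorem encodeRaw_inj (h01 : zero ≠ one) {n n' : ℕ} {tr tr' : List (ℕ × α × ℕ)}
    {st st' fi fi' : List ℕ} {k k' : ℕ}
    (h : encodeRaw zero one n tr st fi k = encodeRaw zero one n' tr' st' fi' k') :
    n = n' ∧ tr = tr' ∧ st = st' ∧ fi = fi' ∧ k = k' := by
  obtain ⟨rfl, h1⟩ := encodeNat_append_inj h01 h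
  obtain ⟨rfl, h2⟩ := encodeList_append_inj h01 (e := encodeTrans zero one)
    (encodeTrans_append_inj h01) h1
  obtain ⟨rfl, h3⟩ := encodeList_append_inj h01 (e := encodeNat zero one)
    (encodeNat_append_inj h01) h2
  obtain ⟨rfl, h4⟩ := encodeList_append_inj h01 (e := encodeNat zero one)
    (encodeNat_append_inj h01) h3
  exact ⟨rfl, rfl, rfl, rfl, by simpa using congrArg List.length h4⟩

theorem ListedNFA.ext_raw {A B : ListedNFA α} (hn : A.n = B.n) (ht : A.rawTrans = B.rawTrans)
    (hs : A.rawStarts = B.rawStarts) (hf : A.rawFinals = B.rawFinals) : A = B := by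
  obtain ⟨n, tr, st, fi⟩ := A
  obtain ⟨n', tr', st', fi'⟩ := B
  obtain rfl : n = n' := hn
  have h1 : tr = tr' := List.map_injective_iff.2 (by
    rintro ⟨p, a, q⟩ ⟨p', a', q'⟩ h
    simpa [Fin.ext_iff] using h) ht
  have h2 : st = st' := List.map_injective_iff.2 Fin.val_injective hs
  have h3 : fi = fi' := List.map_injective_iff.2 Fin.val_injective hf
  rw [h1, h2, h3]

theorem encodeInstance_inj (h01 : zero ≠ one) {A B : ListedNFA α} {k k' : ℕ}
    (h : encodeInstance zero one A k = encodeInstance zero one B k') : A = B ∧ k = k' := by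
  rw [encodeInstance_eq, encodeInstance_eq] at h
  obtain ⟨h1, h2, h3, h4, h5⟩ := encodeRaw_inj h01 h
  exact ⟨ListedNFA.ext_raw h1 h2 h3 h4, h5⟩

/-- Unique decoding removes the existential quantifier from `memNFA`. -/
theorem mem_memNFA (h01 : zero ≠ one) (A : ListedNFA α) (k : ℕ) (w : List α) :
    w ∈ witnesses (memNFA zero one) (encodeInstance zero one A k) ↔
      w.length = k ∧ w ∈ A.toNFA.accepts := by
  constructor
  · rintro ⟨B, k', h, hw⟩
    obtain ⟨rfl, rfl⟩ := encodeInstance_inj h01 h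
    exact hw
  · exact fun hw => ⟨A, k, rfl, hw⟩

theorem mem_memUFA (h01 : zero ≠ one) {A : ListedNFA α} (hA : Unambiguous A.toNFA) (k : ℕ)
    (w : List α) : w ∈ witnesses (memUFA zero one) (encodeInstance zero one A k) ↔
      w.length = k ∧ w ∈ A.toNFA.accepts := by
  constructor
  · rintro ⟨B, k', h, _, hw⟩
    obtain ⟨rfl, rfl⟩ := encodeInstance_inj h01 h
    exact hw
  · exact fun hw => ⟨A, k, rfl, hA, hw⟩

theorem fixedLength_memNFA (h01 : zero ≠ one) : FixedLength (memNFA zero one) := by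
  rintro x y y' ⟨A, k, h, hy, _⟩ ⟨A', k', h', hy', _⟩
  obtain ⟨-, rfl⟩ := encodeInstance_inj h01 (h.symm.trans h')
  exact hy.trans hy'.symm

/-! ### Runs as sequences of states -/

/-- `qs` is the sequence of the later states of an accepting run on `w` from the state `p`. -/
def RawRun (tr : List (ℕ × α × ℕ)) (fi : List ℕ) : ℕ → List α → List ℕ → Prop
  | p, [], [] => p ∈ fi
  | p, a :: w, q :: qs => (p, a, q) ∈ tr ∧ RawRun tr fi q w qs
  | _, _, _ => False

namespace ListedNFA

variable (A : ListedNFA α)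

theorem mem_rawTrans (p q : Fin A.n) (a : α) :
    (p.1, a, q.1) ∈ A.rawTrans ↔ q ∈ A.toNFA.step p a := by
  simp only [rawTrans, List.mem_map, Prod.mk.injEq, toNFA, Set.mem_ofPred_eq]
  constructor
  · rintro ⟨⟨p', a', q'⟩, h, h1, h2, h3⟩
    obtain rfl := Fin.ext h1
    obtain rfl := Fin.ext h3
    obtain rfl := h2
    exact h
  · exact fun h => ⟨_, h, rfl, rfl, rfl⟩

theorem lt_of_mem_rawTrans {p q : ℕ} {a : α} (h : (p, a, q) ∈ A.rawTrans) : q < A.n := by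
  obtain ⟨⟨p', a', q'⟩, -, h⟩ := List.mem_map.1 h
  simp only [Prod.mk.injEq] at h
  rw [← h.2.2]
  exact q'.2

theorem mem_rawStarts (p : Fin A.n) : p.1 ∈ A.rawStarts ↔ p ∈ A.toNFA.start := by
  simp [rawStarts, toNFA, Fin.val_inj]

theorem mem_rawFinals (p : Fin A.n) : p.1 ∈ A.rawFinals ↔ p ∈ A.toNFA.accept := by
  simp [rawFinals, toNFA, Fin.val_inj]

theorem lt_of_mem_rawStarts {p : ℕ} (h : p ∈ A.rawStarts) : p < A.n := by
  obtain ⟨p', -, rfl⟩ := List.mem_map.1 h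
  exact p'.2

/-- The later states of a path. -/
def pathStates : {s t : Fin A.n} → {w : List α} → A.toNFA.Path s t w → List ℕ
  | _, _, _, .nil _ => []
  | _, _, _, .cons q _ _ _ _ _ p => q.1 :: pathStates p

theorem rawRun_pathStates {s t : Fin A.n} {w : List α} (p : A.toNFA.Path s t w)
    (ht : t ∈ A.toNFA.accept) : RawRun A.rawTrans A.rawFinals s.1 w (A.pathStates p) := by
  induction p with
  | nil s => exact (A.mem_rawFinals s).2 ht
  | cons q s t a w h p ih => exact ⟨(A.mem_rawTrans _ _ _).2 h, ih ht⟩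

/-- The end point is determined by the states as well, so it varies and the paths can be compared
only by `HEq`. -/
theorem pathStates_inj {s t : Fin A.n} {w : List α} (p : A.toNFA.Path s t w) {t' : Fin A.n}
    (p' : A.toNFA.Path s t' w) (h : A.pathStates p = A.pathStates p') : t = t' ∧ HEq p p' := by
  induction p with
  | nil s => cases p'; exact ⟨rfl, HEq.rfl⟩
  | cons q s t a w hq p ih =>
    cases p' with
    | cons q' _ _ _ _ hq' p' =>
    simp only [pathStates, List.cons.injEq] at h
    obtain rfl := Fin.ext h.1
    obtain ⟨rfl, h2⟩ := ih p' h.2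
    obtain rfl := eq_of_heq h2
    exact ⟨rfl, HEq.rfl⟩

theorem exists_path {w : List α} : ∀ {s : Fin A.n} {qs : List ℕ},
    RawRun A.rawTrans A.rawFinals s.1 w qs →
    ∃ (t : Fin A.n) (p : A.toNFA.Path s t w), t ∈ A.toNFA.accept ∧ A.pathStates p = qs := by
  induction w with
  | nil =>
    intro s qs h
    cases qs with
    | nil => exact ⟨s, .nil s, (A.mem_rawFinals s).1 h, rfl⟩
    | cons q qs => exact h.elim
  | cons a w ih =>
    intro s qs h
    cases qs with
    | nil => exact h.elim
    | cons q qs =>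
      obtain ⟨h1, h2⟩ := h
      have hq := A.lt_of_mem_rawTrans h1
      obtain ⟨t, p, ht, hp⟩ := ih (s := ⟨q, hq⟩) h2
      exact ⟨t, .cons ⟨q, hq⟩ _ _ _ _ ((A.mem_rawTrans s ⟨q, hq⟩ a).1 h1) p, ht, by
        simp [pathStates, hp]⟩

theorem mem_accepts_iff (w : List α) : w ∈ A.toNFA.accepts ↔
    ∃ p ∈ A.rawStarts, ∃ qs, RawRun A.rawTrans A.rawFinals p w qs := by
  rw [NFA.accepts_iff_exists_path]
  constructor
  · rintro ⟨s, hs, t, ht, ⟨p⟩⟩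
    exact ⟨s.1, (A.mem_rawStarts s).2 hs, _, A.rawRun_pathStates p ht⟩
  · rintro ⟨p, hp, qs, h⟩
    obtain ⟨t, π, ht, -⟩ := A.exists_path (s := ⟨p, A.lt_of_mem_rawStarts hp⟩) h
    exact ⟨_, (A.mem_rawStarts _).1 hp, t, ht, ⟨π⟩⟩

/-- A path is determined by its starting point and the list of later states. So uniqueness in the
dependent sum of paths can be expressed by numbers and lists of numbers, free of dependent types. -/
theorem unambiguous_iff : Unambiguous A.toNFA ↔ ∀ w, ∀ p ∈ A.rawStarts, ∀ p' ∈ A.rawStarts,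
    ∀ qs qs', RawRun A.rawTrans A.rawFinals p w qs → RawRun A.rawTrans A.rawFinals p' w qs' →
      p = p' ∧ qs = qs' := by
  constructor
  · intro h w p hp p' hp' qs qs' hr hr'
    obtain ⟨t, π, ht, rfl⟩ := A.exists_path (s := ⟨p, A.lt_of_mem_rawStarts hp⟩) hr
    obtain ⟨t', π', ht', rfl⟩ := A.exists_path (s := ⟨p', A.lt_of_mem_rawStarts hp'⟩) hr'
    obtain ⟨r, -, hu⟩ := h w ((A.mem_accepts_iff w).2 ⟨p, hp, _, hr⟩)
    have e1 := hu ⟨_, t, π⟩ ⟨(A.mem_rawStarts _).1 hp, ht⟩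
    have e2 := hu ⟨_, t', π'⟩ ⟨(A.mem_rawStarts _).1 hp', ht'⟩
    have e := e1.trans e2.symm
    simp only [Sigma.mk.injEq, Fin.mk.injEq] at e
    obtain ⟨rfl, e⟩ := e
    simp only [heq_eq_eq, Sigma.mk.injEq] at e
    obtain ⟨rfl, e⟩ := e
    obtain rfl := eq_of_heq e
    exact ⟨rfl, rfl⟩
  · intro h w hw
    obtain ⟨s, hs, t, ht, ⟨π⟩⟩ := NFA.accepts_iff_exists_path.1 hw
    refine ⟨⟨s, t, π⟩, ⟨hs, ht⟩, ?_⟩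
    rintro ⟨s', t', π'⟩ ⟨hs', ht'⟩
    obtain ⟨h1, h2⟩ := h w _ ((A.mem_rawStarts s).2 hs) _ ((A.mem_rawStarts s').2 hs') _ _
      (A.rawRun_pathStates π ht) (A.rawRun_pathStates π' ht')
    obtain rfl := Fin.ext h1
    obtain ⟨rfl, h3⟩ := A.pathStates_inj π π' h2
    obtain rfl := eq_of_heq h3
    rfl

/-- The automaton with given lists of numbers. -/
def ofRaw (n : ℕ) (tr : List (ℕ × α × ℕ)) (st fi : List ℕ) (htr : ∀ t ∈ tr, t.1 < n ∧ t.2.2 < n)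
    (hst : ∀ p ∈ st, p < n) (hfi : ∀ p ∈ fi, p < n) : ListedNFA α where
  n := n
  trans := tr.pmap (fun t h => (⟨t.1, h.1⟩, t.2.1, ⟨t.2.2, h.2⟩)) htr
  starts := st.pmap (fun p h => ⟨p, h⟩) hst
  finals := fi.pmap (fun p h => ⟨p, h⟩) hfi

variable {n : ℕ} {tr : List (ℕ × α × ℕ)} {st fi : List ℕ} (htr : ∀ t ∈ tr, t.1 < n ∧ t.2.2 < n)
  (hst : ∀ p ∈ st, p < n) (hfi : ∀ p ∈ fi, p < n)

theorem rawTrans_ofRaw : (ofRaw n tr st fi htr hst hfi).rawTrans = tr := by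
  simp [ofRaw, rawTrans, List.map_pmap]

theorem rawStarts_ofRaw : (ofRaw n tr st fi htr hst hfi).rawStarts = st := by
  simp [ofRaw, rawStarts, List.map_pmap]

theorem rawFinals_ofRaw : (ofRaw n tr st fi htr hst hfi).rawFinals = fi := by
  simp [ofRaw, rawFinals, List.map_pmap]

end ListedNFA

end RawInstances
end LogspaceRelations

namespace LogspaceRelations

/-! ### Configurations as pairs of zippers -/

section Zippers

variable {S : Type}

/-- A tape with the head on the first symbol of the second list; the first list is reversed. -/
abbrev Zip (S : Type) := List S × List S

/-- The possible results of moving the head of the tape `(l, s :: r)`. -/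
def moveZip (d : Dir) (l : List S) (s : S) (r : List S) : List (Zip S) :=
  match d with
  | .left => match l with
    | [] => []
    | b :: l' => [(l', b :: s :: r)]
  | .stay => [(l, s :: r)]
  | .right => match r with
    | [] => []
    | b :: r' => [(s :: l, b :: r')]

/-- The tape `T` with the head on position `p`. -/
def zipAt (T : List S) (p : ℕ) : Zip S := ((T.take p).reverse, T.drop p)

theorem zipAt_snd {T : List S} {p : ℕ} (h : p < T.length) :
    (zipAt T p).2 = T[p] :: T.drop (p + 1) := List.drop_eq_getElem_cons h

/-- A zipper on a finite list loses exactly the moves beyond its last cell. On the input tape, of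
length `|x| + 2`, these are the moves that `Step` forbids; on the work tape they do not occur within
the space bound. -/
theorem mem_moveZip {T : List S} {p : ℕ} (h : p < T.length) (d : Dir) (s : S) (z : Zip S) :
    z ∈ moveZip d (zipAt T p).1 s (T.drop (p + 1)) ↔
      ∃ p', d.move p = some p' ∧ p' < T.length ∧ z = zipAt (T.set p s) p' := by
  have e1 : (T.set p s).take p = T.take p := List.take_set_of_le le_rfl
  have e2 : (T.set p s).drop p = s :: T.drop (p + 1) := by
    rw [List.drop_eq_getElem_cons (by simpa using h)]
    simp [List.drop_set]
  cases d with
  | stay =>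
    simp [moveZip, Dir.move, zipAt, e1, e2, h]
  | left =>
    cases p with
    | zero => simp [moveZip, Dir.move, zipAt]
    | succ p =>
      have hp : p < T.length := by omega
      have e3 : (T.take (p + 1)).reverse = T[p] :: (T.take p).reverse := by
        rw [List.take_succ_eq_append_getElem hp]; simp
      have e4 : (T.set (p + 1) s).drop p = T[p] :: s :: T.drop (p + 1 + 1) := by
        rw [List.drop_eq_getElem_cons (by simpa using hp), e2]
        simp
      have e5 : (T.set (p + 1) s).take p = T.take p := List.take_set_of_le (Nat.le_succ p)
      simp [moveZip, Dir.move, zipAt, e3, e4, e5, hp]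
  | right =>
    by_cases hp : p + 1 < T.length
    · have e3 : T.drop (p + 1) = T[p + 1] :: T.drop (p + 1 + 1) := List.drop_eq_getElem_cons hp
      have e4 : (T.set p s).take (p + 1) = T.take p ++ [s] := by
        rw [List.take_succ_eq_append_getElem (by simpa using h), e1]; simp
      have e5 : (T.set p s).drop (p + 1) = T.drop (p + 1) := List.drop_set_of_lt (Nat.lt_succ_self p)
      have hz : zipAt (T.set p s) (p + 1) =
          (s :: (T.take p).reverse, T[p + 1] :: T.drop (p + 1 + 1)) := by
        rw [zipAt, e4, e5, e3, List.reverse_append]; rfl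
      rw [e3]
      simp only [moveZip, Dir.move, List.mem_singleton, Option.some.injEq]
      constructor
      · rintro rfl; exact ⟨_, rfl, hp, hz.symm⟩
      · rintro ⟨_, rfl, -, rfl⟩; exact hz
    · have e3 : T.drop (p + 1) = [] := List.drop_eq_nil_of_le (by omega)
      rw [e3]
      simp only [moveZip, Dir.move, List.not_mem_nil, false_iff, not_exists, not_and, Option.some.injEq]
      rintro _ rfl h'; exact absurd h' hp

end Zippers

/-! ### Finite representations of configurations and their successors -/

namespace Transducer

variable {α : Type} (M : Transducer α)

attribute [local instance] Transducer.finQ Transducer.finΓ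

instance : Finite Dir :=
  Finite.of_injective (fun d : Dir => match d with
    | .left => (0 : Fin 3) | .stay => 1 | .right => 2) (by rintro (_ | _ | _) (_ | _ | _) <;> simp)

instance [Finite α] (Q Γ : Type) [Finite Q] [Finite Γ] : Finite (Action α Q Γ) :=
  Finite.of_injective (fun a : Action α Q Γ => (a.state, a.write, a.inputDir, a.workDir, a.emit))
    (by rintro ⟨_, _, _, _, _⟩ ⟨_, _, _, _, _⟩ h; simpa using h)

/-- Configurations without output, with a work tape of fixed length. -/
abbrev Rep := M.Q × (Zip (InSym α) × Zip M.Γ)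

/-- The instructions as a list. -/
noncomputable def acts [Finite α] (q : M.Q) (s : InSym α) (g : M.Γ) : List (Action α M.Q M.Γ) :=
  (Set.toFinite (M.δ q s g)).toFinset.toList

/-- The results of one instruction. -/
def applyAct (a : Action α M.Q M.Γ) (il : List (InSym α)) (s : InSym α) (ir : List (InSym α))
    (wl wr : List M.Γ) : List (Option α × M.Rep) :=
  (moveZip a.inputDir il s ir).flatMap fun z => (moveZip a.workDir wl a.write wr).map fun z' =>
    (a.emit, a.state, z, z')

/-- The successors, each with the letter that is emitted. -/
noncomputable def succs [Finite α] (c : M.Rep) : List (Option α × M.Rep) :=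
  match c.2.1.2 with
  | [] => []
  | s :: ir => match c.2.2.2 with
    | [] => []
    | g :: wr => (M.acts c.1 s g).flatMap fun a => M.applyAct a c.2.1.1 s ir c.2.2.1 wr

/-- The input tape as a list. -/
def tape (x : List α) : List (InSym α) := .leftEnd :: (x.map .letter ++ [.rightEnd])

theorem length_tape (x : List α) : (tape x).length = x.length + 2 := by simp [tape]

theorem tape_getElem (x : List α) (i : ℕ) (h : i < (tape x).length) :
    (tape x)[i] = readInput x i := by
  cases i with
  | zero => rfl
  | succ i =>
    simp only [tape, List.getElem_cons_succ, readInput]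
    by_cases hi : i < x.length
    · simp [hi, List.getElem_append_left]
    · have : i = x.length := by rw [length_tape] at h; omega
      subst this
      simp

/-- The first `S` cells of the work tape. -/
def cells (S : ℕ) (w : ℕ → M.Γ) : List M.Γ := (List.range S).map w

/-- The representation of a configuration. -/
def rep (x : List α) (S : ℕ) (c : M.Cfg) : M.Rep :=
  (c.state, zipAt (tape x) c.inputPos, zipAt (M.cells S c.work) c.workPos)

theorem cells_set (S : ℕ) (w : ℕ → M.Γ) (p : ℕ) (g : M.Γ) :
    (M.cells S w).set p g = M.cells S (Function.update w p g) := by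
  refine List.ext_getElem (by simp [cells]) fun i h1 h2 => ?_
  simp only [cells, List.getElem_set, List.getElem_map, List.getElem_range, Function.update_apply]
  by_cases h : p = i
  · simp [h]
  · simp [h, Ne.symm h]

/-- Representations contain no output, so that there are few of them. The emission survives as the
tag `e`, which is recovered from the growth of the output. -/
theorem mem_succs_rep [Finite α] {x : List α} {S : ℕ} {c : M.Cfg} (hi : c.inputPos ≤ x.length + 1)
    (hw : c.workPos < S) (e : Option α) (r : M.Rep) :
    (e, r) ∈ M.succs (M.rep x S c) ↔ ∃ d, M.Step x c d ∧ d.workPos < S ∧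
      d.output = c.output ++ e.toList ∧ r = M.rep x S d := by
  have hT : c.inputPos < (tape x).length := by rw [length_tape]; omega
  have hC : c.workPos < (M.cells S c.work).length := by simpa [cells] using hw
  have hg : (M.cells S c.work)[c.workPos] = c.work c.workPos := by simp [cells]
  simp only [succs, rep, zipAt_snd hT, zipAt_snd hC, List.mem_flatMap, applyAct, List.mem_map,
    mem_moveZip hT, mem_moveZip hC, acts, Finset.mem_toList, Set.Finite.mem_toFinset, hg,
    tape_getElem, cells_set]
  constructor
  · rintro ⟨a, ha, z, ⟨p, hp, hpT, rfl⟩, z', ⟨p', hp', hpC, rfl⟩, h⟩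
    simp only [Prod.mk.injEq] at h
    obtain ⟨rfl, rfl⟩ := h
    refine ⟨⟨a.state, p, p', Function.update c.work c.workPos a.write, c.output ++ a.emit.toList⟩,
      ⟨a, ha, rfl, hp, by rw [length_tape] at hpT; simp; omega, hp', rfl, rfl⟩,
      by simpa [cells] using hpC, rfl, ?_⟩
    rw [← tape_getElem x _ hT, List.set_getElem_self]
  · rintro ⟨d, ⟨a, ha, h1, h2, h3, h4, h5, h6⟩, hd, hout, rfl⟩
    have he : a.emit = e := by
      have := List.append_cancel_left (h6.symm.trans hout)
      cases h : a.emit <;> cases e <;> simp_all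
    refine ⟨a, ha, zipAt (tape x) d.inputPos, ⟨_, h2, by rw [length_tape]; omega, ?_⟩,
      zipAt (M.cells S d.work) d.workPos, ⟨_, h4, by simpa [cells] using hd, by rw [h5]⟩, ?_⟩
    · rw [← tape_getElem x _ hT, List.set_getElem_self]
    · rw [he, h1]

/-- The representation of the initial configuration. -/
def initRep (x : List α) (S : ℕ) : M.Rep :=
  (M.start, ([.leftEnd], x.map .letter ++ [.rightEnd]), ([], List.replicate S M.blank))

theorem rep_initial (x : List α) (S : ℕ) : M.rep x S M.initial = M.initRep x S := by
  simp [rep, initRep, initial, zipAt, tape, cells]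

end Transducer

end LogspaceRelations

namespace LogspaceRelations

/-! ### Numbers in unary and the numbering of lists -/

section PolyNat

variable {α A : Type} {S T U V W : Type} [Atoms A Bool]

instance : Enc A ℕ where
  enc n := encL (List.replicate n true)
  inj m n h := by simpa using congrArg List.length (encL_injective h)

@[simp] theorem sz_nat (n : ℕ) : sz A n = 2 * n + 1 := by
  change sz A (List.replicate n true) = _
  induction n with
  | zero => rfl
  | succ n ih => rw [List.replicate_succ, sz_cons, ih, sz_atom]; ring

namespace PolyFun

variable [Enc A S] [Enc A T] [Enc A U] [Enc A V] [Enc A W]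

theorem of_enc_out {f : S → T} (hf : PolyFun α A f) {g : S → U}
    (h : ∀ x, (Enc.enc (g x) : PTree A) = Enc.enc (f x)) : PolyFun α A g := by
  obtain ⟨p, t, hf⟩ := hf
  refine ⟨p, t, fun x => ?_⟩
  have hs : sz A (g x) = sz A (f x) := congrArg PTree.size (h x)
  rw [hs, h]
  exact hf x

theorem length {l : T → List U} (hl : PolyFun α A l) : PolyFun α A (fun x => (l x).length) :=
  of_enc_out (map (f := fun _ _ => true) hl (const true)) fun x => by
    change encL _ = encL _
    rw [List.map_const']

theorem replicate {n : T → ℕ} (hn : PolyFun α A n) (u : U) :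
    PolyFun α A (fun x => List.replicate (n x) u) := by
  refine comp (g := fun n => List.replicate n u) ?_ hn
  exact of_enc (map (f := fun _ _ => u) (id (T := List Bool)) (const u))
    (fun n => List.replicate n true) (fun n => rfl) fun n => by simp

theorem natSucc {n : T → ℕ} (hn : PolyFun α A n) : PolyFun α A (fun x => n x + 1) :=
  of_eq (length (cons (const true) (replicate hn true))) fun x => by simp

theorem isEmpty {l : T → List U} (hl : PolyFun α A l) : PolyFun α A (fun x => (l x).isEmpty) :=
  of_eq (head? hl (const true) (const false)) fun x => by cases l x <;> rfl

/-- Number the elements of a list from the end. -/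
def _root_.LogspaceRelations.number : List T → List (T × ℕ)
  | [] => []
  | a :: l => (a, l.length) :: number l

theorem number {l : T → List U} (hl : PolyFun α A l) : PolyFun α A (fun x => number (l x)) := by
  have h : ∀ l b : List U, l.foldl (fun (acc : List (U × ℕ)) a => (a, acc.length) :: acc)
      (LogspaceRelations.number b) = LogspaceRelations.number (l.reverse ++ b) := by
    intro l
    induction l with
    | nil => simp
    | cons a l ih =>
      intro b
      have hlen : ∀ b : List U, (LogspaceRelations.number b).length = b.length := by
        intro b; induction b <;> simp_all [LogspaceRelations.number]
      have := ih (a :: b)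
      simp only [LogspaceRelations.number] at this
      simp [hlen, this]
  have hsz : ∀ l : List U, sz A (LogspaceRelations.number l) ≤
      sz A l + l.length * (2 * l.length + 2) := by
    intro l
    induction l with
    | nil => simp [LogspaceRelations.number]
    | cons a l ih =>
      simp only [LogspaceRelations.number, sz_cons, sz_pair, sz_nat, List.length_cons]
      nlinarith
  suffices H : PolyFun α A (fun l : List U => LogspaceRelations.number l) from H.comp hl
  refine of_eq (foldl (f := fun (acc : List (U × ℕ)) a (_ : List U) => (a, acc.length) :: acc)
    (b := fun _ => []) (reverse id) (const [])
    (cons ((snd.comp fst).pair (length (fst.comp fst))) (fst.comp fst))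
    (Polynomial.X + Polynomial.X * (2 * Polynomial.X + 2)) fun l i => ?_) fun l => ?_
  · have h1 := h (l.reverse.take i) []
    rw [LogspaceRelations.number, List.append_nil] at h1
    rw [h1]
    simp only [Polynomial.eval_add, Polynomial.eval_mul, Polynomial.eval_X, Polynomial.eval_ofNat]
    have h2 := hsz (l.reverse.take i).reverse
    rw [sz_reverse] at h2
    have h3 := sz_take_le (A := A) l.reverse i
    rw [sz_reverse] at h3
    have h4 := length_lt_sz (A := A) (l.reverse.take i).reverse
    rw [sz_reverse] at h4
    have h5 : (l.reverse.take i).reverse.length ≤ sz A l := by omega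
    exact h2.trans (Nat.add_le_add h3 (Nat.mul_le_mul h5 (by omega)))
  · have h1 := h l.reverse []
    rw [LogspaceRelations.number, List.append_nil, List.reverse_reverse] at h1
    exact h1

end PolyFun
end PolyNat

/-! ### The reduction and the computability of its search phase -/

namespace Transducer

open PolyFun

variable {α : Type} (M : Transducer α) [Finite α]

attribute [local instance] Transducer.finQ Transducer.finΓ

instance : Finite (InSym α) :=
  Finite.of_injective (fun s : InSym α => match s with
    | .leftEnd => (none : Option (Option α)) | .rightEnd => some none | .letter a => some (some a))
    (by rintro (_ | _ | _) (_ | _ | _) <;> simp)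

/-- Successors that count the emitted letters. -/
noncomputable def tagSuccs (p : M.Rep × ℕ) : List (M.Rep × ℕ) :=
  (M.succs p.1).map fun e => (e.2, if e.1.isSome = true then p.2 + 1 else p.2)

/-- Successors of the second component without emission. -/
noncomputable def pairSuccs (p : M.Rep × M.Rep) : List (M.Rep × M.Rep) :=
  (M.succs p.2).flatMap fun e => if e.1.isSome = true then [] else [(p.1, e.2)]

open Classical in
/-- Whether a configuration is halting and accepting. -/
noncomputable def accHalt (r : M.Rep) : Bool := (M.succs r).isEmpty && decide (r.1 ∈ M.accepting)

/-- The parameters of the reduction: bounds for the space and for the number of configurations. -/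
structure Bounds where
  space : ℕ
  coeff : ℕ
  deg : ℕ

variable (B : Bounds)

/-- The length of the work tape. -/
def Bounds.tapeLength (x : List α) : ℕ := B.space * (x.length + 1) ^ 1

/-- The number of rounds. -/
def Bounds.rounds (x : List α) : ℕ := B.coeff * (x.length + 1) ^ B.deg

noncomputable instance : DecidableEq M.Rep := Classical.decEq _

/-- The reachable configurations. -/
noncomputable def reach (x : List α) : List (M.Rep × ℕ) :=
  (closeRound Prod.fst M.tagSuccs)^[B.rounds x] [(M.initRep x (B.tapeLength x), 0)]

/-- The pairs of reachable configurations that are connected without emission. -/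
noncomputable def pairs (x : List α) : List (M.Rep × M.Rep) :=
  (closeRound id M.pairSuccs)^[(B.coeff * B.coeff) * (x.length + 1) ^ (B.deg + B.deg)]
    ((M.reach B x).map fun p => (p.1, p.1))

/-- The numbered reachable configurations. -/
noncomputable def nodes (x : List α) : List (M.Rep × ℕ) := number ((M.reach B x).map fun p => p.1)

/-- The transitions of the automaton. -/
noncomputable def autTrans (x : List α) : List (ℕ × α × ℕ) :=
  (M.nodes B x).flatMap fun a => (M.pairs B x).flatMap fun b =>
    if decide (b.1 = a.1) = true then
      (M.succs b.2).flatMap fun e => (M.nodes B x).flatMap fun a' =>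
        if decide (e.2 = a'.1) = true then e.1.toList.map fun l => (a.2, l, a'.2) else []
    else []

/-- The initial states of the automaton. -/
noncomputable def autStarts (x : List α) : List ℕ :=
  (M.nodes B x).flatMap fun a =>
    if decide (a.1 = M.initRep x (B.tapeLength x)) = true then [a.2] else []

/-- The final states of the automaton. -/
noncomputable def autFinals (x : List α) : List ℕ :=
  (M.nodes B x).flatMap fun a =>
    if ((M.pairs B x).any fun b => decide (b.1 = a.1) && M.accHalt b.2) = true then [a.2] else []

/-- The length of a witness, if there is one. -/
noncomputable def witnessLength (x : List α) : ℕ :=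
  (((M.reach B x).filter fun p => M.accHalt p.1).head?.map fun p => p.2).getD 0

/-- The reduction to the membership problem of automata. -/
noncomputable def reduction (zero one : α) (x : List α) : List α :=
  encodeRaw zero one (M.nodes B x).length (M.autTrans B x) (M.autStarts B x) (M.autFinals B x)
    (M.witnessLength B x)

variable {A : Type} [Atoms A Bool] [Atoms A α] [Atoms A (Option α)] [Atoms A (InSym α)]
  [Atoms A M.Q] [Atoms A M.Γ]

theorem polyFun_moveZip {S T : Type} [Enc A S] [Enc A T] (d : Dir) {l r : T → List S} {s : T → S}
    (hl : PolyFun α A l) (hs : PolyFun α A s) (hr : PolyFun α A r) :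
    PolyFun α A (fun x => moveZip d (l x) (s x) (r x)) := by
  cases d with
  | left =>
    refine of_eq (listCases (h := fun p : (S × List S) × T => [(p.1.2, p.1.1 :: s p.2 :: r p.2)])
      hl (const []) (cons ((snd.comp fst).pair
        ((fst.comp fst).cons ((hs.comp snd).cons (hr.comp snd)))) (const []))) fun x => ?_
    simp only [moveZip]
  | stay => exact cons (hl.pair (hs.cons hr)) (const [])
  | right =>
    refine of_eq (listCases (h := fun p : (S × List S) × T => [(s p.2 :: l p.2, p.1.1 :: p.1.2)])
      hr (const []) (cons (((hs.comp snd).cons (hl.comp snd)).pair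
        ((fst.comp fst).cons (snd.comp fst))) (const []))) fun x => ?_
    simp only [moveZip]

theorem polyFun_applyAct {T : Type} [Enc A T] (a : Action α M.Q M.Γ) {il ir : T → List (InSym α)}
    {s : T → InSym α} {wl wr : T → List M.Γ} (h1 : PolyFun α A il) (h2 : PolyFun α A s)
    (h3 : PolyFun α A ir) (h4 : PolyFun α A wl) (h5 : PolyFun α A wr) :
    PolyFun α A (fun x => M.applyAct a (il x) (s x) (ir x) (wl x) (wr x)) :=
  flatMap (f := fun z x => (moveZip a.workDir (wl x) a.write (wr x)).map fun z' =>
    (a.emit, a.state, z, z')) (polyFun_moveZip _ h1 h2 h3)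
    (map (f := fun z' (p : Zip (InSym α) × T) => (a.emit, a.state, p.1, z'))
      (polyFun_moveZip _ (h4.comp snd) (const _) (h5.comp snd))
      ((const _).pair ((const _).pair ((fst.comp snd).pair fst))))

/-- The transition table is finite. Once the state and the two scanned symbols are fixed by case
distinction, the list of instructions is a constant, and each instruction is a fixed manipulation of
two zippers. -/
theorem polyFun_succs : PolyFun α A M.succs := by
  have key : ∀ (q : M.Q) (s : InSym α) (g : M.Γ), PolyFun α A
      (fun p : (List (InSym α) × List (InSym α)) × (List M.Γ × List M.Γ) =>
        (M.acts q s g).flatMap fun a => M.applyAct a p.1.1 s p.1.2 p.2.1 p.2.2) := by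
    intro q s g
    induction M.acts q s g with
    | nil => exact const []
    | cons a l ih =>
      exact append (polyFun_applyAct M a (fst.comp fst) (const s) (snd.comp fst) (fst.comp snd)
        (snd.comp snd)) ih
  have h2 : PolyFun α A (fun p : ((M.Γ × List M.Γ) × ((InSym α × List (InSym α)) × M.Rep)) =>
      (M.acts p.2.2.1 p.2.1.1 p.1.1).flatMap fun a =>
        M.applyAct a p.2.2.2.1.1 p.2.1.1 p.2.1.2 p.2.2.2.2.1 p.1.2) := by
    refine finCases (k := fun p : ((M.Γ × List M.Γ) × ((InSym α × List (InSym α)) × M.Rep)) =>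
      p.2.2.1) (f := fun q p => (M.acts q p.2.1.1 p.1.1).flatMap fun a =>
        M.applyAct a p.2.2.2.1.1 p.2.1.1 p.2.1.2 p.2.2.2.2.1 p.1.2) (fst.comp (snd.comp snd))
      fun q => ?_
    refine finCases (k := fun p : ((M.Γ × List M.Γ) × ((InSym α × List (InSym α)) × M.Rep)) =>
      p.2.1.1) (f := fun s p => (M.acts q s p.1.1).flatMap fun a =>
        M.applyAct a p.2.2.2.1.1 s p.2.1.2 p.2.2.2.2.1 p.1.2) (fst.comp (fst.comp snd))
      fun s => ?_
    refine finCases (k := fun p : ((M.Γ × List M.Γ) × ((InSym α × List (InSym α)) × M.Rep)) =>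
      p.1.1) (f := fun g p => (M.acts q s g).flatMap fun a =>
        M.applyAct a p.2.2.2.1.1 s p.2.1.2 p.2.2.2.2.1 p.1.2) (fst.comp fst)
      fun g => ?_
    refine (key q s g).comp
      (f := fun p : ((M.Γ × List M.Γ) × ((InSym α × List (InSym α)) × M.Rep)) =>
        ((p.2.2.2.1.1, p.2.1.2), (p.2.2.2.2.1, p.1.2))) (pair (pair ?_ ?_) (pair ?_ ?_))
    · exact fst.comp (fst.comp (snd.comp (snd.comp snd)))
    · exact snd.comp (fst.comp snd)
    · exact fst.comp (snd.comp (snd.comp (snd.comp snd)))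
    · exact snd.comp fst
  have h1 := listCases (g := fun _ : (InSym α × List (InSym α)) × M.Rep => ([] : List (Option α × M.Rep)))
    (snd.comp (snd.comp (snd.comp snd)) : PolyFun α A
      (fun p : (InSym α × List (InSym α)) × M.Rep => p.2.2.2.2)) (const []) h2
  refine of_eq (listCases (g := fun _ : M.Rep => ([] : List (Option α × M.Rep))) (snd.comp (fst.comp snd) : PolyFun α A
      (fun p : M.Rep => p.2.1.2)) (const []) h1) fun r => ?_
  obtain ⟨q, ⟨il, ir⟩, ⟨wl, wr⟩⟩ := r
  cases ir <;> cases wr <;> rfl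

theorem polyFun_tagSuccs : PolyFun α A M.tagSuccs :=
  map (f := fun e (p : M.Rep × ℕ) => (e.2, if e.1.isSome = true then p.2 + 1 else p.2))
    ((polyFun_succs M).comp fst) ((snd.comp fst).pair
      (ite (finCases (f := fun (o : Option α) _ => o.isSome) (fst.comp fst) fun _ => const _)
        (natSucc (snd.comp snd)) (snd.comp snd)))

theorem polyFun_pairSuccs : PolyFun α A M.pairSuccs :=
  flatMap (f := fun e (p : M.Rep × M.Rep) => if e.1.isSome = true then [] else [(p.1, e.2)])
    ((polyFun_succs M).comp snd)
      (ite (finCases (f := fun (o : Option α) _ => o.isSome) (fst.comp fst) fun _ => const _)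
        (const []) (cons ((fst.comp snd).pair (snd.comp fst)) (const [])))

theorem polyFun_accHalt : PolyFun α A M.accHalt := by
  classical
  exact bool₂ (· && ·) (isEmpty (polyFun_succs M))
    (finCases (f := fun q (_ : M.Rep) => decide (q ∈ M.accepting)) fst fun q => const _)

theorem sz_moveZip {S : Type} [Enc A S] (hS : ∀ s : S, sz A s = 1) {d : Dir} {l r : List S} {s : S}
    {z : Zip S} (hz : z ∈ moveZip d l s r) : sz A z = sz A l + sz A r + 3 := by
  cases d with
  | left =>
    cases l with
    | nil => simp [moveZip] at hz
    | cons b l => simp only [moveZip, List.mem_singleton] at hz; subst hz; simp [hS]; omega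
  | stay => simp only [moveZip, List.mem_singleton] at hz; subst hz; simp [hS]; omega
  | right =>
    cases r with
    | nil => simp [moveZip] at hz
    | cons b l => simp only [moveZip, List.mem_singleton] at hz; subst hz; simp [hS]; omega

/-- The tapes keep their lengths and every symbol is a single leaf. So the only growth in the
searches comes from the counter of emitted letters. -/
theorem sz_succs {r : M.Rep} {e : Option α × M.Rep} (he : e ∈ M.succs r) : sz A e.2 = sz A r := by
  obtain ⟨q, ⟨il, ir⟩, ⟨wl, wr⟩⟩ := r
  cases ir with
  | nil => simp [succs] at he
  | cons s ir =>
    cases wr with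
    | nil => simp [succs] at he
    | cons g wr =>
      simp only [succs, applyAct, List.mem_flatMap, List.mem_map] at he
      obtain ⟨a, -, z, hz, z', hz', rfl⟩ := he
      have h1 := sz_moveZip (A := A) (fun _ => rfl) hz
      have h2 := sz_moveZip (A := A) (fun _ => rfl) hz'
      simp only [sz_pair, sz_cons, sz_atom] at *
      omega

theorem polyFun_reach (N : Polynomial ℕ) (hN : ∀ x i, ((closeRound Prod.fst M.tagSuccs)^[i]
    [(M.initRep x (B.tapeLength x), 0)]).length ≤ N.eval (sz A x)) :
    PolyFun α A (M.reach B) := by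
  have hinit : PolyFun α A (fun x => M.initRep x (B.tapeLength x)) := by
    refine (const _).pair (((const _).pair (append (map (f := fun a _ => InSym.letter a) id
      (finCases (f := fun a (_ : α × List α) => InSym.letter a) fst fun _ => const _))
      (const _))).pair ((const _).pair (units id _ _ _)))
  refine of_eq (PolyFun.close (key := Prod.fst) (succ := M.tagSuccs) fst (polyFun_tagSuccs M)
    (R := fun x => List.replicate (B.rounds x) true) (units id _ _ _)
    -- Growth by at most `2` is one increment of a number in unary.
    (cons (hinit.pair (const 0)) (const [])) 2 ?_ N ?_) fun x => ?_
  · rintro ⟨r, n⟩ t' ht'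
    obtain ⟨e, he, rfl⟩ := List.mem_map.1 ht'
    have := sz_succs (A := A) M he
    simp only [sz_pair, sz_nat] at *
    split_ifs <;> omega
  · intro x i
    exact hN x i
  · rw [List.length_replicate, reach]

end Transducer

end LogspaceRelations

namespace LogspaceRelations

/-! ### Polynomial time of the lists that make up the automaton -/

namespace PolyFun

variable {α A X R : Type} [Finite α] [Atoms A Bool] [Atoms A α] [Atoms A (Option α)] [Enc A X] [Enc A R]
  [DecidableEq R] {nodes : X → List (R × ℕ)} {pairs : X → List (R × R)}

theorem polyFun_joinFinals {acc : R → Bool} (hn : PolyFun α A nodes) (hp : PolyFun α A pairs)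
    (ha : PolyFun α A acc) : PolyFun α A (fun x => (nodes x).flatMap fun a =>
      if ((pairs x).any fun b => decide (b.1 = a.1) && acc b.2) = true then [a.2] else []) :=
  have h1 : PolyFun α A (fun p : (R × R) × ((R × ℕ) × X) => decide (p.1.1 = p.2.1.1)) :=
    eqTest (f := fun p : (R × R) × ((R × ℕ) × X) => p.1.1)
      (g := fun p => p.2.1.1) (fst.comp fst) (fst.comp (fst.comp snd))
  have h2 : PolyFun α A (fun p : (R × R) × ((R × ℕ) × X) => acc p.1.2) :=
    ha.comp (snd.comp fst)
  have h3 : PolyFun α A (fun p : (R × ℕ) × X =>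
      (pairs p.2).any fun b => decide (b.1 = p.1.1) && acc b.2) :=
    any (f := fun (b : R × R) (p : (R × ℕ) × X) => decide (b.1 = p.1.1) && acc b.2)
        (hp.comp snd) (bool₂ (· && ·) h1 h2)
  flatMap (f := fun (a : R × ℕ) (x : X) =>
      if ((pairs x).any fun b => decide (b.1 = a.1) && acc b.2) = true then [a.2] else []) hn
    (PolyFun.ite h3 (cons (snd.comp fst) (const [])) (const []))

variable {succs : R → List (Option α × R)}

/-- The nested loops that produce the transitions are treated from the inside outwards; the tuple
`p` collects the variables bound by the outer loops. -/
theorem polyFun_joinTrans_inner : PolyFun α A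
    (fun p : (R × ℕ) × ((Option α × R) × ((R × R) × ((R × ℕ) × X))) =>
      if decide (p.2.1.2 = p.1.1) = true then
        p.2.1.1.toList.map fun l => (p.2.2.2.1.2, l, p.1.2) else []) := by
  refine PolyFun.ite (eqTest (f := fun p : (R × ℕ) × ((Option α × R) × ((R × R) × ((R × ℕ) × X)))
    => p.2.1.2) (g := fun p => p.1.1)
    (snd.comp (fst.comp snd)) (fst.comp fst)) (PolyFun.map (f := fun (l : α)
    (p : (R × ℕ) × ((Option α × R) × ((R × R) × ((R × ℕ) × X)))) =>
      (p.2.2.2.1.2, l, p.1.2)) ?_ (pair ?_ (pair fst ?_))) (const [])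
  · exact finCases (f := fun (o : Option α) _ => o.toList)
      (fst.comp (fst.comp snd)) fun o => const _
  · exact snd.comp (fst.comp (snd.comp (snd.comp (snd.comp snd))))
  · exact snd.comp (fst.comp snd)

theorem polyFun_joinTrans_nodes (hn : PolyFun α A nodes) :
    PolyFun α A (fun p : (Option α × R) × ((R × R) × ((R × ℕ) × X)) =>
      (nodes p.2.2.2).flatMap fun a' => if decide (p.1.2 = a'.1) = true then
        p.1.1.toList.map fun l => (p.2.2.1.2, l, a'.2) else []) :=
  flatMap (f := fun (a' : R × ℕ) (p : (Option α × R) × ((R × R) × ((R × ℕ) × X))) =>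
    if decide (p.1.2 = a'.1) = true then p.1.1.toList.map fun l => (p.2.2.1.2, l, a'.2) else [])
    (hn.comp (snd.comp (snd.comp snd))) polyFun_joinTrans_inner

theorem polyFun_joinTrans_succs (hn : PolyFun α A nodes) (hs : PolyFun α A succs) :
    PolyFun α A (fun p : (R × R) × ((R × ℕ) × X) =>
      (succs p.1.2).flatMap fun e => (nodes p.2.2).flatMap fun a' =>
          if decide (e.2 = a'.1) = true then e.1.toList.map fun l => (p.2.1.2, l, a'.2) else []) :=
  flatMap (f := fun (e : Option α × R) (p : (R × R) × ((R × ℕ) × X)) =>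
        (nodes p.2.2).flatMap fun a' =>
          if decide (e.2 = a'.1) = true then e.1.toList.map fun l => (p.2.1.2, l, a'.2) else [])
        (hs.comp (snd.comp fst)) (polyFun_joinTrans_nodes hn)

theorem polyFun_joinTrans_pairs (hn : PolyFun α A nodes) (hs : PolyFun α A succs) :
    PolyFun α A (fun p : (R × R) × ((R × ℕ) × X) =>
      if decide (p.1.1 = p.2.1.1) = true then
        (succs p.1.2).flatMap fun e => (nodes p.2.2).flatMap fun a' =>
          if decide (e.2 = a'.1) = true then e.1.toList.map fun l => (p.2.1.2, l, a'.2) else []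
      else []) :=
  PolyFun.ite (eqTest (f := fun p : (R × R) × ((R × ℕ) × X) => p.1.1)
      (g := fun p => p.2.1.1) (fst.comp fst) (fst.comp (fst.comp snd)))
    (polyFun_joinTrans_succs hn hs) (const [])

set_option maxHeartbeats 4000000 in
theorem polyFun_joinTrans (hn : PolyFun α A nodes) (hp : PolyFun α A pairs)
    (hs : PolyFun α A succs) : PolyFun α A (fun x => (nodes x).flatMap fun a =>
      (pairs x).flatMap fun b => if decide (b.1 = a.1) = true then
        (succs b.2).flatMap fun e => (nodes x).flatMap fun a' =>
          if decide (e.2 = a'.1) = true then e.1.toList.map fun l => (a.2, l, a'.2) else []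
        else []) := by
  refine flatMap (f := fun (a : R × ℕ) (x : X) => (pairs x).flatMap fun b =>
      if decide (b.1 = a.1) = true then
        (succs b.2).flatMap fun e => (nodes x).flatMap fun a' =>
          if decide (e.2 = a'.1) = true then e.1.toList.map fun l => (a.2, l, a'.2) else []
      else []) hn ?_
  have h := polyFun_joinTrans_pairs (nodes := nodes) hn hs
  have h' : PolyFun α A (fun p : (R × ℕ) × X => pairs p.2) := hp.comp snd
  have h'' := flatMap (f := fun (b : R × R) (p : (R × ℕ) × X) => if decide (b.1 = p.1.1) = true then
        (succs b.2).flatMap fun e => (nodes p.2).flatMap fun a' =>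
          if decide (e.2 = a'.1) = true then e.1.toList.map fun l => (p.1.2, l, a'.2) else []
      else []) h' h
  exact h''

end PolyFun

namespace Transducer

open PolyFun

variable {α : Type} (M : Transducer α) [Finite α]

attribute [local instance] Transducer.finQ Transducer.finΓ

variable (B : Bounds)

section

variable {A : Type} [Atoms A Bool] [Atoms A α] [Atoms A (Option α)] [Atoms A (InSym α)]
  [Atoms A M.Q] [Atoms A M.Γ]

theorem polyFun_initRep : PolyFun α A (fun x => M.initRep x (B.tapeLength x)) :=
  (const _).pair (((const _).pair (append (PolyFun.map (f := fun a _ => InSym.letter a) id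
    (finCases (f := fun a (_ : α × List α) => InSym.letter a) fst fun _ => const _))
    (const _))).pair ((const _).pair (units id _ _ _)))

theorem polyFun_pairs (hr : PolyFun α A (M.reach B)) (N : Polynomial ℕ)
    (hN : ∀ x i, ((closeRound _root_.id M.pairSuccs)^[i]
      ((M.reach B x).map fun p => (p.1, p.1))).length ≤ N.eval (sz A x)) :
    PolyFun α A (M.pairs B) := by
  have hL : PolyFun α A (fun x => (M.reach B x).map fun p => (p.1, p.1)) :=
    PolyFun.map (f := fun (p : M.Rep × ℕ) (_ : List α) => (p.1, p.1)) hr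
      ((fst.comp fst).pair (fst.comp fst))
  have hR : PolyFun α A (fun x : List α => List.replicate
      ((B.coeff * B.coeff) * (x.length + 1) ^ (B.deg + B.deg)) true) := units PolyFun.id _ _ _
  have h := PolyFun.close (key := (_root_.id : M.Rep × M.Rep → M.Rep × M.Rep))
    (succ := M.pairSuccs) PolyFun.id (polyFun_pairSuccs M) hR hL 0 ?_ N hN
  · refine of_eq h fun x => ?_
    rw [List.length_replicate, pairs]
  · rintro ⟨r, r'⟩ t' ht'
    obtain ⟨e, he, ht'⟩ := List.mem_flatMap.1 ht'
    split_ifs at ht' with h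
    · simp at ht'
    · obtain rfl := List.mem_singleton.1 ht'
      have := sz_succs (A := A) M he
      simp only [sz_pair] at *
      omega

variable (hr : PolyFun α A (M.reach B)) (hp : PolyFun α A (M.pairs B))
include hr

theorem polyFun_nodes : PolyFun α A (M.nodes B) :=
  PolyFun.number (map (f := fun p _ => p.1) hr (fst.comp fst))

theorem polyFun_autStarts : PolyFun α A (M.autStarts B) :=
  have h : PolyFun α A (fun p : (M.Rep × ℕ) × List α =>
      decide (p.1.1 = M.initRep p.2 (B.tapeLength p.2))) :=
    eqTest (f := fun p : (M.Rep × ℕ) × List α => p.1.1) (fst.comp fst)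
      ((polyFun_initRep M B).comp snd)
  flatMap (f := fun (a : M.Rep × ℕ) (x : List α) =>
    if decide (a.1 = M.initRep x (B.tapeLength x)) = true then [a.2] else [])
    (polyFun_nodes M B hr) (PolyFun.ite h (cons (snd.comp fst) (const [])) (const []))

theorem polyFun_witnessLength : PolyFun α A (M.witnessLength B) :=
  head? (filter (f := fun p _ => M.accHalt p.1) hr ((polyFun_accHalt M).comp (fst.comp fst)))
    (const 0) snd

include hp

theorem polyFun_autFinals : PolyFun α A (M.autFinals B) :=
  polyFun_joinFinals (polyFun_nodes M B hr) hp (polyFun_accHalt M)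

theorem polyFun_autTrans : PolyFun α A (M.autTrans B) :=
  polyFun_joinTrans (polyFun_nodes M B hr) hp (polyFun_succs M)

theorem polyFun_reduction (zero one : α) : PolyFun α A (M.reduction B zero one) := by
  have hnat : ∀ {T : Type} [Enc A T] {n : T → ℕ}, PolyFun α A n →
      PolyFun α A (fun x => encodeNat zero one (n x)) := fun hn =>
    append (PolyFun.replicate hn one) (const [zero])
  have hlist : ∀ {U : Type} [Enc A U] {e : U → List α} {l : List α → List U},
      PolyFun α A e → PolyFun α A l → PolyFun α A (fun x => encodeList zero one e (l x)) :=
    fun {U} _ {e l} he hl =>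
    append (flatMap (f := fun b _ => one :: e b) hl (cons (const one) (he.comp fst))) (const [zero])
  refine append (hnat (PolyFun.length (polyFun_nodes M B hr))) (append
    (hlist (append (append (hnat fst) (cons (fst.comp snd) (const []))) (hnat (snd.comp snd)))
      (polyFun_autTrans M B hr hp))
    (append (hlist (hnat PolyFun.id) (polyFun_autStarts M B hr))
      (append (hlist (hnat PolyFun.id) (polyFun_autFinals M B hr hp))
        (PolyFun.replicate (polyFun_witnessLength M B hr) zero))))

end

/-- The leaves used for the data of the reduction. -/
abbrev Leaf := Bool ⊕ Option α ⊕ InSym α ⊕ M.Q ⊕ M.Γ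

instance : Atoms M.Leaf Bool := ⟨Sum.inl, Sum.inl_injective⟩
instance : Atoms M.Leaf (Option α) := ⟨fun x => .inr (.inl x), fun _ _ h => by simpa using h⟩
instance : Atoms M.Leaf α := ⟨fun x => .inr (.inl (some x)), fun _ _ h => by simpa using h⟩
instance : Atoms M.Leaf (InSym α) := ⟨fun x => .inr (.inr (.inl x)), fun _ _ h => by simpa using h⟩
instance : Atoms M.Leaf M.Q := ⟨fun x => .inr (.inr (.inr (.inl x))), fun _ _ h => by simpa using h⟩
instance : Atoms M.Leaf M.Γ := ⟨fun x => .inr (.inr (.inr (.inr x))), fun _ _ h => by simpa using h⟩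

/-- The reduction is computable in polynomial time if the lists stay short. -/
theorem polyTime_reduction [Fintype α] (zero one : α) (N : Polynomial ℕ)
    (hN : ∀ x i, ((closeRound Prod.fst M.tagSuccs)^[i]
      [(M.initRep x (B.tapeLength x), 0)]).length ≤ N.eval x.length)
    (hN' : ∀ x i, ((closeRound _root_.id M.pairSuccs)^[i]
      ((M.reach B x).map fun p => (p.1, p.1))).length ≤ N.eval x.length) :
    PolyTime (M.reduction B zero one) := by
  have : Inhabited α := ⟨zero⟩
  have hx : ∀ x : List α, N.eval x.length ≤ N.eval (sz M.Leaf x) := fun x =>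
    polynomial_eval_mono N (length_lt_sz x).le
  have hr : PolyFun α M.Leaf (M.reach B) :=
    polyFun_reach M B N fun x i => (hN x i).trans (hx x)
  exact (polyFun_reduction M B hr
    (polyFun_pairs M B hr N fun x i => (hN' x i).trans (hx x)) zero one).polyTime

end Transducer

end LogspaceRelations

namespace LogspaceRelations

/-! ### Counting configurations -/

/-- The `O`-bound holds for large arguments only; the remaining values are absorbed by adding their
sum to the constant. The shift by `2` keeps the binary logarithm positive everywhere, and the factor
`2` pays for rounding it down. -/
theorem exists_le_mul_log {f : ℕ → ℕ}
    (hf : (fun n => (f n : ℝ)) =O[atTop] (fun n => Real.log (n : ℝ))) :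
    ∃ a, ∀ n, f n ≤ a * Nat.log 2 (n + 2) := by
  obtain ⟨C, hC⟩ := hf.bound
  obtain ⟨N, hN⟩ := eventually_atTop.1 hC
  refine ⟨⌈C⌉₊ * 2 + ∑ i ∈ Finset.range N, f i, fun n => ?_⟩
  have hlog : 1 ≤ Nat.log 2 (n + 2) := Nat.log_pos (by norm_num) (by omega)
  by_cases hn : n < N
  · have h1 : f n ≤ ∑ i ∈ Finset.range N, f i :=
      Finset.single_le_sum (f := f) (fun _ _ => Nat.zero_le _) (Finset.mem_range.2 hn)
    nlinarith
  · have h1 := hN n (by omega)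
    rw [Real.norm_natCast, Real.norm_of_nonneg (Real.log_natCast_nonneg n)] at h1
    have h2 : Real.log n ≤ (2 * Nat.log 2 (n + 2) : ℕ) := by
      have h3 : (n : ℝ) ≤ (2 : ℝ) ^ (2 * Nat.log 2 (n + 2)) := by
        have h4 : n + 2 < 2 ^ (Nat.log 2 (n + 2) + 1) := Nat.lt_pow_succ_log_self (by norm_num) _
        have h5 : 2 ^ (Nat.log 2 (n + 2) + 1) ≤ 2 ^ (2 * Nat.log 2 (n + 2)) :=
          Nat.pow_le_pow_right (by norm_num) (by omega)
        exact_mod_cast (show n ≤ 2 ^ (2 * Nat.log 2 (n + 2)) by omega)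
      rcases Nat.eq_zero_or_pos n with rfl | hpos
      · simp
      · have h4 := Real.log_le_log (by exact_mod_cast hpos) h3
        rw [Real.log_pow] at h4
        refine h4.trans ?_
        have : Real.log 2 ≤ 1 := by linarith [Real.log_two_lt_d9]
        exact mul_le_of_le_one_right (Nat.cast_nonneg _) this
    have h3 : (f n : ℝ) ≤ ((⌈C⌉₊ * (2 * Nat.log 2 (n + 2)) : ℕ) : ℝ) := by
      rw [Nat.cast_mul]
      refine h1.trans ?_
      have h4 : C ≤ (⌈C⌉₊ : ℝ) := Nat.le_ceil C
      exact (mul_le_mul_of_nonneg_right h4 (Real.log_natCast_nonneg n)).trans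
        (mul_le_mul_of_nonneg_left h2 (Nat.cast_nonneg _))
    have h4 : f n ≤ ⌈C⌉₊ * (2 * Nat.log 2 (n + 2)) := by exact_mod_cast h3
    refine h4.trans ?_
    rw [add_mul, mul_assoc]
    exact Nat.le_add_right _ _

/-- Space `O(log n)` gives polynomially many configurations. -/
theorem exists_bounds {f : ℕ → ℕ}
    (hf : (fun n => (f n : ℝ)) =O[atTop] (fun n => Real.log (n : ℝ))) (q g : ℕ) :
    ∃ s c d : ℕ, ∀ n, f n ≤ s * (n + 1) ^ 1 ∧
      q * ((n + 2) * (f n * g ^ f n)) < c * (n + 1) ^ d := by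
  obtain ⟨a, ha⟩ := exists_le_mul_log hf
  refine ⟨2 * a, q * a * 2 ^ (g * a + 2) + 1, g * a + 2, fun n => ?_⟩
  have hL : 2 ^ Nat.log 2 (n + 2) ≤ n + 2 := Nat.pow_log_le_self 2 (by omega)
  have hL' : Nat.log 2 (n + 2) ≤ n + 2 := Nat.log_le_self _ _
  have hF : f n ≤ a * (n + 2) := (ha n).trans (Nat.mul_le_mul_left _ hL')
  -- Here logarithmic space turns into polynomially many tape contents: `g ≤ 2 ^ g`, and `2` to the
  -- logarithm of `n + 2` is at most `n + 2`.
  have hg : g ^ f n ≤ (n + 2) ^ (g * a) :=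
    calc g ^ f n ≤ (2 ^ g) ^ f n := Nat.pow_le_pow_left Nat.lt_two_pow_self.le _
      _ ≤ (2 ^ g) ^ (a * Nat.log 2 (n + 2)) := Nat.pow_le_pow_right (by positivity) (ha n)
      _ = (2 ^ Nat.log 2 (n + 2)) ^ (g * a) := by rw [← pow_mul, ← pow_mul]; ring_nf
      _ ≤ _ := Nat.pow_le_pow_left hL _
  refine ⟨by rw [pow_one]; nlinarith, ?_⟩
  have h2 : (n + 2) ^ (g * a + 2) ≤ 2 ^ (g * a + 2) * (n + 1) ^ (g * a + 2) := by
    rw [← mul_pow]; exact Nat.pow_le_pow_left (by omega) _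
  calc q * ((n + 2) * (f n * g ^ f n))
      ≤ q * ((n + 2) * (a * (n + 2) * (n + 2) ^ (g * a))) := by gcongr
    _ = q * a * (n + 2) ^ (g * a + 2) := by ring
    _ ≤ q * a * (2 ^ (g * a + 2) * (n + 1) ^ (g * a + 2)) := Nat.mul_le_mul_left _ h2
    _ < (q * a * 2 ^ (g * a + 2) + 1) * (n + 1) ^ (g * a + 2) := by
      have : 0 < (n + 1) ^ (g * a + 2) := by positivity
      rw [add_mul, ← mul_assoc, one_mul]; omega

namespace Transducer

variable {α : Type} (M : Transducer α)

attribute [local instance] Transducer.finQ Transducer.finΓ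

/-- Reachability from the initial configuration. -/
def Reachable (x : List α) (c : M.Cfg) : Prop := Relation.ReflTransGen (M.Step x) M.initial c

variable {M} {x : List α} {c d : M.Cfg}

theorem Reachable.inputPos_le (h : M.Reachable x c) : c.inputPos ≤ x.length + 1 := by
  induction h with
  | refl => simp [initial]
  | tail _ hs _ => obtain ⟨a, -, -, -, h, -⟩ := hs; exact h

/-- A bound for the space on the input `x`. -/
def SpaceBound (M : Transducer α) (x : List α) (F : ℕ) : Prop := ∀ c, M.Reachable x c → c.workPos < F

variable {F S : ℕ}

theorem Reachable.work_eq_blank (h : M.Reachable x c) (hF : M.SpaceBound x F) {i : ℕ} (hi : F ≤ i) :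
    c.work i = M.blank := by
  induction h with
  | refl => rfl
  | @tail b c hb hs ih =>
    obtain ⟨a, -, -, -, -, -, h, -⟩ := hs
    have := hF b hb
    rw [h, Function.update_of_ne (by omega), ih]

/-- The part of a configuration in the first `F` cells. -/
def code (F n : ℕ) (hF : 0 < F) (c : M.Cfg) : M.Q × (Fin (n + 2) × (Fin F × (Fin F → M.Γ))) :=
  (c.state, Fin.ofNat _ c.inputPos, ⟨c.workPos % F, Nat.mod_lt _ hF⟩, fun i => c.work i)

/-- Reachable configurations are blank beyond the first `F` cells, and their head positions lie in
the range where the reductions modulo `F` and `|x| + 2` lose nothing. So the finite code determines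
everything but the output. -/
theorem rep_eq_of_code_eq (hF : M.SpaceBound x F) (h0 : 0 < F) (hc : M.Reachable x c)
    (hd : M.Reachable x d) (h : code F x.length h0 c = code F x.length h0 d) (S : ℕ) :
    M.rep x S c = M.rep x S d := by
  simp only [code, Prod.mk.injEq, Fin.ofNat, Fin.mk.injEq] at h
  obtain ⟨h1, h2, h3, h4⟩ := h
  have := hc.inputPos_le
  have := hd.inputPos_le
  rw [Nat.mod_eq_of_lt (by omega), Nat.mod_eq_of_lt (by omega)] at h2
  rw [Nat.mod_eq_of_lt (hF _ hc), Nat.mod_eq_of_lt (hF _ hd)] at h3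
  have h5 : c.work = d.work := by
    funext i
    by_cases hi : i < F
    · exact congrFun h4 ⟨i, hi⟩
    · rw [hc.work_eq_blank hF (by omega), hd.work_eq_blank hF (by omega)]
  simp only [rep, h1, h2, h3, h5]

/-- There are few representations of reachable configurations. -/
theorem exists_code (hF : M.SpaceBound x F) (S : ℕ) :
    ∃ φ : M.Rep → M.Q × (Fin (x.length + 2) × (Fin F × (Fin F → M.Γ))), ∀ c d,
      M.Reachable x c → M.Reachable x d → φ (M.rep x S c) = φ (M.rep x S d) →
        M.rep x S c = M.rep x S d := by
  classical
  have h0 : 0 < F := (Nat.zero_le _).trans_lt (hF M.initial .refl)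
  -- The code is that of a chosen reachable configuration with the given representation; elsewhere
  -- the value is arbitrary.
  refine ⟨fun r => if h : ∃ c, M.Reachable x c ∧ M.rep x S c = r then code F _ h0 h.choose else
    code F _ h0 M.initial, fun c d hc hd h => ?_⟩
  have hc' : ∃ c', M.Reachable x c' ∧ M.rep x S c' = M.rep x S c := ⟨c, hc, rfl⟩
  have hd' : ∃ c', M.Reachable x c' ∧ M.rep x S c' = M.rep x S d := ⟨d, hd, rfl⟩
  dsimp only at h
  rw [dif_pos hc', dif_pos hd'] at h
  rw [← hc'.choose_spec.2, ← hd'.choose_spec.2]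
  exact rep_eq_of_code_eq hF h0 hc'.choose_spec.1 hd'.choose_spec.1 h S

variable [Finite α]

/-- For reachable configurations the space bound makes the truncation of the work tape invisible. -/
theorem mem_succs (hS : M.SpaceBound x S) (hc : M.Reachable x c) (e : Option α) (r : M.Rep) :
    (e, r) ∈ M.succs (M.rep x S c) ↔ ∃ d, M.Step x c d ∧
      d.output = c.output ++ e.toList ∧ r = M.rep x S d := by
  rw [mem_succs_rep M hc.inputPos_le (hS c hc)]
  exact exists_congr fun d => ⟨fun h => ⟨h.1, h.2.2⟩, fun h => ⟨h.1, hS d (hc.tail h.1), h.2⟩⟩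

theorem Step.emit (h : M.Step x c d) : ∃ e : Option α, d.output = c.output ++ e.toList := by
  obtain ⟨a, -, -, -, -, -, -, h⟩ := h
  exact ⟨a.emit, h⟩

theorem accHalt_rep (hS : M.SpaceBound x S) (hc : M.Reachable x c) :
    M.accHalt (M.rep x S c) = true ↔ M.Halted x c ∧ c.state ∈ M.accepting := by
  simp only [accHalt, Bool.and_eq_true, List.isEmpty_iff, decide_eq_true_eq]
  refine and_congr ?_ Iff.rfl
  constructor
  · intro h d hd
    obtain ⟨e, he⟩ := hd.emit
    have : (e, M.rep x S d) ∈ M.succs (M.rep x S c) := (mem_succs hS hc _ _).2 ⟨d, hd, he, rfl⟩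
    simp [h] at this
  · intro h
    refine List.eq_nil_iff_forall_not_mem.2 fun p hp => ?_
    obtain ⟨d, hd, -⟩ := (mem_succs hS hc p.1 p.2).1 hp
    exact h d hd

/-! ### Runs of the transducer as runs between emissions -/

variable (M) in
/-- Connection without emission. -/
def Silent : M.Rep → M.Rep → Prop := Relation.ReflTransGen fun r r' => (none, r') ∈ M.succs r

variable (M) in
/-- A run that emits `w` from the representation `r`; the list consists of the representations
directly after each emission. -/
def NodeRun : M.Rep → List α → List M.Rep → Prop
  | r, [], [] => ∃ r', M.Silent r r' ∧ M.accHalt r' = true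
  | r, a :: w, r' :: rs => (∃ r₁, M.Silent r r₁ ∧ (some a, r') ∈ M.succs r₁) ∧ NodeRun r' w rs
  | _, _, _ => False

theorem NodeRun.of_silent {r r' : M.Rep} (h : (none, r') ∈ M.succs r) {w : List α}
    {rs : List M.Rep} (hr : M.NodeRun r' w rs) : M.NodeRun r w rs := by
  cases w <;> cases rs <;> simp only [NodeRun] at hr ⊢
  · obtain ⟨r'', h1, h2⟩ := hr; exact ⟨r'', .head h h1, h2⟩
  · obtain ⟨⟨r'', h1, h2⟩, h3⟩ := hr; exact ⟨⟨r'', .head h h1, h2⟩, h3⟩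

variable (M) in
/-- `ρ` continues an accepting run at `c`; the final output is `y`. -/
def IsRunFrom (x y : List α) (c : M.Cfg) (ρ : List M.Cfg) : Prop :=
  (c :: ρ).IsChain (M.Step x) ∧ ∃ c', (c :: ρ).getLast? = some c' ∧ M.Halted x c' ∧
    c'.state ∈ M.accepting ∧ c'.output = y

theorem isAcceptingRun_iff {y : List α} {ρ : List M.Cfg} :
    M.IsAcceptingRun x y ρ ↔ ∃ ρ', ρ = M.initial :: ρ' ∧ M.IsRunFrom x y M.initial ρ' := by
  constructor
  · rintro ⟨h1, h2, h3⟩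
    cases ρ with
    | nil => simp at h2
    | cons c ρ =>
      obtain rfl : c = M.initial := by simpa using h2
      exact ⟨ρ, rfl, h1, h3⟩
  · rintro ⟨ρ', rfl, h1, h3⟩
    exact ⟨h1, rfl, h3⟩

theorem isRunFrom_nil {y : List α} :
    M.IsRunFrom x y c [] ↔ M.Halted x c ∧ c.state ∈ M.accepting ∧ c.output = y := by
  simp [IsRunFrom]

theorem isRunFrom_cons {y : List α} {ρ : List M.Cfg} :
    M.IsRunFrom x y c (d :: ρ) ↔ M.Step x c d ∧ M.IsRunFrom x y d ρ := by
  simp [IsRunFrom, List.isChain_cons_cons, and_assoc]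

/-- The representations directly after each emission. -/
def marks (x : List α) (S : ℕ) : M.Cfg → List M.Cfg → List M.Rep
  | _, [] => []
  | c, d :: ρ => if c.output.length = d.output.length then marks x S d ρ else
      M.rep x S d :: marks x S d ρ

/-- Going backwards along the run, a silent step is absorbed into the silent path that follows, and
an emitting step contributes a letter and a mark. -/
theorem IsRunFrom.nodeRun (hS : M.SpaceBound x S) {y : List α} {ρ : List M.Cfg}
    (hc : M.Reachable x c) (h : M.IsRunFrom x y c ρ) :
    ∃ w, y = c.output ++ w ∧ M.NodeRun (M.rep x S c) w (marks x S c ρ) := by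
  induction ρ generalizing c with
  | nil =>
    obtain ⟨h1, h2, h3⟩ := isRunFrom_nil.1 h
    exact ⟨[], by simp [h3], _, .refl, (accHalt_rep hS hc).2 ⟨h1, h2⟩⟩
  | cons d ρ ih =>
    obtain ⟨h1, h2⟩ := isRunFrom_cons.1 h
    obtain ⟨w, rfl, hw⟩ := ih (hc.tail h1) h2
    obtain ⟨e, he⟩ := h1.emit
    have hm : (e, M.rep x S d) ∈ M.succs (M.rep x S c) := (mem_succs hS hc _ _).2 ⟨d, h1, he, rfl⟩
    cases e with
    | none =>
      refine ⟨w, by simp [he], ?_⟩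
      rw [marks, if_pos (by simp [he])]
      exact hw.of_silent hm
    | some a =>
      refine ⟨a :: w, by simp [he], ?_⟩
      rw [marks, if_neg (by simp [he])]
      exact ⟨⟨_, .refl, hm⟩, hw⟩

/-- A silent path lifts from representations to configurations step by step. It is placed in front
of any accepting continuation and adds no mark. -/
theorem exists_run_of_silent (hS : M.SpaceBound x S) {y : List α} {r r' : M.Rep}
    (h : M.Silent r r') (hc : M.Reachable x c) (hr : M.rep x S c = r) :
    ∃ c', M.Reachable x c' ∧ M.rep x S c' = r' ∧ c'.output = c.output ∧
      ∀ ρ', M.IsRunFrom x y c' ρ' → ∃ ρ, M.IsRunFrom x y c ρ ∧ marks x S c ρ = marks x S c' ρ' := by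
  induction h using Relation.ReflTransGen.head_induction_on generalizing c with
  | refl => exact ⟨c, hc, hr, rfl, fun ρ' h => ⟨ρ', h, rfl⟩⟩
  | head h1 _ ih =>
    subst hr
    obtain ⟨d, hd, hout, rfl⟩ := (mem_succs hS hc _ _).1 h1
    have hout : d.output = c.output := by simpa using hout
    obtain ⟨c', h2, h3, h4, h5⟩ := ih (hc.tail hd) rfl
    refine ⟨c', h2, h3, h4.trans hout, fun ρ' h => ?_⟩
    obtain ⟨ρ, h6, h7⟩ := h5 ρ' h
    exact ⟨d :: ρ, isRunFrom_cons.2 ⟨hd, h6⟩, by rw [marks, if_pos (by rw [hout]), h7]⟩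

/-- The lifted run has exactly the prescribed marks. This is what transfers unambiguity: distinct
lists of marks need distinct runs. -/
theorem NodeRun.exists_run (hS : M.SpaceBound x S) {w : List α} {rs : List M.Rep} {r : M.Rep}
    (h : M.NodeRun r w rs) (hc : M.Reachable x c) (hr : M.rep x S c = r) :
    ∃ ρ, M.IsRunFrom x (c.output ++ w) c ρ ∧ marks x S c ρ = rs := by
  induction w generalizing r rs c with
  | nil =>
    cases rs with
    | cons => exact h.elim
    | nil =>
      obtain ⟨r', h1, h2⟩ := h
      obtain ⟨c', h3, rfl, h5, h6⟩ := exists_run_of_silent hS (y := c.output ++ []) h1 hc hr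
      obtain ⟨h7, h8⟩ := (accHalt_rep hS h3).1 h2
      obtain ⟨ρ, h9, h10⟩ := h6 [] (isRunFrom_nil.2 ⟨h7, h8, by simp [h5]⟩)
      exact ⟨ρ, h9, h10⟩
  | cons a w ih =>
    cases rs with
    | nil => exact h.elim
    | cons r' rs =>
      obtain ⟨⟨r₁, h1, h2⟩, h3⟩ := h
      obtain ⟨c', h4, rfl, h5, h6⟩ := exists_run_of_silent hS (y := c.output ++ a :: w) h1 hc hr
      obtain ⟨d, hd, hout, rfl⟩ := (mem_succs hS h4 _ _).1 h2
      obtain ⟨ρ', h7, h8⟩ := ih h3 (h4.tail hd) rfl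
      have hout' : d.output = c.output ++ [a] := by simpa [h5] using hout
      obtain ⟨ρ, h9, h10⟩ := h6 (d :: ρ') (isRunFrom_cons.2 ⟨hd, by
        rw [hout', List.append_assoc] at h7; exact h7⟩)
      refine ⟨ρ, h9, h10.trans ?_⟩
      rw [marks, if_neg (by simp [hout]), h8]

/-- The outputs are the words that are emitted along runs of representations. -/
theorem mem_outputs_iff (hS : M.SpaceBound x S) (w : List α) :
    w ∈ M.outputs x ↔ ∃ rs, M.NodeRun (M.initRep x S) w rs := by
  rw [← rep_initial]
  constructor
  · rintro ⟨ρ, hρ⟩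
    obtain ⟨ρ', -, h⟩ := isAcceptingRun_iff.1 hρ
    obtain ⟨w', h1, h2⟩ := h.nodeRun hS .refl
    obtain rfl : w = w' := h1
    exact ⟨_, h2⟩
  · rintro ⟨rs, h⟩
    obtain ⟨ρ, h1, -⟩ := h.exists_run hS .refl rfl
    exact ⟨M.initial :: ρ, isAcceptingRun_iff.2 ⟨ρ, rfl, h1⟩⟩

theorem UnambiguousOn.nodeRun_unique (hS : M.SpaceBound x S) (hU : M.UnambiguousOn x) {w : List α}
    {rs rs' : List M.Rep} (h : M.NodeRun (M.initRep x S) w rs)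
    (h' : M.NodeRun (M.initRep x S) w rs') : rs = rs' := by
  rw [← rep_initial] at h h'
  obtain ⟨ρ, h1, rfl⟩ := h.exists_run hS .refl rfl
  obtain ⟨ρ', h1', rfl⟩ := h'.exists_run hS .refl rfl
  have h2 : M.IsAcceptingRun x w (M.initial :: ρ) := isAcceptingRun_iff.2 ⟨ρ, rfl, h1⟩
  have h2' : M.IsAcceptingRun x w (M.initial :: ρ') := isAcceptingRun_iff.2 ⟨ρ', rfl, h1'⟩
  have := (hU w ⟨_, h2⟩).unique h2 h2'
  rw [(List.cons.inj this).2]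

end Transducer

end LogspaceRelations

namespace LogspaceRelations

/-! ### Correctness of the reduction -/

section Number

variable {T : Type}

theorem map_fst_number (l : List T) : (number l).map Prod.fst = l := by
  induction l with
  | nil => rfl
  | cons a l ih => rw [number, List.map_cons, ih]

theorem length_number (l : List T) : (number l).length = l.length := by
  rw [← List.length_map (f := Prod.fst), map_fst_number]

theorem lt_of_mem_number {l : List T} {p : T × ℕ} (h : p ∈ number l) : p.2 < l.length := by
  induction l with
  | nil => simp [number] at h
  | cons a l ih =>
    rcases List.mem_cons.1 h with rfl | h
    · simp
    · exact (ih h).trans (by simp)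

theorem number_label_inj {l : List T} {p q : T × ℕ} (hp : p ∈ number l) (hq : q ∈ number l)
    (h : p.2 = q.2) : p = q := by
  induction l with
  | nil => simp [number] at hp
  | cons a l ih =>
    rcases List.mem_cons.1 hp with rfl | hp <;> rcases List.mem_cons.1 hq with rfl | hq
    · rfl
    · exact absurd h (lt_of_mem_number hq).ne'
    · exact absurd h (lt_of_mem_number hp).ne
    · exact ih hp hq

theorem number_fst_inj {l : List T} (hl : l.Nodup) {p q : T × ℕ} (hp : p ∈ number l)
    (hq : q ∈ number l) (h : p.1 = q.1) : p = q := by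
  rw [← map_fst_number l] at hl
  exact List.inj_on_of_nodup_map hl hp hq h

theorem exists_mem_number {l : List T} {a : T} (h : a ∈ l) : ∃ n, (a, n) ∈ number l := by
  rw [← map_fst_number l] at h
  obtain ⟨⟨a, n⟩, h', rfl⟩ := List.mem_map.1 h
  exact ⟨n, h'⟩

theorem mem_of_mem_number {l : List T} {p : T × ℕ} (h : p ∈ number l) : p.1 ∈ l := by
  rw [← map_fst_number l]
  exact List.mem_map_of_mem h

end Number

namespace Transducer

variable {α : Type} {M : Transducer α} [Finite α] {B : Bounds} {x : List α} {S F : ℕ}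

attribute [local instance] Transducer.finQ Transducer.finΓ

/-- A pair of a reachable configuration and the length of its output. -/
def ReachTag (M : Transducer α) (x : List α) (S : ℕ) (p : M.Rep × ℕ) : Prop :=
  ∃ c, M.Reachable x c ∧ M.rep x S c = p.1 ∧ c.output.length = p.2

/-- A pair of reachable configurations connected without emission. -/
def ReachPair (M : Transducer α) (x : List α) (S : ℕ) (p : M.Rep × M.Rep) : Prop :=
  (∃ c, M.Reachable x c ∧ M.rep x S c = p.1) ∧ (∃ c, M.Reachable x c ∧ M.rep x S c = p.2) ∧
    M.Silent p.1 p.2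

omit [Finite α] in
theorem reachTag_init : M.ReachTag x S (M.initRep x S, 0) :=
  ⟨M.initial, .refl, rep_initial M x S, rfl⟩

theorem ReachTag.succs (hS : M.SpaceBound x S) (p : M.Rep × ℕ) (hp : M.ReachTag x S p)
    (p' : M.Rep × ℕ) (h : p' ∈ M.tagSuccs p) : M.ReachTag x S p' := by
  obtain ⟨r, t⟩ := p
  obtain ⟨c, hc, rfl, rfl⟩ := hp
  obtain ⟨⟨e, r⟩, he, rfl⟩ := List.mem_map.1 h
  obtain ⟨d, hd, hout, rfl⟩ := (mem_succs hS hc _ _).1 he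
  refine ⟨d, hc.tail hd, rfl, ?_⟩
  cases e <;> simp [hout]

theorem ReachPair.succs (hS : M.SpaceBound x S) (p : M.Rep × M.Rep) (hp : M.ReachPair x S p)
    (p' : M.Rep × M.Rep) (h : p' ∈ M.pairSuccs p) : M.ReachPair x S p' := by
  obtain ⟨r, r'⟩ := p
  obtain ⟨h1, ⟨c, hc, rfl⟩, h2⟩ := hp
  obtain ⟨⟨e, r''⟩, he, h3⟩ := List.mem_flatMap.1 h
  cases e with
  | some a => simp at h3
  | none =>
    obtain rfl : p' = (r, r'') := by simpa using h3
    obtain ⟨d, hd, hout, rfl⟩ := (mem_succs hS hc _ _).1 he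
    exact ⟨h1, ⟨d, hc.tail hd, rfl⟩, .tail h2 he⟩

/-- The bounds suffice for the input `x`. -/
structure Bounds.Fits (B : Bounds) (M : Transducer α) (x : List α) (F : ℕ) : Prop where
  space : M.SpaceBound x F
  le : F ≤ B.tapeLength x
  card : Fintype.card M.Q * ((x.length + 2) * (F * Fintype.card M.Γ ^ F)) < B.rounds x

namespace Bounds.Fits

variable (hB : B.Fits M x F)
include hB

theorem spaceBound : M.SpaceBound x (B.tapeLength x) := fun c hc => (hB.space c hc).trans_le hB.le

/-- All listed elements stem from reachable configurations, and these have fewer codes than there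
are rounds. So the search is complete. The key omits the output length, which is unbounded in
general. -/
theorem close_tag : KeyClosed Prod.fst M.tagSuccs (M.reach B x) ∧
    ∀ j, ((closeRound Prod.fst M.tagSuccs)^[j] [(M.initRep x (B.tapeLength x), 0)]).length ≤
      B.rounds x := by
  obtain ⟨φ, hφ⟩ := exists_code hB.space (B.tapeLength x)
  have h := closed_close (key := Prod.fst) (succ := M.tagSuccs) (ReachTag.succs hB.spaceBound)
    (L := [(M.initRep x (B.tapeLength x), 0)]) (by simpa using reachTag_init) (by simp) φ
    (by
      rintro ⟨r, t⟩ ⟨r', t'⟩ ⟨c, hc, rfl, -⟩ ⟨c', hc', rfl, -⟩ h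
      exact hφ c c' hc hc' h) (i := B.rounds x) (by simpa using hB.card)
  exact ⟨h.1, fun j => (h.2 j).trans (by simpa using hB.card.le)⟩

theorem nodup_reach : ((M.reach B x).map Prod.fst).Nodup := nodup_close (by simp) _

theorem reachTag_of_mem {p : M.Rep × ℕ} (hp : p ∈ M.reach B x) :
    M.ReachTag x (B.tapeLength x) p :=
  forall_close (ReachTag.succs hB.spaceBound) (by simpa using reachTag_init) _ p hp

/-- Induction along a run; closedness up to keys supplies the representation of the next
configuration, possibly with another output length. -/
theorem mem_reach {c : M.Cfg} (hc : M.Reachable x c) :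
    M.rep x (B.tapeLength x) c ∈ (M.reach B x).map Prod.fst := by
  induction hc with
  | refl =>
    rw [rep_initial]
    exact List.mem_map.2 ⟨_, subset_close _ _ (List.mem_singleton_self _), rfl⟩
  | @tail b c hb hs ih =>
    obtain ⟨p, hp, h⟩ := List.mem_map.1 ih
    obtain ⟨e, he⟩ := hs.emit
    have hm := (mem_succs hB.spaceBound hb e _).2 ⟨c, hs, he, rfl⟩
    rw [← h] at hm
    exact hB.close_tag.1 p hp _ (List.mem_map.2 ⟨_, hm, rfl⟩)

theorem exists_of_mem_reach {r : M.Rep} (h : r ∈ (M.reach B x).map Prod.fst) :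
    ∃ c, M.Reachable x c ∧ M.rep x (B.tapeLength x) c = r := by
  obtain ⟨p, hp, rfl⟩ := List.mem_map.1 h
  obtain ⟨c, hc, h, -⟩ := hB.reachTag_of_mem hp
  exact ⟨c, hc, h⟩

theorem reachPair_diag : ∀ p ∈ (M.reach B x).map fun p => (p.1, p.1),
    M.ReachPair x (B.tapeLength x) p := by
  intro p hp
  obtain ⟨q, hq, rfl⟩ := List.mem_map.1 hp
  have := hB.exists_of_mem_reach (List.mem_map_of_mem hq)
  exact ⟨this, this, .refl⟩

theorem close_pair : KeyClosed id M.pairSuccs (M.pairs B x) ∧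
    ∀ j, ((closeRound id M.pairSuccs)^[j] ((M.reach B x).map fun p => (p.1, p.1))).length ≤
      B.rounds x * B.rounds x := by
  obtain ⟨φ, hφ⟩ := exists_code hB.space (B.tapeLength x)
  -- Pairs have at most the squared number of codes, which is why `pairs` uses the squared number of
  -- rounds.
  have hlt := Nat.mul_self_lt_mul_self hB.card
  have h := closed_close (key := id) (succ := M.pairSuccs) (ReachPair.succs hB.spaceBound)
    (L := (M.reach B x).map fun p => (p.1, p.1)) hB.reachPair_diag
    (by
      have h1 := hB.nodup_reach.map (f := fun r => (r, r)) fun r r' h => (Prod.mk.inj h).1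
      simpa [List.map_map, Function.comp_def] using h1) (fun p => (φ p.1, φ p.2))
    (by
      rintro ⟨r, t⟩ ⟨r', t'⟩ ⟨⟨c, hc, rfl⟩, ⟨d, hd, rfl⟩, -⟩ ⟨⟨c', hc', rfl⟩, ⟨d', hd', rfl⟩, -⟩ h
      obtain ⟨h1, h2⟩ := Prod.mk.inj h
      exact Prod.ext (hφ c c' hc hc' h1) (hφ d d' hd hd' h2))
    (i := (B.coeff * B.coeff) * (x.length + 1) ^ (B.deg + B.deg)) (by
      have : B.rounds x * B.rounds x = (B.coeff * B.coeff) * (x.length + 1) ^ (B.deg + B.deg) := by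
        rw [Bounds.rounds, pow_add]; ring
      rw [← this]
      simpa using hlt)
  exact ⟨h.1, fun j => (h.2 j).trans (by simpa using hlt.le)⟩

theorem reachPair_of_mem {p : M.Rep × M.Rep} (hp : p ∈ M.pairs B x) :
    M.ReachPair x (B.tapeLength x) p :=
  forall_close (ReachPair.succs hB.spaceBound) hB.reachPair_diag _ p hp

theorem mem_pairs {r r' : M.Rep} (hr : r ∈ (M.reach B x).map Prod.fst) (h : M.Silent r r') :
    (r, r') ∈ M.pairs B x := by
  induction h with
  | refl =>
    obtain ⟨p, hp, rfl⟩ := List.mem_map.1 hr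
    exact subset_close _ _ (List.mem_map.2 ⟨p, hp, rfl⟩)
  | @tail b c hb hs ih =>
    have := hB.close_pair.1 _ ih (r, c) (List.mem_flatMap.2 ⟨(none, c), hs, by simp⟩)
    simpa using this

theorem mem_pairs_iff {r r' : M.Rep} : (r, r') ∈ M.pairs B x ↔
    r ∈ (M.reach B x).map Prod.fst ∧ M.Silent r r' := by
  constructor
  · intro h
    obtain ⟨⟨c, hc, rfl⟩, -, h3⟩ := hB.reachPair_of_mem h
    exact ⟨hB.mem_reach hc, h3⟩
  · exact fun h => hB.mem_pairs h.1 h.2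

theorem mem_autTrans {p q : ℕ} {a : α} : (p, a, q) ∈ M.autTrans B x ↔ ∃ r r₁ r',
    (r, p) ∈ M.nodes B x ∧ M.Silent r r₁ ∧ (some a, r') ∈ M.succs r₁ ∧ (r', q) ∈ M.nodes B x := by
  simp only [autTrans, List.mem_flatMap, decide_eq_true_eq]
  constructor
  · rintro ⟨⟨r, p'⟩, h1, ⟨r₀, r₁⟩, h2, h3⟩
    split_ifs at h3 with h4
    · obtain ⟨⟨e, r'⟩, h5, ⟨r'', q'⟩, h6, h7⟩ := by simpa only [List.mem_flatMap] using h3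
      split_ifs at h7 with h8
      · obtain ⟨l, hl, h9⟩ := List.mem_map.1 h7
        obtain rfl : e = some l := by cases e <;> simp_all
        simp only [Prod.mk.injEq] at h9
        obtain ⟨rfl, rfl, rfl⟩ := h9
        dsimp only at h4 h8
        subst h4 h8
        exact ⟨_, _, _, h1, (hB.mem_pairs_iff.1 h2).2, h5, h6⟩
      · simp at h7
    · simp at h3
  · rintro ⟨r, r₁, r', h1, h2, h3, h4⟩
    refine ⟨(r, p), h1, (r, r₁), hB.mem_pairs (mem_of_mem_number h1) h2, ?_⟩
    rw [if_pos rfl]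
    refine List.mem_flatMap.2 ⟨_, h3, List.mem_flatMap.2 ⟨_, h4, ?_⟩⟩
    rw [if_pos rfl]
    simp

theorem mem_autFinals {p : ℕ} : p ∈ M.autFinals B x ↔ ∃ r r₁,
    (r, p) ∈ M.nodes B x ∧ M.Silent r r₁ ∧ M.accHalt r₁ = true := by
  simp only [autFinals, List.mem_flatMap, List.any_eq_true, Bool.and_eq_true, decide_eq_true_eq]
  constructor
  · rintro ⟨⟨r, p'⟩, h1, h2⟩
    split_ifs at h2 with h3
    · obtain ⟨⟨r₀, r₁⟩, h4, rfl, h5⟩ := h3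
      obtain rfl : p = p' := by simpa using h2
      exact ⟨_, _, h1, (hB.mem_pairs_iff.1 h4).2, h5⟩
    · simp at h2
  · rintro ⟨r, r₁, h1, h2, h3⟩
    refine ⟨(r, p), h1, ?_⟩
    rw [if_pos ⟨(r, r₁), hB.mem_pairs (mem_of_mem_number h1) h2, rfl, h3⟩]
    simp

omit hB in
theorem mem_autStarts {p : ℕ} :
    p ∈ M.autStarts B x ↔ (M.initRep x (B.tapeLength x), p) ∈ M.nodes B x := by
  simp only [autStarts, List.mem_flatMap, decide_eq_true_eq]
  constructor
  · rintro ⟨⟨r, p'⟩, h1, h2⟩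
    split_ifs at h2 with h3
    · obtain rfl : p = p' := by simpa using h2
      dsimp only at h3
      rwa [← h3]
    · simp at h2
  · intro h
    exact ⟨_, h, by simp⟩

/-- A number belongs to only one representation, so the transitions of a numerical run fit together
as transitions between representations. -/
theorem nodeRun_of_rawRun {w : List α} {p : ℕ} {qs : List ℕ} {r : M.Rep}
    (h : RawRun (M.autTrans B x) (M.autFinals B x) p w qs) (hr : (r, p) ∈ M.nodes B x) :
    ∃ rs, M.NodeRun r w rs ∧ List.Forall₂ (fun r q => (r, q) ∈ M.nodes B x) rs qs := by
  induction w generalizing p qs r with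
  | nil =>
    cases qs with
    | cons => exact h.elim
    | nil =>
      obtain ⟨r', r₁, h1, h2, h3⟩ := hB.mem_autFinals.1 h
      obtain rfl : r = r' := congrArg Prod.fst (number_label_inj hr h1 rfl)
      exact ⟨[], ⟨r₁, h2, h3⟩, .nil⟩
  | cons a w ih =>
    cases qs with
    | nil => exact h.elim
    | cons q qs =>
      obtain ⟨h1, h2⟩ := h
      obtain ⟨r', r₁, r₂, h3, h4, h5, h6⟩ := hB.mem_autTrans.1 h1
      obtain rfl : r = r' := congrArg Prod.fst (number_label_inj hr h3 rfl)
      obtain ⟨rs, h7, h8⟩ := ih h2 h6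
      exact ⟨r₂ :: rs, ⟨⟨r₁, h4, h5⟩, h7⟩, .cons h6 h8⟩

theorem exists_rawRun {w : List α} {p : ℕ} {rs : List M.Rep} {r : M.Rep}
    (h : M.NodeRun r w rs) (hr : (r, p) ∈ M.nodes B x) :
    ∃ qs, RawRun (M.autTrans B x) (M.autFinals B x) p w qs := by
  induction w generalizing p rs r with
  | nil =>
    cases rs with
    | cons => exact h.elim
    | nil =>
      obtain ⟨r₁, h1, h2⟩ := h
      exact ⟨[], hB.mem_autFinals.2 ⟨r, r₁, hr, h1, h2⟩⟩
  | cons a w ih =>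
    cases rs with
    | nil => exact h.elim
    | cons r₂ rs =>
      obtain ⟨⟨r₁, h1, h2⟩, h3⟩ := h
      -- The invariant of the pairs exhibits `r₁` as a representation of a reachable configuration;
      -- hence `r₂` is one too and has a number.
      obtain ⟨-, ⟨c, hc, rfl⟩, -⟩ := hB.reachPair_of_mem (hB.mem_pairs (mem_of_mem_number hr) h1)
      obtain ⟨d, hd, -, rfl⟩ := (mem_succs hB.spaceBound hc _ _).1 h2
      obtain ⟨q, hq⟩ := exists_mem_number (hB.mem_reach (hc.tail hd))
      obtain ⟨qs, h4⟩ := ih h3 hq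
      exact ⟨q :: qs, hB.mem_autTrans.2 ⟨_, _, _, hr, h1, h2, hq⟩, h4⟩

omit hB in
theorem lt_of_mem_nodes {p : M.Rep × ℕ} (h : p ∈ M.nodes B x) : p.2 < (M.nodes B x).length := by
  rw [nodes, length_number]
  exact lt_of_mem_number h

/-- The reduction yields an instance with the automaton of the configurations. -/
theorem reduction_spec (zero one : α) : ∃ A : ListedNFA α,
    M.reduction B zero one x = encodeInstance zero one A (M.witnessLength B x) ∧
    (∀ w, w ∈ A.toNFA.accepts ↔ w ∈ M.outputs x) ∧
    (M.UnambiguousOn x → Unambiguous A.toNFA) := by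
  refine ⟨ListedNFA.ofRaw (M.nodes B x).length (M.autTrans B x) (M.autStarts B x) (M.autFinals B x)
    ?_ ?_ ?_, ?_, ?_, ?_⟩
  · rintro ⟨p, a, q⟩ h
    obtain ⟨r, r₁, r', h1, -, -, h2⟩ := hB.mem_autTrans.1 h
    exact ⟨lt_of_mem_nodes h1, lt_of_mem_nodes h2⟩
  · intro p h
    exact lt_of_mem_nodes (mem_autStarts.1 h)
  · intro p h
    obtain ⟨r, r₁, h1, -⟩ := hB.mem_autFinals.1 h
    exact lt_of_mem_nodes h1
  · rw [encodeInstance_eq, ListedNFA.rawTrans_ofRaw, ListedNFA.rawStarts_ofRaw,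
      ListedNFA.rawFinals_ofRaw]
    rfl
  · intro w
    rw [ListedNFA.mem_accepts_iff, ListedNFA.rawTrans_ofRaw, ListedNFA.rawStarts_ofRaw,
      ListedNFA.rawFinals_ofRaw, mem_outputs_iff hB.spaceBound]
    constructor
    · rintro ⟨p, hp, qs, h⟩
      obtain ⟨rs, h, -⟩ := hB.nodeRun_of_rawRun h (mem_autStarts.1 hp)
      exact ⟨rs, h⟩
    · rintro ⟨rs, h⟩
      have hi := hB.mem_reach (M := M) .refl
      rw [rep_initial] at hi
      obtain ⟨p, hp⟩ := exists_mem_number hi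
      exact ⟨p, mem_autStarts.2 hp, hB.exists_rawRun h hp⟩
  · intro hU
    rw [ListedNFA.unambiguous_iff]
    rw [ListedNFA.rawTrans_ofRaw, ListedNFA.rawStarts_ofRaw, ListedNFA.rawFinals_ofRaw]
    intro w p hp p' hp' qs qs' h h'
    have hp := mem_autStarts.1 hp
    have hp' := mem_autStarts.1 hp'
    -- Each representation is listed once and so has only one number. Thus equality of the node runs
    -- gives equality of the numerical runs.
    have hu : ∀ {r p p'}, (r, p) ∈ M.nodes B x → (r, p') ∈ M.nodes B x → p = p' := fun h h' =>
      congrArg Prod.snd (number_fst_inj hB.nodup_reach h h' rfl)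
    obtain ⟨rs, h1, h2⟩ := hB.nodeRun_of_rawRun h hp
    obtain ⟨rs', h1', h2'⟩ := hB.nodeRun_of_rawRun h' hp'
    obtain rfl := hU.nodeRun_unique hB.spaceBound h1 h1'
    refine ⟨hu hp hp', ?_⟩
    clear h1 h1' h h'
    induction h2 generalizing qs' with
    | nil => cases h2'; rfl
    | cons a b ih => cases h2' with | cons a' b' => rw [hu a a', ih _ b']

/-- The first accepting halting entry of the search comes from some reachable configuration whose
output has the recorded length. That output is a witness, so the fixed witness length carries over
to all outputs. -/
theorem length_of_mem_outputs (hR : FixedLength M.relation) {w : List α} (hw : w ∈ M.outputs x) :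
    w.length = M.witnessLength B x := by
  obtain ⟨ρ, hρ⟩ := id hw
  have hreach : ∀ {ρ : List M.Cfg} {c c' : M.Cfg}, M.Reachable x c → (c :: ρ).IsChain (M.Step x) →
      (c :: ρ).getLast? = some c' → M.Reachable x c' := by
    intro ρ
    induction ρ with
    | nil =>
      intro c c' hc _ h
      obtain rfl : c = c' := by simpa using h
      exact hc
    | cons d ρ ih =>
      intro c c' hc h1 h2
      rw [List.isChain_cons_cons] at h1
      exact ih (hc.tail h1.1) h1.2 (by simpa using h2)
  obtain ⟨ρ', -, h1, c', h2, h3, h4, rfl⟩ := isAcceptingRun_iff.1 hρ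
  have hc' := hreach .refl h1 h2
  obtain ⟨p, hp, hp'⟩ := List.mem_map.1 (hB.mem_reach hc')
  have hmem : p ∈ (M.reach B x).filter fun p => M.accHalt p.1 := by
    refine List.mem_filter.2 ⟨hp, ?_⟩
    rw [hp']
    exact (accHalt_rep hB.spaceBound hc').2 ⟨h3, h4⟩
  -- The default `0` does not matter: `hmem` shows that the filtered list is not empty. Without any
  -- output the automaton accepts nothing, whatever the length.
  rw [witnessLength]
  generalize hL : ((M.reach B x).filter fun p => M.accHalt p.1) = L at hmem
  cases L with
  | nil => simp at hmem
  | cons q L =>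
    have hq : q ∈ (M.reach B x).filter fun p => M.accHalt p.1 := by rw [hL]; simp
    obtain ⟨hq1, hq2⟩ := List.mem_filter.1 hq
    obtain ⟨c, hc, h5, h6⟩ := hB.reachTag_of_mem hq1
    rw [← h5, accHalt_rep hB.spaceBound hc] at hq2
    have hout : c.output ∈ M.outputs x := by
      obtain ⟨l, hl1, hl2⟩ := List.exists_isChain_cons_of_relationReflTransGen hc
      exact ⟨_, isAcceptingRun_iff.2 ⟨l, rfl, hl1, c, by rw [List.getLast?_eq_some_getLast (by simp), hl2],
        hq2.1, hq2.2, rfl⟩⟩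
    simp only [List.head?_cons, Option.map_some, Option.getD_some, ← h6]
    exact hR x _ _ hw hout

end Bounds.Fits

/-- Every relation of an NL-transducer reduces to the membership problem of automata. -/
theorem IsNL.exists_reduction [Fintype α] (hM : M.IsNL) (hR : FixedLength M.relation)
    (zero one : α) : ∃ f : List α → List α, PolyTime f ∧ ∀ x, ∃ (A : ListedNFA α) (k : ℕ),
      f x = encodeInstance zero one A k ∧
      (∀ w, w ∈ M.outputs x ↔ w.length = k ∧ w ∈ A.toNFA.accepts) ∧
      (M.UnambiguousOn x → Unambiguous A.toNFA) := by
  obtain ⟨f, hf, hspace⟩ := hM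
  obtain ⟨s, c, d, h⟩ := exists_bounds hf (Fintype.card M.Q) (Fintype.card M.Γ)
  set B : Bounds := ⟨s, c, d⟩
  have hB : ∀ x, B.Fits M x (f x.length) := fun x => ⟨hspace x, (h x.length).1, (h x.length).2⟩
  have hpoly : ∀ x : List α, B.rounds x = (Polynomial.C c * (Polynomial.X + 1) ^ d).eval x.length :=
    fun x => by simp [Bounds.rounds, B]
  have hpos : ∀ x, 0 < B.rounds x := fun x => (Nat.zero_le _).trans_lt (hB x).card
  refine ⟨M.reduction B zero one, polyTime_reduction M B zero one
    -- The square of the number of rounds bounds both searches: the list of pairs directly, the list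
    -- of configurations because the number of rounds is positive.
    ((Polynomial.C c * (Polynomial.X + 1) ^ d) * (Polynomial.C c * (Polynomial.X + 1) ^ d))
    (fun x i => ?_) (fun x i => ?_), fun x => ?_⟩
  · rw [Polynomial.eval_mul, ← hpoly]
    exact ((hB x).close_tag.2 i).trans (Nat.le_mul_of_pos_left _ (hpos x))
  · rw [Polynomial.eval_mul, ← hpoly]
    exact (hB x).close_pair.2 i
  · obtain ⟨A, h1, h2, h3⟩ := (hB x).reduction_spec zero one
    refine ⟨A, _, h1, fun w => ?_, h3⟩
    rw [h2]
    exact ⟨fun hw => ⟨(hB x).length_of_mem_outputs hR hw, hw⟩, And.right⟩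

end Transducer

theorem exists_reduction_memNFA {α : Type} [Fintype α] {zero one : α} (h01 : zero ≠ one) {R : Rel α}
    (hR : R ∈ RelationNL α) : ∃ f, IsReduction f R (memNFA zero one) := by
  obtain ⟨hfix, M, hM, rfl⟩ := hR
  obtain ⟨f, hf, h⟩ := hM.exists_reduction hfix zero one
  refine ⟨f, hf, fun x => Set.ext fun w => ?_⟩
  obtain ⟨A, k, h1, h2, -⟩ := h x
  rw [h1, mem_memNFA h01, ← h2]
  rfl

theorem exists_reduction_memUFA {α : Type} [Fintype α] {zero one : α} (h01 : zero ≠ one) {R : Rel α}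
    (hR : R ∈ RelationUL α) : ∃ f, IsReduction f R (memUFA zero one) ∧
      ∀ x, f x ∈ ufaInstances zero one := by
  obtain ⟨hfix, M, ⟨hM, hU⟩, rfl⟩ := hR
  obtain ⟨f, hf, h⟩ := hM.exists_reduction hfix zero one
  refine ⟨f, ⟨hf, fun x => Set.ext fun w => ?_⟩, fun x => ?_⟩
  · obtain ⟨A, k, h1, h2, h3⟩ := h x
    rw [h1, mem_memUFA h01 (h3 (hU x)), ← h2]
    rfl
  · obtain ⟨A, k, h1, -, h3⟩ := h x
    exact ⟨A, k, h1, h3 (hU x)⟩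

end LogspaceRelations

namespace LogspaceRelations

namespace Transducer

/-! ### Counting accepting runs -/

variable {α : Type} {M : Transducer α} [Finite α] {x y : List α} {c d : M.Cfg}

/-- Some accepting run with output `y` continues `c`. -/
def Acc (M : Transducer α) (x : List α) (c : M.Cfg) (y : List α) : Prop :=
  ∃ ρ, M.IsRunFrom x y c ρ

/-- At most one accepting run with output `y` continues `c`. -/
def AtMostOne (M : Transducer α) (x : List α) (c : M.Cfg) (y : List α) : Prop :=
  ∀ ρ ρ', M.IsRunFrom x y c ρ → M.IsRunFrom x y c ρ' → ρ = ρ'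

/-- No accepting run continues `c`. -/
def Dead (M : Transducer α) (x : List α) (c : M.Cfg) : Prop := ∀ y, ¬ M.Acc x c y

/-- The accepting runs from `c` are those from `d` with a fixed beginning. -/
def Det (M : Transducer α) (x : List α) (c d : M.Cfg) : Prop :=
  ∀ y, (M.Acc x c y ↔ M.Acc x d y) ∧ (M.AtMostOne x d y → M.AtMostOne x c y)

theorem acc_iff : M.Acc x c y ↔ (M.Halted x c ∧ c.state ∈ M.accepting ∧ c.output = y) ∨
    ∃ d, M.Step x c d ∧ M.Acc x d y := by
  constructor
  · rintro ⟨_ | ⟨d, ρ⟩, h⟩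
    · exact .inl (isRunFrom_nil.1 h)
    · exact .inr ⟨d, (isRunFrom_cons.1 h).1, ρ, (isRunFrom_cons.1 h).2⟩
  · rintro (h | ⟨d, h, ρ, h'⟩)
    · exact ⟨[], isRunFrom_nil.2 h⟩
    · exact ⟨d :: ρ, isRunFrom_cons.2 ⟨h, h'⟩⟩

theorem acc_iff_of_step (hs : M.Step x c d) : M.Acc x c y ↔ ∃ d, M.Step x c d ∧ M.Acc x d y := by
  rw [acc_iff, or_iff_right]
  exact fun h => h.1 d hs

/-- Accepting requires halting, so an empty and a nonempty continuation exclude each other. Two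
nonempty ones have the same first step by `hu`. -/
theorem atMostOne_of_steps (h : ∀ d, M.Step x c d → M.AtMostOne x d y)
    (hu : ∀ d d', M.Step x c d → M.Step x c d' → M.Acc x d y → M.Acc x d' y → d = d') :
    M.AtMostOne x c y := by
  rintro (_ | ⟨d, ρ⟩) (_ | ⟨d', ρ'⟩) h1 h2
  · rfl
  · exact absurd (isRunFrom_cons.1 h2).1 ((isRunFrom_nil.1 h1).1 d')
  · exact absurd (isRunFrom_cons.1 h1).1 ((isRunFrom_nil.1 h2).1 d)
  · obtain ⟨h3, h4⟩ := isRunFrom_cons.1 h1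
    obtain ⟨h5, h6⟩ := isRunFrom_cons.1 h2
    obtain rfl := hu d d' h3 h5 ⟨ρ, h4⟩ ⟨ρ', h6⟩
    rw [h d h3 ρ ρ' h4 h6]

theorem atMostOne_of_not_acc (h : ¬ M.Acc x c y) : M.AtMostOne x c y :=
  fun ρ _ h1 _ => absurd ⟨ρ, h1⟩ h

theorem Det.refl (c : M.Cfg) : M.Det x c c := fun _ => ⟨Iff.rfl, fun h => h⟩

theorem Det.trans {e : M.Cfg} (h : M.Det x c d) (h' : M.Det x d e) : M.Det x c e := fun y =>
  ⟨(h y).1.trans (h' y).1, fun hs => (h y).2 ((h' y).2 hs)⟩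

theorem Det.dead (h : M.Det x c d) (hd : M.Dead x d) : M.Dead x c :=
  fun y hc => hd y ((h y).1.1 hc)

theorem det_of_step (h : ∀ d', M.Step x c d' ↔ d' = d) : M.Det x c d := fun y => by
  refine ⟨?_, fun hd => atMostOne_of_steps (fun d' hd' => ?_) fun d' d'' h1 h2 _ _ => ?_⟩
  · rw [acc_iff_of_step ((h d).2 rfl)]
    simp [h]
  · rwa [(h d').1 hd']
  · rw [(h d').1 h1, (h d'').1 h2]

theorem dead_of_halted (h : M.Halted x c) (h' : c.state ∉ M.accepting) : M.Dead x c := fun y hy => by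
  rcases acc_iff.1 hy with h1 | ⟨d, h1, -⟩
  · exact h' h1.2.1
  · exact h d h1

omit [Finite α] in
theorem halted_of_eq_empty (h : M.δ c.state (readInput x c.inputPos) (c.work c.workPos) = ∅) :
    M.Halted x c := by
  rintro d ⟨a, ha, -⟩
  simp [h] at ha

omit [Finite α] in
theorem step_iff_of_eq_singleton {a : Action α M.Q M.Γ} {i j : ℕ}
    (h : M.δ c.state (readInput x c.inputPos) (c.work c.workPos) = {a})
    (hi : a.inputDir.move c.inputPos = some i) (hi' : i ≤ x.length + 1)
    (hj : a.workDir.move c.workPos = some j) (d : M.Cfg) : M.Step x c d ↔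
      d = ⟨a.state, i, j, Function.update c.work c.workPos a.write, c.output ++ a.emit.toList⟩ := by
  simp only [Step, h, Set.mem_singleton_iff, exists_eq_left, hi, hj, Option.some.injEq]
  obtain ⟨q, i', j', w, o⟩ := d
  simp only [Cfg.mk.injEq]
  constructor
  · rintro ⟨rfl, rfl, -, rfl, rfl, rfl⟩; exact ⟨rfl, rfl, rfl, rfl, rfl⟩
  · rintro ⟨rfl, rfl, rfl, rfl, rfl⟩; exact ⟨rfl, rfl, hi', rfl, rfl, rfl⟩

theorem mem_outputs_iff_acc : y ∈ M.outputs x ↔ M.Acc x M.initial y := by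
  constructor
  · rintro ⟨ρ, h⟩
    obtain ⟨ρ', -, h⟩ := isAcceptingRun_iff.1 h
    exact ⟨ρ', h⟩
  · rintro ⟨ρ, h⟩
    exact ⟨_, isAcceptingRun_iff.2 ⟨ρ, rfl, h⟩⟩

theorem unambiguousOn_of_atMostOne (h : ∀ y, M.AtMostOne x M.initial y) : M.UnambiguousOn x := by
  rintro y ⟨ρ, hρ⟩
  refine ⟨ρ, hρ, fun ρ' hρ' => ?_⟩
  obtain ⟨σ, rfl, h1⟩ := isAcceptingRun_iff.1 hρ
  obtain ⟨σ', rfl, h2⟩ := isAcceptingRun_iff.1 hρ'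
  rw [h y _ _ h1 h2]

end Transducer

/-! ### Programs that sweep over the work tape -/

/-- An instruction: either a pass of a deterministic finite-state machine over the columns of the
work tape, possibly followed by a new column, or a choice that depends on the input letter. -/
inductive SweepInstr (α L C σ : Type)
  | sweep (start : σ) (step : σ → C → σ × C) (ext : σ → Option C) (next : σ → Option L)
  | branch (next : InSym α → List (L × Dir × Option α))

/-- A program with labels `L`, columns `C` and states `σ` of the sweeps. -/
structure SweepProg (α L C σ : Type) where
  start : L
  accept : L
  instr : L → SweepInstr α L C σ

/-- The result of a sweep. -/
def sweepRun {C σ : Type} (step : σ → C → σ × C) : σ → List C → σ × List C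
  | s, [] => (s, [])
  | s, c :: l => ((sweepRun step (step s c).1 l).1, (step s c).2 :: (sweepRun step (step s c).1 l).2)

theorem length_sweepRun {C σ : Type} (step : σ → C → σ × C) (s : σ) (l : List C) :
    (sweepRun step s l).2.length = l.length := by
  induction l generalizing s with
  | nil => rfl
  | cons c l ih => simp [sweepRun, ih]

theorem sweepRun_append {C σ : Type} (step : σ → C → σ × C) (s : σ) (l l' : List C) :
    sweepRun step s (l ++ l') = ((sweepRun step (sweepRun step s l).1 l').1,
      (sweepRun step s l).2 ++ (sweepRun step (sweepRun step s l).1 l').2) := by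
  induction l generalizing s with
  | nil => rfl
  | cons c l ih => simp [sweepRun, ih]

/-- A work tape with the given columns in the cells `1, 2, …`. -/
def columnTape {C : Type} (l : List C) : ℕ → Option C
  | 0 => none
  | i + 1 => l[i]?

theorem update_columnTape {C : Type} (l l' : List C) (c c' : C) :
    Function.update (columnTape (l ++ c :: l')) (l.length + 1) (some c') =
      columnTape (l ++ c' :: l') := by
  funext i
  cases i with
  | zero => rfl
  | succ i =>
    simp only [Function.update_apply, columnTape, Nat.add_right_cancel_iff]
    split_ifs with h
    · subst h; simp
    · rcases Nat.lt_or_gt_of_ne h with h | h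
      · rw [List.getElem?_append_left h, List.getElem?_append_left h]
      · rw [List.getElem?_append_right h.le, List.getElem?_append_right h.le]
        obtain ⟨j, hj⟩ := Nat.exists_eq_add_of_lt h
        have : i - l.length = j + 1 := by omega
        simp [this]

theorem update_columnTape_end {C : Type} (l : List C) (o : Option C) :
    Function.update (columnTape l) (l.length + 1) o = columnTape (l ++ o.toList) := by
  funext i
  cases i with
  | zero => rfl
  | succ i =>
    simp only [Function.update_apply, columnTape, Nat.add_right_cancel_iff]
    split_ifs with h
    · subst h; cases o <;> simp
    · rcases Nat.lt_or_gt_of_ne h with h | h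
      · rw [List.getElem?_append_left h]
      · rw [List.getElem?_append_right h.le]
        obtain ⟨j, hj⟩ := Nat.exists_eq_add_of_lt h
        have : i - l.length = j + 1 := by omega
        rw [List.getElem?_eq_none (by omega), this]
        cases o <;> simp

theorem update_columnTape_self {C : Type} (l : List C) (i : ℕ) :
    Function.update (columnTape l) i (columnTape l i) = columnTape l := Function.update_eq_self _ _

namespace SweepProg

variable {α L C σ : Type} [Fintype L] [Fintype C] [Fintype σ] (p : SweepProg α L C σ)

/-- The transition relation of the transducer of a program. -/
def trans : L × Option (Bool × σ) → InSym α → Option C →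
    Set (Action α (L × Option (Bool × σ)) (Option C))
  | (l, none), a, g =>
    match p.instr l with
    | .branch next => {b | ∃ t ∈ next a, b = ⟨(t.1, none), g, t.2.1, .stay, t.2.2⟩}
    | .sweep s _ _ _ => {⟨(l, some (true, s)), g, .stay, .right, none⟩}
  | (l, some (true, s)), _, g =>
    match p.instr l with
    | .branch _ => ∅
    | .sweep _ step ext _ =>
      match g with
      | some c => {⟨(l, some (true, (step s c).1)), some (step s c).2, .stay, .right, none⟩}
      | none => {⟨(l, some (false, s)), ext s, .stay, .left, none⟩}
  | (l, some (false, s)), _, g =>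
    match p.instr l with
    | .branch _ => ∅
    | .sweep _ _ _ next =>
      match g with
      | some c => {⟨(l, some (false, s)), some c, .stay, .left, none⟩}
      | none =>
        match next s with
        | some l' => {⟨(l', none), none, .stay, .stay, none⟩}
        | none => ∅

/-- The transducer of a program. -/
def toTransducer : Transducer α where
  Q := L × Option (Bool × σ)
  Γ := Option C
  blank := none
  start := (p.start, none)
  accepting := {(p.accept, none)}
  δ := p.trans

/-- The configuration at a label. -/
def cfg (l : L) (i : ℕ) (cols : List C) (out : List α) : p.toTransducer.Cfg :=
  ⟨(l, none), i, 0, columnTape cols, out⟩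

theorem initial_eq : p.toTransducer.initial = p.cfg p.start 1 [] [] := by
  have : (fun _ => none : ℕ → Option C) = columnTape [] := by
    funext i; cases i <;> rfl
  simp only [Transducer.initial, cfg, ← this]
  rfl

variable {p} {l : L} {i : ℕ} {cols : List C} {out : List α} {x : List α}

theorem step_iff {q q' : L × Option (Bool × σ)} {i j i' j' : ℕ} {w w' : ℕ → Option C} {g : Option C}
    {out out' : List α} {di dw : Dir} {e : Option α}
    (h : p.trans q (readInput x i) (w j) = {⟨q', g, di, dw, e⟩}) (hi : di.move i = some i')
    (hi' : i' ≤ x.length + 1) (hj : dw.move j = some j') (hw : Function.update w j g = w')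
    (ho : out ++ e.toList = out') (d : p.toTransducer.Cfg) :
    p.toTransducer.Step x (⟨q, i, j, w, out⟩ : p.toTransducer.Cfg) d ↔ d = ⟨q', i', j', w', out'⟩ := by
  subst hw ho
  exact Transducer.step_iff_of_eq_singleton (M := p.toTransducer) (c := ⟨q, i, j, w, out⟩)
    (a := ⟨q', g, di, dw, e⟩) h hi hi' hj d

section Sweep

variable {s₀ : σ} {step : σ → C → σ × C} {ext : σ → Option C} {next : σ → Option L}
  (hl : p.instr l = .sweep s₀ step ext next)
include hl

/-- The configurations during the forward part of a sweep. -/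
abbrev fwd (p : SweepProg α L C σ) (l : L) (s : σ) (i : ℕ) (done rest : List C) (out : List α) :
    p.toTransducer.Cfg :=
  ⟨(l, some (true, s)), i, done.length + 1, columnTape (done ++ rest), out⟩

/-- The configurations during the backward part of a sweep. -/
abbrev back (p : SweepProg α L C σ) (l : L) (s : σ) (i j : ℕ) (cols : List C) (out : List α) :
    p.toTransducer.Cfg :=
  ⟨(l, some (false, s)), i, j, columnTape cols, out⟩

theorem step_sweep_start (hi : i ≤ x.length + 1) (d : p.toTransducer.Cfg) :
    p.toTransducer.Step x (p.cfg l i cols out) d ↔ d = p.fwd l s₀ i [] cols out :=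
  step_iff (g := columnTape cols 0) (di := .stay) (dw := .right) (e := none) (by simp [trans, hl]) rfl hi rfl
    (update_columnTape_self _ _) (by simp) d

theorem step_fwd_cons (hi : i ≤ x.length + 1) {s : σ} {done : List C} {c : C} {rest : List C}
    (d : p.toTransducer.Cfg) : p.toTransducer.Step x (p.fwd l s i done (c :: rest) out) d ↔
      d = p.fwd l (step s c).1 i (done ++ [(step s c).2]) rest out :=
  step_iff (g := some (step s c).2) (di := .stay) (dw := .right) (e := none) (j' := (done ++ [(step s c).2]).length + 1)
    (by simp [trans, hl, columnTape]) rfl hi (by simp [Dir.move])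
    (by simp [update_columnTape]) (by simp) d

theorem step_fwd_nil (hi : i ≤ x.length + 1) {s : σ} {done : List C}
    (d : p.toTransducer.Cfg) : p.toTransducer.Step x (p.fwd l s i done [] out) d ↔
      d = p.back l s i done.length (done ++ (ext s).toList) out :=
  step_iff (g := ext s) (di := .stay) (dw := .left) (e := none) (by simp [trans, hl, columnTape]) rfl hi rfl
    (by simp [update_columnTape_end]) (by simp) d

theorem step_back_succ (hi : i ≤ x.length + 1) {s : σ} {j : ℕ} (hj : j < cols.length)
    (d : p.toTransducer.Cfg) : p.toTransducer.Step x (p.back l s i (j + 1) cols out) d ↔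
      d = p.back l s i j cols out :=
  step_iff (g := columnTape cols (j + 1)) (di := .stay) (dw := .left) (e := none)
    (by simp [trans, hl, columnTape, hj]) rfl hi rfl (update_columnTape_self _ _) (by simp) d

theorem step_back_zero (hi : i ≤ x.length + 1) {s : σ} {l' : L} (hn : next s = some l')
    (d : p.toTransducer.Cfg) : p.toTransducer.Step x (p.back l s i 0 cols out) d ↔
      d = p.cfg l' i cols out :=
  step_iff (g := columnTape cols 0) (di := .stay) (dw := .stay) (e := none) (by simp [trans, hl, columnTape, hn]) rfl hi
    rfl (update_columnTape_self _ _) (by simp) d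

theorem halted_back_zero {s : σ} (hn : next s = none) :
    p.toTransducer.Halted x (p.back l s i 0 cols out) :=
  Transducer.halted_of_eq_empty (by
    change p.trans (l, some (false, s)) (readInput x i) (columnTape cols 0) = ∅
    simp [trans, hl, columnTape, hn])

variable [Finite α]

theorem det_fwd (hi : i ≤ x.length + 1) (s : σ) (done rest : List C) :
    p.toTransducer.Det x (p.fwd l s i done rest out) (p.fwd l (sweepRun step s rest).1 i
      (done ++ (sweepRun step s rest).2) [] out) := by
  induction rest generalizing s done with
  | nil => simpa [sweepRun] using Transducer.Det.refl _
  | cons c rest ih =>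
    refine (Transducer.det_of_step (step_fwd_cons hl hi)).trans ?_
    simpa [sweepRun] using ih (step s c).1 (done ++ [(step s c).2])

theorem det_back (hi : i ≤ x.length + 1) (s : σ) {j : ℕ} (hj : j ≤ cols.length) :
    p.toTransducer.Det x (p.back l s i j cols out) (p.back l s i 0 cols out) := by
  induction j with
  | zero => exact .refl _
  | succ j ih => exact (Transducer.det_of_step (step_back_succ hl hi hj)).trans (ih (by omega))

theorem det_sweep_back (hi : i ≤ x.length + 1) {s : σ} {cols' : List C}
    (hr : sweepRun step s₀ cols = (s, cols')) :
    p.toTransducer.Det x (p.cfg l i cols out) (p.back l s i 0 (cols' ++ (ext s).toList) out) := by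
  refine (Transducer.det_of_step (step_sweep_start hl hi)).trans
    ((det_fwd hl hi s₀ [] cols).trans ?_)
  rw [hr]
  exact (Transducer.det_of_step (step_fwd_nil hl hi)).trans (det_back hl hi s (by simp))

theorem det_sweep (hi : i ≤ x.length + 1) {s : σ} {cols' : List C}
    (hr : sweepRun step s₀ cols = (s, cols')) {l' : L} (hn : next s = some l') :
    p.toTransducer.Det x (p.cfg l i cols out) (p.cfg l' i (cols' ++ (ext s).toList) out) :=
  (det_sweep_back hl hi hr).trans (Transducer.det_of_step (step_back_zero hl hi hn))

theorem dead_sweep (hi : i ≤ x.length + 1) {s : σ} {cols' : List C}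
    (hr : sweepRun step s₀ cols = (s, cols')) (hn : next s = none) :
    p.toTransducer.Dead x (p.cfg l i cols out) :=
  (det_sweep_back hl hi hr).dead (Transducer.dead_of_halted (halted_back_zero hl hn)
    (fun h => by cases h))

end Sweep

section Branch

variable {next : InSym α → List (L × Dir × Option α)} (hl : p.instr l = .branch next)
include hl

theorem step_branch (d : p.toTransducer.Cfg) : p.toTransducer.Step x (p.cfg l i cols out) d ↔
    ∃ t ∈ next (readInput x i), ∃ i', t.2.1.move i = some i' ∧ i' ≤ x.length + 1 ∧
      d = p.cfg t.1 i' cols (out ++ t.2.2.toList) := by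
  obtain ⟨q, i', j', w, o⟩ := d
  have h : p.toTransducer.δ (p.cfg l i cols out).state (readInput x i) (columnTape cols 0) =
      {b | ∃ t ∈ next (readInput x i), b = ⟨(t.1, none), columnTape cols 0, t.2.1, .stay, t.2.2⟩} := by
    change p.trans (l, none) _ _ = _
    simp [trans, hl]
    rfl
  constructor
  · rintro ⟨a, ha, h1, h2, h3, h4, h5, h6⟩
    obtain ⟨t, ht, rfl⟩ := h.subset ha
    refine ⟨t, ht, i', h2, h3, ?_⟩
    have h5' : w = columnTape cols := h5.trans (update_columnTape_self _ _)
    have h4 : 0 = j' := Option.some.inj h4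
    exact (Transducer.Cfg.mk.injEq ..).mpr ⟨h1, rfl, h4.symm, h5', h6⟩
  · rintro ⟨t, ht, i'', h2, h3, h4⟩
    obtain ⟨rfl, rfl, rfl, rfl, rfl⟩ := (Transducer.Cfg.mk.injEq ..).mp h4
    refine ⟨_, h.superset ⟨t, ht, rfl⟩, ?_, h2, h3, ?_, ?_, ?_⟩
    · rfl
    · rfl
    · exact (update_columnTape_self cols 0).symm
    · rfl

variable [Finite α]

theorem det_branch {l' : L} {dir : Dir} {e : Option α} {i' : ℕ}
    (hn : next (readInput x i) = [(l', dir, e)]) (hi : dir.move i = some i')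
    (hi' : i' ≤ x.length + 1) :
    p.toTransducer.Det x (p.cfg l i cols out) (p.cfg l' i' cols (out ++ e.toList)) := by
  refine Transducer.det_of_step fun d => ?_
  simp [step_branch hl, hn, hi, hi']

theorem dead_branch (hn : next (readInput x i) = []) (h : l ≠ p.accept) :
    p.toTransducer.Dead x (p.cfg l i cols out) := by
  refine Transducer.dead_of_halted (fun d hd => ?_) fun h' => h (congrArg Prod.fst h')
  simp [step_branch hl, hn] at hd

end Branch

/-- A program whose number of columns stays below `b` uses the first `b + 2` cells. -/
theorem spaceBound (J : L → ℕ → List C → Prop) {b : ℕ} (h0 : J p.start 1 [])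
    (hbranch : ∀ l next i cols, p.instr l = .branch next → J l i cols →
      ∀ t ∈ next (readInput x i), ∀ i', t.2.1.move i = some i' → i' ≤ x.length + 1 → J t.1 i' cols)
    (hsweep : ∀ l s₀ step ext next i cols, p.instr l = .sweep s₀ step ext next →
      i ≤ x.length + 1 → J l i cols →
      (cols.length ≤ b ∧
        ((sweepRun step s₀ cols).2 ++ (ext (sweepRun step s₀ cols).1).toList).length ≤ b) ∧
      ∀ l', next (sweepRun step s₀ cols).1 = some l' →
        J l' i ((sweepRun step s₀ cols).2 ++ (ext (sweepRun step s₀ cols).1).toList)) :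
    p.toTransducer.SpaceBound x (b + 2) := by
  -- `J` speaks only of configurations at labels; those in the middle of a sweep are described by
  -- the label configuration at which the sweep began. The head sees cell `0`, at most `b` columns
  -- and the blank cell behind them, hence `b + 2` cells.
  have key : ∀ c, p.toTransducer.Reachable x c → ∃ l i out, i ≤ x.length + 1 ∧
      ((∃ cols, J l i cols ∧ c = p.cfg l i cols out) ∨
      ∃ s₀ step ext next cols, p.instr l = .sweep s₀ step ext next ∧ J l i cols ∧
        ((∃ l₁ l₂, cols = l₁ ++ l₂ ∧
          c = p.fwd l (sweepRun step s₀ l₁).1 i (sweepRun step s₀ l₁).2 l₂ out) ∨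
        ∃ j, j ≤ b ∧ j ≤ ((sweepRun step s₀ cols).2 ++
            (ext (sweepRun step s₀ cols).1).toList).length ∧
          c = p.back l (sweepRun step s₀ cols).1 i j ((sweepRun step s₀ cols).2 ++
            (ext (sweepRun step s₀ cols).1).toList) out)) := by
    intro c hc
    induction hc with
    | refl => exact ⟨p.start, 1, [], by omega, .inl ⟨[], h0, p.initial_eq⟩⟩
    | @tail c d hc hs ih =>
      obtain ⟨l, i, out, hi, ⟨cols, hJ, rfl⟩ | ⟨s₀, step, ext, next, cols, hl, hJ,
        ⟨l₁, l₂, rfl, rfl⟩ | ⟨j, hjb, hj, rfl⟩⟩⟩ := ih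
      · cases hl : p.instr l with
        | branch next =>
          obtain ⟨t, ht, i', h1, h2, rfl⟩ := (step_branch hl d).1 hs
          exact ⟨_, _, _, h2, .inl ⟨_, hbranch l next i cols hl hJ t ht i' h1 h2, rfl⟩⟩
        | sweep s₀ step ext next =>
          obtain rfl := (step_sweep_start hl hi d).1 hs
          exact ⟨l, i, out, hi, .inr ⟨s₀, step, ext, next, cols, hl, hJ,
            .inl ⟨[], cols, rfl, rfl⟩⟩⟩
      · cases l₂ with
        | nil =>
          obtain rfl := (step_fwd_nil hl hi d).1 hs
          have hb := (hsweep l s₀ step ext next i _ hl hi hJ).1.2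
          refine ⟨l, i, out, hi, .inr ⟨s₀, step, ext, next, _, hl, hJ, .inr ⟨(sweepRun step s₀ l₁).2.length,
            ?_, ?_, ?_⟩⟩⟩
          · rw [List.append_nil, List.length_append] at hb; omega
          · rw [List.append_nil, List.length_append]; omega
          · rw [List.append_nil]
        | cons c l₂ =>
          obtain rfl := (step_fwd_cons hl hi d).1 hs
          refine ⟨l, i, out, hi, .inr ⟨s₀, step, ext, next, _, hl, hJ,
            .inl ⟨l₁ ++ [c], l₂, by simp, ?_⟩⟩⟩
          simp [sweepRun_append, sweepRun]
      · cases j with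
        | zero =>
          cases hn : next (sweepRun step s₀ cols).1 with
          | none => exact absurd hs (halted_back_zero hl hn d)
          | some l' =>
            obtain rfl := (step_back_zero hl hi hn d).1 hs
            exact ⟨l', i, out, hi, .inl ⟨_, (hsweep l s₀ step ext next i _ hl hi hJ).2 l' hn, rfl⟩⟩
        | succ j =>
          obtain rfl := (step_back_succ hl hi (by omega) d).1 hs
          exact ⟨l, i, out, hi, .inr ⟨s₀, step, ext, next, cols, hl, hJ,
            .inr ⟨j, by omega, by omega, rfl⟩⟩⟩
  intro c hc
  obtain ⟨l, i, out, hi, ⟨cols, hJ, rfl⟩ | ⟨s₀, step, ext, next, cols, hl, hJ,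
    ⟨l₁, l₂, rfl, rfl⟩ | ⟨j, hjb, hj, rfl⟩⟩⟩ := key c hc
  · simp [cfg]
  · have := (hsweep l s₀ step ext next i _ hl hi hJ).1.1
    rw [List.length_append] at this
    simp only [length_sweepRun]
    omega
  · dsimp only
    omega

end SweepProg

end LogspaceRelations

namespace LogspaceRelations

/-! ### Binary counters in the columns of the work tape -/

/-- The counters: the number of states, the previous state, the current state, the number of
letters that have been written, and a counter for reading. -/
inductive Register
  | states
  | prev
  | cur
  | steps
  | tmp
  deriving DecidableEq

instance : Fintype Register := ⟨{.states, .prev, .cur, .steps, .tmp}, fun r => by cases r <;> simp⟩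

/-- The values of the counters. -/
def regs (n p r e t : ℕ) : Register → ℕ
  | .states => n
  | .prev => p
  | .cur => r
  | .steps => e
  | .tmp => t

@[simp] theorem update_regs_tmp (n p r e t t' : ℕ) :
    Function.update (regs n p r e t) .tmp t' = regs n p r e t' := by
  funext i; cases i <;> rfl

@[simp] theorem update_regs_cur (n p r e t r' : ℕ) :
    Function.update (regs n p r e t) .cur r' = regs n p r' e t := by
  funext i; cases i <;> rfl

@[simp] theorem update_regs_steps (n p r e t e' : ℕ) :
    Function.update (regs n p r e t) .steps e' = regs n p r e' t := by
  funext i; cases i <;> rfl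

/-- The binary digits of the counters, the lowest first. -/
def columns : ℕ → (Register → ℕ) → List (Register → Bool)
  | 0, _ => []
  | u + 1, v => (fun r => decide (v r % 2 = 1)) :: columns u (fun r => v r / 2)

@[simp] theorem length_columns (u : ℕ) (v : Register → ℕ) : (columns u v).length = u := by
  induction u generalizing v with
  | zero => rfl
  | succ u ih => simp [columns, ih]

/-- The states of the sweeps: the result of a comparison, or a carry, and two further tests. -/
abbrev SweepState := Ordering × Bool × Bool

/-- One digit of the addition of `1`. -/
def incStep (r : Register) (s : SweepState) (c : Register → Bool) :
    SweepState × (Register → Bool) :=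
  ((s.1, s.2.1 && c r, s.2.2), Function.update c r (xor (c r) s.2.1))

/-- Induction on the number of digits with all counters halved; the carry out of the lowest digit is
the carry into the halves. The bound excludes a carry at the end. -/
theorem sweepRun_incStep {r : Register} {u : ℕ} {v : Register → ℕ} {o : Ordering} {b b' : Bool}
    (h : v r + b.toNat < 2 ^ u) : sweepRun (incStep r) (o, b, b') (columns u v) =
      ((o, false, b'), columns u (Function.update v r (v r + b.toNat))) := by
  induction u generalizing v b with
  | zero => cases b <;> simp [columns, sweepRun] at h ⊢
  | succ u ih =>
    have h1 : v r / 2 + (b && decide (v r % 2 = 1)).toNat = (v r + b.toNat) / 2 := by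
      rcases Nat.mod_two_eq_zero_or_one (v r) with h2 | h2 <;> cases b <;> simp [h2] <;> omega
    have h2 := ih (v := fun r => v r / 2) (b := b && decide (v r % 2 = 1)) (by
      rw [h1]; rw [pow_succ] at h; omega)
    simp only [columns, sweepRun, incStep, h2, Prod.mk.injEq, List.cons.injEq, true_and]
    constructor
    · funext i
      by_cases hi : i = r
      · subst hi
        rw [Function.update_self, Function.update_self]
        rcases Nat.mod_two_eq_zero_or_one (v i) with h3 | h3 <;> cases b <;>
          simp [h3, Nat.add_mod]
      · simp [hi]
    · congr 1
      funext i
      by_cases hi : i = r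
      · subst hi; simp [h1]
      · simp [hi]

/-- All digits are `1`, so each becomes `0` and the carry survives. The surviving carry either
triggers a new column or ends the run. -/
theorem sweepRun_incStep_overflow {r : Register} {u : ℕ} {v : Register → ℕ} {o : Ordering}
    {b' : Bool} (h : v r + 1 = 2 ^ u) : sweepRun (incStep r) (o, true, b') (columns u v) =
      ((o, true, b'), columns u (Function.update v r 0)) := by
  induction u generalizing v with
  | zero => simp [columns, sweepRun]
  | succ u ih =>
    have h0 : v r % 2 = 1 := by rw [pow_succ] at h; omega
    have h2 := ih (v := fun r => v r / 2) (by rw [pow_succ] at h; omega)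
    simp only [columns, sweepRun, incStep, h0, decide_true, Bool.and_self, h2, Prod.mk.injEq,
      List.cons.injEq, true_and]
    constructor
    · funext i
      by_cases hi : i = r
      · subst hi; simp
      · simp [hi]
    · congr 1
      funext i
      by_cases hi : i = r
      · subst hi; simp
      · simp [hi]

/-- Describes the tape after an overflow: zeros everywhere below the appended top digit. -/
theorem columns_pow {v : Register → ℕ} (u : ℕ) (hv : ∀ r, v r = 0 ∨ v r = 2 ^ u) :
    columns (u + 1) v = columns u (fun _ => 0) ++ [fun r => decide (v r ≠ 0)] := by
  induction u generalizing v with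
  | zero =>
    simp only [columns, List.nil_append, List.cons.injEq, and_true]
    funext r
    rcases hv r with h | h <;> simp [h]
  | succ u ih =>
    rw [columns, ih (v := fun r => v r / 2)]
    · simp only [columns, List.cons_append, List.cons.injEq]
      refine ⟨?_, ?_⟩
      · funext r
        rcases hv r with h | h
        · simp [h]
        · simp only [h, pow_succ]; simp
      · simp only [List.append_cancel_left_eq, List.cons.injEq, and_true]
        funext r
        rcases hv r with h | h
        · simp [h]
        · simp only [h, pow_succ]; simp
    · intro r
      rcases hv r with h | h
      · left; simp [h]
      · right; simp [h, pow_succ]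

/-- One digit of the comparison of the reading counter with `q`, and with the previous and the
current state. Moreover each counter receives the value that `f` prescribes. -/
def cmpStep (q : Register) (f : Register → Option Register) (s : SweepState)
    (c : Register → Bool) : SweepState × (Register → Bool) :=
  ((if c .tmp = c q then s.1 else if c .tmp = true then .gt else .lt,
    s.2.1 && (c .tmp == c .prev), s.2.2 && (c .tmp == c .cur)),
    fun r => ((f r).map c).getD false)

/-- The lowest digit is read first but only breaks ties between the halves; `o`, the verdict of
still lower digits, breaks the ties that are left. -/
theorem compare_half (a b : ℕ) (o : Ordering) : (compare (a / 2) (b / 2)).then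
    (if decide (a % 2 = 1) = decide (b % 2 = 1) then o
      else if decide (a % 2 = 1) = true then .gt else .lt) = (compare a b).then o := by
  rcases lt_trichotomy (a / 2) (b / 2) with h | h | h
  · rw [compare_lt_iff_lt.2 h, compare_lt_iff_lt.2 (by omega : a < b)]; rfl
  · rw [compare_eq_iff_eq.2 h]
    rcases Nat.mod_two_eq_zero_or_one a with h1 | h1 <;>
      rcases Nat.mod_two_eq_zero_or_one b with h2 | h2
    · obtain rfl : a = b := by omega
      simp
    · rw [compare_lt_iff_lt.2 (by omega : a < b)]; simp [h1, h2]
    · rw [compare_gt_iff_gt.2 (by omega : b < a)]; simp [h1, h2]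
    · obtain rfl : a = b := by omega
      simp
  · rw [compare_gt_iff_gt.2 h, compare_gt_iff_gt.2 (by omega : b < a)]; rfl

theorem eq_half (a b : ℕ) (c : Bool) :
    ((c && (decide (a % 2 = 1) == decide (b % 2 = 1))) && decide (a / 2 = b / 2)) =
      (c && decide (a = b)) := by
  by_cases h : a = b
  · subst h; simp
  · have h' : ¬ (a % 2 = b % 2 ∧ a / 2 = b / 2) := by omega
    rcases Nat.mod_two_eq_zero_or_one a with h1 | h1 <;>
      rcases Nat.mod_two_eq_zero_or_one b with h2 | h2 <;> cases c <;> simp_all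

/-- Each higher digit overrides the verdict so far. The assignments of `f` act on whole tracks,
hence digit by digit in the same sweep, and the comparisons use the old values. -/
theorem sweepRun_cmpStep {q : Register} {f : Register → Option Register} {u : ℕ}
    {v : Register → ℕ} {o : Ordering} {b b' : Bool} (h : ∀ r, v r < 2 ^ u) :
    sweepRun (cmpStep q f) (o, b, b') (columns u v) =
      (((compare (v .tmp) (v q)).then o, b && decide (v .tmp = v .prev),
        b' && decide (v .tmp = v .cur)), columns u fun r => ((f r).map v).getD 0) := by
  induction u generalizing v o b b' with
  | zero =>
    have h0 : ∀ r, v r = 0 := fun r => by simpa using h r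
    simp [columns, sweepRun, h0]
  | succ u ih =>
    have h1 := ih (v := fun r => v r / 2)
      (o := if decide (v .tmp % 2 = 1) = decide (v q % 2 = 1) then o
        else if decide (v .tmp % 2 = 1) = true then .gt else .lt)
      (b := b && (decide (v .tmp % 2 = 1) == decide (v .prev % 2 = 1)))
      (b' := b' && (decide (v .tmp % 2 = 1) == decide (v .cur % 2 = 1)))
      (fun r => by have := h r; rw [pow_succ] at this; omega)
    simp only [columns, sweepRun, cmpStep, h1, compare_half, eq_half, Prod.mk.injEq,
      List.cons.injEq, true_and]
    constructor
    · funext r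
      rcases Option.eq_none_or_eq_some (f r) with h2 | ⟨r', h2⟩ <;> simp [h2]
    · congr 1
      funext r
      rcases Option.eq_none_or_eq_some (f r) with h2 | ⟨r', h2⟩ <;> simp [h2]

end LogspaceRelations

namespace LogspaceRelations

/-! ### A program for the membership problem -/

/-- The lists of an instance. -/
inductive Sec
  | trans
  | starts
  | finals

/-- The occurrences of numbers in the lists of an instance. -/
inductive Slot
  | source
  | target
  | start
  | final

/-- Places in the program. -/
inductive Place
  | init
  | initInc
  | initEnd
  | rewind
  | guess
  | guessInc
  | header
  | headerInc
  | headerEnd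
  | list (s : Sec)
  | number (s : Slot)
  | numberInc (s : Slot)
  | numberEnd (s : Slot)
  | letter
  | tail
  | tailInc
  | check
  | advance
  | advanceInc
  | emit
  | accept

instance : Finite Sec := Finite.of_injective
  (fun s : Sec => match s with | .trans => (0 : Fin 3) | .starts => 1 | .finals => 2)
  (by rintro (_ | _) (_ | _) <;> simp)

instance : Finite Slot := Finite.of_injective
  (fun s : Slot => match s with | .source => (0 : Fin 4) | .target => 1 | .start => 2 | .final => 3)
  (by rintro (_ | _) (_ | _) <;> simp)

instance : Finite Place := Finite.of_injective
  (fun p : Place => match p with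
    | .init => (Sum.inl 0 : Fin 17 ⊕ Fin 4 × (Sec ⊕ Slot ⊕ Unit))
    | .initInc => .inl 1
    | .initEnd => .inl 2
    | .rewind => .inl 3
    | .guess => .inl 4
    | .guessInc => .inl 5
    | .header => .inl 6
    | .headerInc => .inl 7
    | .headerEnd => .inl 8
    | .letter => .inl 9
    | .tail => .inl 10
    | .tailInc => .inl 11
    | .check => .inl 12
    | .advance => .inl 13
    | .advanceInc => .inl 14
    | .emit => .inl 15
    | .accept => .inl 16
    | .list s => .inr (0, .inl s)
    | .number s => .inr (1, .inr (.inl s))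
    | .numberInc s => .inr (2, .inr (.inl s))
    | .numberEnd s => .inr (3, .inr (.inl s)))
  (by rintro (_ | _) (_ | _) <;> simp)

noncomputable instance : Fintype Place := Fintype.ofFinite _

/-- The labels: a place, the letter of the transition that is checked (none for the choice of the
initial state), whether the transition or initial state has been found, whether the current state
has been found among the final states, and whether the source and the letter of the present
transition are right. -/
abbrev Label (α : Type) := Place × Option α × Bool × Bool × Bool

section Program

variable {α : Type} [Fintype α] (zero one : α)

/-- Increase a counter; the carry has to vanish. -/
def incInstr (r : Register) (l : Label α) : SweepInstr α (Label α) (Register → Bool) SweepState :=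
  .sweep (.eq, true, true) (incStep r) (fun _ => none) fun s => if s.2.1 = true then none else some l

open Classical in
/-- Read a number in unary. -/
noncomputable def readInstr (l l' : Label α) :
    SweepInstr α (Label α) (Register → Bool) SweepState :=
  .branch fun s => match s with
    | .letter a =>
      if a = one then [(l, .right, none)] else if a = zero then [(l', .right, none)] else []
    | _ => []

/-- Clear the reading counter. -/
def clearTmp : Register → Option Register
  | .tmp => none
  | r => some r

/-- Move the reading counter to the number of states. -/
def setStates : Register → Option Register
  | .tmp => none
  | .states => some .tmp
  | r => some r

/-- Make the current state the previous one. -/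
def shiftState : Register → Option Register
  | .tmp => none
  | .cur => none
  | .prev => some .cur
  | r => some r

open Classical in
/-- Where to go on after a number. The two tests compare it with the previous and with the current
state. -/
noncomputable def afterNumber (s : Slot) (m : Option α) (f g o b b' : Bool) : Label α :=
  match s with
  | .source => (.letter, m, f, g, b)
  | .target => (.list .trans, m, f || (o && b'), g, false)
  | .start => (.list .starts, m, f || (decide (m = none) && b'), g, false)
  | .final => (.list .finals, m, f, g || b', false)

/-- The first number of an entry. -/
def Sec.slot : Sec → Slot
  | .trans => .source
  | .starts => .start
  | .finals => .final

/-- The place after a list. -/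
def Sec.next : Sec → Place
  | .trans => .list .starts
  | .starts => .list .finals
  | .finals => .tail

theorem Sec.next_ne_init (s : Sec) : s.next ≠ .init := by cases s <;> simp [Sec.next]

theorem Sec.next_ne_initInc (s : Sec) : s.next ≠ .initInc := by cases s <;> simp [Sec.next]

open Classical in
/-- The instructions. -/
noncomputable def memInstr : Label α → SweepInstr α (Label α) (Register → Bool) SweepState
  | (.init, m, f, g, o) => .branch fun s => match s with
    | .letter _ => [((.initInc, m, f, g, o), .right, none)]
    | .rightEnd => [((.initEnd, m, f, g, o), .stay, none)]
    | .leftEnd => []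
  | (.initInc, m, f, g, o) => .sweep (.eq, true, true) (incStep .tmp)
      (fun s => if s.2.1 = true then some (fun r => decide (r = .tmp)) else none)
      fun _ => some (.init, m, f, g, o)
  | (.initEnd, m, f, g, o) => .sweep (.eq, true, true) (cmpStep .states clearTmp) (fun _ => none)
      fun _ => some (.rewind, m, f, g, o)
  | (.rewind, m, f, g, o) => .branch fun s => match s with
    | .leftEnd => [((.guess, m, f, g, o), .right, none)]
    | _ => [((.rewind, m, f, g, o), .left, none)]
  | (.guess, m, f, g, o) => .branch fun _ =>
      [((.header, m, f, g, o), .stay, none), ((.guessInc, m, f, g, o), .stay, none)]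
  | (.guessInc, m, f, g, o) => incInstr .cur (.guess, m, f, g, o)
  | (.header, m, f, g, o) => readInstr zero one (.headerInc, m, f, g, o) (.headerEnd, m, f, g, o)
  | (.headerInc, m, f, g, o) => incInstr .tmp (.header, m, f, g, o)
  | (.headerEnd, m, f, g, o) => .sweep (.eq, true, true) (cmpStep .states setStates) (fun _ => none)
      fun _ => some (.list .trans, m, f, g, o)
  | (.list s, m, f, g, o) => readInstr zero one (.number s.slot, m, f, g, o) (s.next, m, f, g, o)
  | (.number s, m, f, g, o) =>
      readInstr zero one (.numberInc s, m, f, g, o) (.numberEnd s, m, f, g, o)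
  | (.numberInc s, m, f, g, o) => incInstr .tmp (.number s, m, f, g, o)
  | (.numberEnd s, m, f, g, o) => .sweep (.eq, true, true) (cmpStep .states clearTmp)
      (fun _ => none) fun s' => if s'.1 = .lt then
        some (afterNumber s m f g o s'.2.1 s'.2.2) else none
  | (.letter, m, f, g, o) => .branch fun s => match s with
    | .letter a => [((.number .target, m, f, g, o && decide (m = some a)), .right, none)]
    | _ => []
  | (.tail, m, f, g, o) => .branch fun s => match s with
    | .letter a => if a = zero then [((.tailInc, m, f, g, o), .right, none)] else []
    | .rightEnd => if f = true then [((.check, m, f, g, o), .stay, none)] else []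
    | .leftEnd => []
  | (.tailInc, m, f, g, o) => incInstr .tmp (.tail, m, f, g, o)
  | (.check, m, f, g, o) => .sweep (.eq, true, true) (cmpStep .steps some) (fun _ => none)
      fun s => match s.1 with
        | .lt => none
        | .eq => if g = true then some (.accept, none, false, false, false) else none
        | .gt => some (.advance, m, f, g, o)
  | (.advance, m, f, g, o) => .sweep (.eq, true, true) (cmpStep .steps shiftState) (fun _ => none)
      fun _ => some (.advanceInc, m, f, g, o)
  | (.advanceInc, m, f, g, o) => incInstr .steps (.emit, m, f, g, o)
  | (.emit, _, _, _, _) => .branch fun _ => Finset.univ.toList.map fun a =>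
      ((.rewind, some a, false, false, false), .stay, some a)
  | (.accept, _, _, _, _) => .branch fun _ => []

/-- The program. -/
noncomputable def memProg : SweepProg α (Label α) (Register → Bool) SweepState where
  start := (.init, none, false, false, false)
  accept := (.accept, none, false, false, false)
  instr := memInstr zero one

/-- One step of counting; a new digit is appended if necessary. -/
theorem sweep_count (t : ℕ) :
    (sweepRun (incStep .tmp) (.eq, true, true) (columns (Nat.size t) (regs 0 0 0 0 t))).2 ++
      (if (sweepRun (incStep .tmp) (.eq, true, true)
        (columns (Nat.size t) (regs 0 0 0 0 t))).1.2.1 = true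
        then some (fun r => decide (r = Register.tmp)) else none).toList =
      columns (Nat.size (t + 1)) (regs 0 0 0 0 (t + 1)) := by
  by_cases h : t + 1 < 2 ^ Nat.size t
  · have hs : Nat.size (t + 1) = Nat.size t :=
      le_antisymm (Nat.size_le.2 h) (Nat.size_le_size (Nat.le_succ t))
    rw [sweepRun_incStep (by simpa [regs] using h), hs]
    simp [regs]
  · have h1 : t + 1 = 2 ^ Nat.size t := by have := Nat.lt_size_self t; omega
    have hs : Nat.size (t + 1) = Nat.size t + 1 := by rw [h1, Nat.size_pow]
    rw [sweepRun_incStep_overflow (by simpa [regs] using h1), hs,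
      columns_pow _ (v := regs 0 0 0 0 (t + 1))]
    · have h2 : regs 0 0 0 0 0 = fun _ => 0 := by funext r; cases r <;> rfl
      simp only [if_pos, Option.toList_some, update_regs_tmp, h2]
      congr 2
      funext r
      cases r <;> simp [regs]
    · intro r; cases r <;> simp [regs, h1]

/-- The columns at the labels. -/
def MemInv (x : List α) (l : Label α) (i : ℕ) (cols : List (Register → Bool)) : Prop :=
  i ≤ x.length + 1 ∧
  match l.1 with
  | .init => ∃ t, i = t + 1 ∧ cols = columns (Nat.size t) (regs 0 0 0 0 t)
  | .initInc => ∃ t, i = t + 2 ∧ cols = columns (Nat.size t) (regs 0 0 0 0 t)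
  | _ => cols.length ≤ Nat.size x.length

theorem MemInv.length_le {x : List α} {l : Label α} {i : ℕ} {cols : List (Register → Bool)}
    (h : MemInv x l i cols) : cols.length ≤ Nat.size x.length := by
  obtain ⟨p, m, f, g, o⟩ := l
  obtain ⟨hi, h⟩ := h
  cases p
  case init =>
    obtain ⟨t, rfl, rfl⟩ := h
    rw [length_columns]; exact Nat.size_le_size (by omega)
  case initInc =>
    obtain ⟨t, rfl, rfl⟩ := h
    rw [length_columns]; exact Nat.size_le_size (by omega)
  all_goals exact h

theorem MemInv.of_length {x : List α} {l : Label α} {i : ℕ} {cols : List (Register → Bool)}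
    (h : cols.length ≤ Nat.size x.length) (h1 : l.1 ≠ .init) (h2 : l.1 ≠ .initInc)
    (hi : i ≤ x.length + 1) : MemInv x l i cols := by
  obtain ⟨p, m, f, g, o⟩ := l
  refine ⟨hi, ?_⟩
  cases p
  case init => exact absurd rfl h1
  case initInc => exact absurd rfl h2
  all_goals exact h

/-- Columns are created only during the initial count, where the invariant ties their number to the
head position. At all other places the bound on the number is merely carried along. -/
theorem memInv_branch {x : List α} {l : Label α} {next : InSym α → List (Label α × Dir × Option α)}
    {i : ℕ} {cols : List (Register → Bool)} (hl : memInstr zero one l = .branch next)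
    (hJ : MemInv x l i cols) {t : Label α × Dir × Option α} (ht : t ∈ next (readInput x i)) {i' : ℕ}
    (hi : t.2.1.move i = some i') (hi' : i' ≤ x.length + 1) : MemInv x t.1 i' cols := by
  have hlen := hJ.length_le
  obtain ⟨p, m, f, g, o⟩ := l
  cases p <;> simp only [memInstr, readInstr, incInstr, SweepInstr.branch.injEq, reduceCtorEq] at hl <;>
    subst hl
  case init =>
    obtain ⟨-, k, rfl, hk⟩ := hJ
    dsimp only at ht
    split at ht
    · obtain rfl := List.mem_singleton.1 ht
      obtain rfl : k + 1 + 1 = i' := Option.some.inj hi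
      exact ⟨hi', k, rfl, hk⟩
    · obtain rfl := List.mem_singleton.1 ht
      exact .of_length hlen (by simp) (by simp) hi'
    · simp at ht
  all_goals
    have key : t.1.1 ≠ .init ∧ t.1.1 ≠ .initInc := by
      cases h : readInput x i <;> simp only [h] at ht <;> (try split_ifs at ht) <;>
        simp only [List.mem_cons, List.not_mem_nil, or_false, List.mem_map] at ht <;>
        (first
          | (subst ht; simp [Sec.next_ne_init, Sec.next_ne_initInc])
          | (obtain rfl | rfl := ht <;> simp)
          | (obtain ⟨a, -, rfl⟩ := ht; simp))
    exact .of_length hlen key.1 key.2 hi'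

theorem memInv_sweep {x : List α} {l : Label α} {s₀ : SweepState}
    {step : SweepState → (Register → Bool) → SweepState × (Register → Bool)}
    {ext : SweepState → Option (Register → Bool)} {next : SweepState → Option (Label α)}
    {i : ℕ} {cols : List (Register → Bool)} (hl : memInstr zero one l = .sweep s₀ step ext next)
    (hi : i ≤ x.length + 1) (hJ : MemInv x l i cols) :
    (cols.length ≤ Nat.size x.length ∧
      ((sweepRun step s₀ cols).2 ++ (ext (sweepRun step s₀ cols).1).toList).length ≤
        Nat.size x.length) ∧
    ∀ l', next (sweepRun step s₀ cols).1 = some l' →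
      MemInv x l' i ((sweepRun step s₀ cols).2 ++ (ext (sweepRun step s₀ cols).1).toList) := by
  have hlen := hJ.length_le
  obtain ⟨p, m, f, g, o⟩ := l
  cases p <;> simp only [memInstr, readInstr, incInstr, SweepInstr.sweep.injEq, reduceCtorEq] at hl <;>
    obtain ⟨rfl, rfl, rfl, rfl⟩ := hl
  case initInc =>
    obtain ⟨-, k, rfl, rfl⟩ := hJ
    rw [sweep_count]
    refine ⟨⟨hlen, ?_⟩, fun l' hl' => ?_⟩
    · rw [length_columns]; exact Nat.size_le_size (by omega)
    · obtain rfl := Option.some.inj hl'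
      exact ⟨hi, k + 1, rfl, rfl⟩
  all_goals
    rw [Option.toList_none, List.append_nil, length_sweepRun]
    refine ⟨⟨hlen, hlen⟩, fun l' hl' => ?_⟩
    have key : l'.1 ≠ .init ∧ l'.1 ≠ .initInc := by
      generalize (sweepRun _ _ cols).1 = s at hl'
      dsimp only at hl'
      (try split at hl') <;> (try split_ifs at hl') <;>
        simp only [Option.some.injEq, reduceCtorEq] at hl' <;>
        (first
          | (subst hl'; simp; done)
          | (subst hl'; simp only [afterNumber]; split <;> simp))
    exact .of_length (by rwa [length_sweepRun]) key.1 key.2 hi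

theorem memProg_spaceBound (x : List α) :
    (memProg zero one).toTransducer.SpaceBound x (Nat.size x.length + 2) :=
  SweepProg.spaceBound (MemInv x) ⟨by omega, 0, rfl, by simp [columns]⟩
    (fun _ _ _ _ hl hJ _ ht _ hi hi' => memInv_branch zero one hl hJ ht hi hi')
    (fun _ _ _ _ _ _ _ hl hi hJ => memInv_sweep zero one hl hi hJ)

theorem memProg_isNL : (memProg zero one).toTransducer.IsNL := by
  refine ⟨fun n => Nat.size n + 2, ?_, fun x => memProg_spaceBound zero one x⟩
  -- Since `log 2 > 1/2`, `Nat.size n - 1 ≤ 2 * log n`; for `n ≥ 2` also `1 ≤ 2 * log n`. Thus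
  -- `Nat.size n + 2`, which is three more than `Nat.size n - 1`, is at most `8 * log n`.
  refine Asymptotics.IsBigO.of_bound 8 ?_
  filter_upwards [eventually_ge_atTop 2] with n hn
  have h1 : (2 : ℝ) ^ (Nat.size n - 1) ≤ n := by
    have : 2 ^ (Nat.size n - 1) ≤ n := Nat.lt_size.1 (by
      have : 0 < Nat.size n := Nat.size_pos.2 (by omega)
      omega)
    exact_mod_cast this
  have h2 := Real.log_le_log (by positivity) h1
  have h3 : 2 ≤ Nat.size n := Nat.lt_size.2 (by simpa using hn)
  rw [Real.log_pow, Nat.cast_sub (by omega)] at h2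
  have h4 : (1 / 2 : ℝ) < Real.log 2 := by linarith [Real.log_two_gt_d9]
  have h5 : (2 : ℝ) ≤ Nat.size n := by exact_mod_cast h3
  rw [Real.norm_of_nonneg (Real.log_natCast_nonneg n), Real.norm_of_nonneg (by positivity)]
  push_cast at h2 ⊢
  have h6 : ((Nat.size n : ℝ) - 1) * (1 / 2) ≤ (Nat.size n - 1) * Real.log 2 :=
    mul_le_mul_of_nonneg_left h4.le (by linarith)
  linarith

end Program

end LogspaceRelations

namespace LogspaceRelations

/-! ### Parsing the encoding by the program -/

section ReadInput

variable {α : Type}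

theorem readInput_append_cons (pre s : List α) (a : α) :
    readInput (pre ++ a :: s) (pre.length + 1) = .letter a := by
  simp [readInput]

theorem readInput_end (x : List α) : readInput x (x.length + 1) = .rightEnd := by
  simp [readInput]

end ReadInput

section Parsing

variable {α : Type} [Fintype α] (zero one : α) (x : List α)

/-- The configuration at a label, with the given values of the counters. -/
noncomputable def memCfg (l : Label α) (i : ℕ) (v : Register → ℕ) (out : List α) :
    (memProg zero one).toTransducer.Cfg :=
  (memProg zero one).cfg l i (columns (Nat.size x.length) v) out

/-- The accepting runs from `c` are those from `d` with a fixed beginning. -/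
abbrev MDet (c d : (memProg zero one).toTransducer.Cfg) : Prop :=
  (memProg zero one).toTransducer.Det x c d

/-- An accepting run from `c` yields `y`. -/
abbrev MAcc (c : (memProg zero one).toTransducer.Cfg) (y : List α) : Prop :=
  (memProg zero one).toTransducer.Acc x c y

/-- No accepting run starts from `c`. -/
abbrev MDead (c : (memProg zero one).toTransducer.Cfg) : Prop :=
  (memProg zero one).toTransducer.Dead x c

variable {zero one x} {out y : List α} {v : Register → ℕ} {i : ℕ}

theorem MDet.acc {c d : (memProg zero one).toTransducer.Cfg} (h : MDet zero one x c d)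
    (hc : MAcc zero one x c y) : MAcc zero one x d y := (h y).1.1 hc

theorem det_inc {r : Register} {l l' : Label α} (hl : memInstr zero one l = incInstr r l')
    (hi : i ≤ x.length + 1) (hv : v r + 1 < 2 ^ Nat.size x.length) :
    MDet zero one x (memCfg zero one x l i v out)
      (memCfg zero one x l' i (Function.update v r (v r + 1)) out) := by
  have h := SweepProg.det_sweep (p := memProg zero one) (out := out) hl hi
    (sweepRun_incStep (b := true) (b' := true) (o := .eq) hv) (l' := l') (by simp)
  simpa [MDet, memCfg] using h

theorem dead_inc {r : Register} {l l' : Label α} (hl : memInstr zero one l = incInstr r l')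
    (hi : i ≤ x.length + 1) (hv : v r + 1 = 2 ^ Nat.size x.length) :
    MDead zero one x (memCfg zero one x l i v out) :=
  SweepProg.dead_sweep (p := memProg zero one) (out := out) hl hi
    (sweepRun_incStep_overflow (b' := true) (o := .eq) hv) (by simp)

section Compare

variable {q : Register} {f : Register → Option Register} {l l' : Label α}
  {next : SweepState → Option (Label α)}
  (hl : memInstr zero one l = .sweep (.eq, true, true) (cmpStep q f) (fun _ => none) next)
  (hi : i ≤ x.length + 1) (hv : ∀ r, v r < 2 ^ Nat.size x.length)
include hl hi hv

theorem det_cmp (hn : next (compare (v .tmp) (v q), decide (v .tmp = v .prev),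
      decide (v .tmp = v .cur)) = some l') :
    MDet zero one x (memCfg zero one x l i v out)
      (memCfg zero one x l' i (fun r => ((f r).map v).getD 0) out) := by
  have h := SweepProg.det_sweep (p := memProg zero one) (out := out) hl hi
    (sweepRun_cmpStep (b := true) (b' := true) (o := .eq) hv) (l' := l') (by simpa using hn)
  simpa [MDet, memCfg] using h

theorem dead_cmp (hn : next (compare (v .tmp) (v q), decide (v .tmp = v .prev),
      decide (v .tmp = v .cur)) = none) : MDead zero one x (memCfg zero one x l i v out) :=
  SweepProg.dead_sweep (p := memProg zero one) (out := out) hl hi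
    (sweepRun_cmpStep (b := true) (b' := true) (o := .eq) hv) (by simpa using hn)

end Compare

section Branch

variable {l l' : Label α} {next : InSym α → List (Label α × Dir × Option α)}
  (hl : memInstr zero one l = .branch next)
include hl

theorem det_read {pre s : List α} {a : α} (hx : x = pre ++ a :: s)
    (hn : next (.letter a) = [(l', .right, none)]) :
    MDet zero one x (memCfg zero one x l (pre.length + 1) v out)
      (memCfg zero one x l' ((pre ++ [a]).length + 1) v out) := by
  have h := SweepProg.det_branch (p := memProg zero one) (x := x) (i := pre.length + 1)
    (i' := (pre ++ [a]).length + 1) (dir := .right) (e := none) (l' := l') (out := out)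
    (cols := columns (Nat.size x.length) v) hl
    (by rw [hx, readInput_append_cons, hn]) (by simp [Dir.move]) (by simp [hx])
  simpa [MDet, memCfg] using h

theorem dead_read {pre s : List α} {a : α} (hx : x = pre ++ a :: s)
    (hn : next (.letter a) = []) (hl' : l ≠ (memProg zero one).accept) :
    MDead zero one x (memCfg zero one x l (pre.length + 1) v out) :=
  SweepProg.dead_branch hl (by rw [hx, readInput_append_cons, hn]) hl'

theorem dead_read_end (hn : next .rightEnd = []) (hl' : l ≠ (memProg zero one).accept) :
    MDead zero one x (memCfg zero one x l (x.length + 1) v out) :=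
  SweepProg.dead_branch hl (by rw [readInput_end, hn]) hl'

end Branch

omit [Fintype α] in
theorem length_lt_pow (x : List α) : x.length < 2 ^ Nat.size x.length := Nat.lt_size_self _

/-- Read copies of a letter and count them. -/
theorem det_count {l l₁ : Label α} {next : InSym α → List (Label α × Dir × Option α)} {c : α}
    (hl : memInstr zero one l = .branch next) (hn : next (.letter c) = [(l₁, .right, none)])
    (hl₁ : memInstr zero one l₁ = incInstr .tmp l) {m : ℕ} {n p r e t : ℕ} {pre s : List α}
    (hx : x = pre ++ (List.replicate m c ++ s)) (ht : t ≤ pre.length) :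
    MDet zero one x (memCfg zero one x l (pre.length + 1) (regs n p r e t) out)
      (memCfg zero one x l ((pre ++ List.replicate m c).length + 1) (regs n p r e (t + m)) out) := by
  induction m generalizing pre t with
  | zero => simpa using Transducer.Det.refl _
  | succ m ih =>
    have hlen := length_lt_pow x
    have hx' : x = pre ++ c :: (List.replicate m c ++ s) := by rw [hx]; rfl
    refine (det_read hl hx' hn).trans ((det_inc hl₁ (by rw [hx']; simp) ?_).trans ?_)
    -- The counter never exceeds the number of letters already read, which is less than `|x|` here,
    -- so the increment does not overflow.
    · simp only [regs]
      rw [hx'] at hlen ⊢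
      simp only [List.length_append, List.length_cons] at hlen ⊢
      omega
    · have h := ih (pre := pre ++ [c]) (t := t + 1) (by rw [hx']; simp) (by simp; omega)
      have e : pre ++ [c] ++ List.replicate m c = pre ++ List.replicate (m + 1) c := by
        rw [List.replicate_succ]; simp
      rw [e] at h
      simpa [regs, Nat.add_assoc, Nat.add_comm 1 m] using h

/-- A label where a number is read. -/
structure Reads (zero one : α) (l l₂ : Label α) : Prop where
  ne : l ≠ (memProg zero one).accept
  exists_inc : ∃ l₁, memInstr zero one l = readInstr zero one l₁ l₂ ∧
    memInstr zero one l₁ = incInstr .tmp l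

theorem Reads.det (h01 : zero ≠ one) {l l₂ : Label α} (h : Reads zero one l l₂) {n p r e m : ℕ}
    {pre s : List α} (hx : x = pre ++ (encodeNat zero one m ++ s)) :
    MDet zero one x (memCfg zero one x l (pre.length + 1) (regs n p r e 0) out)
      (memCfg zero one x l₂ ((pre ++ encodeNat zero one m).length + 1) (regs n p r e m) out) := by
  obtain ⟨l₁, hl, hl₁⟩ := h.exists_inc
  have hx' : x = pre ++ (List.replicate m one ++ (zero :: s)) := by rw [hx]; simp [encodeNat]
  refine (det_count hl (c := one) (by simp) hl₁ hx' (Nat.zero_le _)).trans ?_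
  have h2 := det_read (x := x) (l' := l₂) (v := regs n p r e (0 + m)) (out := out) hl
    (pre := pre ++ List.replicate m one) (a := zero) (s := s)
    (by rw [hx']; simp) (by simp [h01])
  simpa [encodeNat, Nat.add_assoc] using h2

/-- Any letter other than `0` and `1`, and the right end marker, halt the machine at a label that is
not accepting. So an accepting run passes this place only over some `1^m 0`. -/
theorem Reads.exists_eq {l l₂ : Label α} (h : Reads zero one l l₂) {n p r e t : ℕ}
    {pre s : List α} (hx : x = pre ++ s) (ht : t ≤ pre.length)
    (hy : MAcc zero one x (memCfg zero one x l (pre.length + 1) (regs n p r e t) out) y) :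
    ∃ m s', s = encodeNat zero one m ++ s' := by
  obtain ⟨l₁, hl, hl₁⟩ := h.exists_inc
  induction s generalizing pre t with
  | nil =>
    rw [List.append_nil] at hx
    rw [← hx] at hy
    exact absurd hy (dead_read_end hl rfl h.ne y)
  | cons a s ih =>
    by_cases h1 : a = one
    · subst h1
      have hd := det_count (x := x) (n := n) (p := p) (r := r) (e := e) (out := out) hl (c := a) (by simp)
        hl₁ (m := 1) (t := t) (pre := pre) (s := s) (by rw [hx]; simp) ht
      obtain ⟨m, s', rfl⟩ := ih (pre := pre ++ [a]) (t := t + 1) (by rw [hx]; simp)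
        (by simpa using ht) (hd.acc hy)
      exact ⟨m + 1, s', by simp [encodeNat, List.replicate_succ]⟩
    · by_cases h0 : a = zero
      · subst h0
        exact ⟨0, s, by simp [encodeNat]⟩
      · exact absurd hy (dead_read hl hx (by simp [h1, h0]) h.ne y)

section Lists

variable {β Φ : Type} {e : β → List α} {ok : β → Prop} {listL elemL nextL : Φ → Label α}
  {up : Φ → β → Φ} {v : Register → ℕ}
  (hl : ∀ φ, memInstr zero one (listL φ) = readInstr zero one (elemL φ) (nextL φ))
include hl

/-- The flags `φ` are updated entry by entry, so over the whole list they are folded. The three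
lists of an instance differ only in labels and updates. -/
theorem det_list (h01 : zero ≠ one)
    (hdet : ∀ φ b pre s, ok b → x = pre ++ (e b ++ s) →
      MDet zero one x (memCfg zero one x (elemL φ) (pre.length + 1) v out)
        (memCfg zero one x (listL (up φ b)) ((pre ++ e b).length + 1) v out))
    {φ : Φ} {l : List β} {pre s : List α} (hok : ∀ b ∈ l, ok b)
    (hx : x = pre ++ (encodeList zero one e l ++ s)) :
    MDet zero one x (memCfg zero one x (listL φ) (pre.length + 1) v out)
      (memCfg zero one x (nextL (l.foldl up φ))
        ((pre ++ encodeList zero one e l).length + 1) v out) := by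
  induction l generalizing φ pre with
  | nil => exact det_read (hl φ) (s := s) (by rw [hx]; simp [encodeList]) (by simp [h01])
  | cons b l ih =>
    have h1 : x = pre ++ one :: (e b ++ (encodeList zero one e l ++ s)) := by
      rw [hx]; simp [encodeList]
    have h2 : x = (pre ++ [one]) ++ (e b ++ (encodeList zero one e l ++ s)) := by
      rw [h1]; simp
    have h3 : x = (pre ++ [one] ++ e b) ++ (encodeList zero one e l ++ s) := by
      rw [h1]; simp
    refine (det_read (l' := elemL φ) (hl φ) h1 (by simp)).trans
      ((hdet φ b _ _ (hok b (by simp)) h2).trans ?_)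
    have h4 := ih (φ := up φ b) (fun b hb => hok b (by simp [hb])) h3
    have h5 : pre ++ [one] ++ e b ++ encodeList zero one e l = pre ++ encodeList zero one e (b :: l) := by
      simp [encodeList]
    rwa [h5] at h4

/-- Converse of `det_list`: each round consumes at least the leading `1`, so strong induction on the
remaining input reconstructs the list, with `hacc` reconstructing one entry. -/
theorem exists_eq_encodeList (hne : ∀ φ, listL φ ≠ (memProg zero one).accept)
    (hacc : ∀ φ pre s, x = pre ++ s →
      MAcc zero one x (memCfg zero one x (elemL φ) (pre.length + 1) v out) y →
      ∃ b s', s = e b ++ s' ∧ ok b ∧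
        MAcc zero one x (memCfg zero one x (listL (up φ b)) ((pre ++ e b).length + 1) v out) y)
    {φ : Φ} {pre s : List α} (hx : x = pre ++ s)
    (hy : MAcc zero one x (memCfg zero one x (listL φ) (pre.length + 1) v out) y) :
    ∃ l s', s = encodeList zero one e l ++ s' ∧ ∀ b ∈ l, ok b := by
  induction hn : s.length using Nat.strong_induction_on generalizing φ pre s with
  | _ k ih =>
    cases s with
    | nil =>
      rw [List.append_nil] at hx
      rw [← hx] at hy
      exact absurd hy (dead_read_end (hl φ) rfl (hne φ) y)
    | cons a s =>
      by_cases h1 : a = one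
      · subst h1
        have hd := det_read (l' := elemL φ) (v := v) (out := out) (hl φ) hx (by simp)
        obtain ⟨b, s', rfl, hb, hy'⟩ := hacc φ (pre ++ [a]) s (by rw [hx]; simp) (hd.acc hy)
        obtain ⟨l, s'', rfl, hl'⟩ := ih s'.length (by rw [← hn]; simp) (by rw [hx]; simp) hy'
          rfl
        exact ⟨b :: l, s'', by simp [encodeList], by simpa using ⟨hb, hl'⟩⟩
      · by_cases h0 : a = zero
        · subst h0
          exact ⟨[], s, by simp [encodeList], by simp⟩
        · exact absurd hy (dead_read (hl φ) hx (by simp [h1, h0]) (hne φ) y)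

end Lists

end Parsing

end LogspaceRelations

namespace LogspaceRelations

/-! ### One pass over the input -/

section Pass

variable {α : Type} [Fintype α] {zero one : α} {x : List α} {out y : List α} {n p r e : ℕ}
  {m : Option α} {pre s : List α}

/-- The values of the counters fit into the columns. -/
def Fits (x : List α) (n p r e : ℕ) : Prop :=
  n ≤ x.length ∧ p < 2 ^ Nat.size x.length ∧ r < 2 ^ Nat.size x.length ∧ e ≤ x.length

omit [Fintype α] in
theorem Fits.lt (h : Fits x n p r e) {t : ℕ} (ht : t ≤ x.length) (i : Register) :
    regs n p r e t i < 2 ^ Nat.size x.length := by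
  have hx := length_lt_pow x
  obtain ⟨h1, h2, h3, h4⟩ := h
  cases i <;> simp only [regs] <;> omega

omit [Fintype α] in
theorem le_length_of_encodeNat {k : ℕ} (hx : x = pre ++ (encodeNat zero one k ++ s)) :
    k ≤ x.length := by
  rw [hx]; simp [encodeNat]; omega

theorem reads_number (sl : Slot) (f g o : Bool) :
    Reads zero one (.number sl, m, f, g, o) (.numberEnd sl, m, f, g, o) :=
  ⟨by simp [memProg], _, rfl, rfl⟩

theorem reads_header (f g o : Bool) :
    Reads zero one (.header, m, f, g, o) (.headerEnd, m, f, g, o) :=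
  ⟨by simp [memProg], _, rfl, rfl⟩

theorem det_number (h01 : zero ≠ one) (hF : Fits x n p r e) {sl : Slot} {f g o : Bool} {k : ℕ}
    (hk : k < n) (hx : x = pre ++ (encodeNat zero one k ++ s)) :
    MDet zero one x (memCfg zero one x (.number sl, m, f, g, o) (pre.length + 1) (regs n p r e 0) out)
      (memCfg zero one x (afterNumber sl m f g o (decide (k = p)) (decide (k = r)))
        ((pre ++ encodeNat zero one k).length + 1) (regs n p r e 0) out) := by
  refine ((reads_number sl f g o).det h01 hx).trans ?_
  have h := det_cmp (zero := zero) (one := one) (x := x) (out := out) (v := regs n p r e k)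
    (i := (pre ++ encodeNat zero one k).length + 1)
    (l := (.numberEnd sl, m, f, g, o)) rfl (by rw [hx]; simp) (hF.lt (le_length_of_encodeNat hx))
    (l' := afterNumber sl m f g o (decide (k = p)) (decide (k = r)))
    (by simp [regs, compare_lt_iff_lt.2 hk]; rfl)
  have h2 : (fun i => ((clearTmp i).map (regs n p r e k)).getD 0) = regs n p r e 0 := by
    funext i; cases i <;> rfl
  rwa [h2] at h

/-- A number `k ≥ n` fails the comparison with the number of states after it has been read. Thus
accepting runs occur only if every listed number is a state. -/
theorem exists_eq_number (h01 : zero ≠ one) (hF : Fits x n p r e) {sl : Slot} {f g o : Bool}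
    (hx : x = pre ++ s) (hy : MAcc zero one x
      (memCfg zero one x (.number sl, m, f, g, o) (pre.length + 1) (regs n p r e 0) out) y) :
    ∃ k s', s = encodeNat zero one k ++ s' ∧ k < n ∧
      MAcc zero one x (memCfg zero one x (afterNumber sl m f g o (decide (k = p)) (decide (k = r)))
        ((pre ++ encodeNat zero one k).length + 1) (regs n p r e 0) out) y := by
  obtain ⟨k, s', rfl⟩ := (reads_number sl f g o).exists_eq hx (Nat.zero_le _) hy
  have hk : k < n := by
    by_contra hk
    refine ((reads_number sl f g o).det h01 hx).dead (dead_cmp (v := regs n p r e k)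
      (l := (.numberEnd sl, m, f, g, o)) rfl (by rw [hx]; simp)
      (hF.lt (le_length_of_encodeNat hx)) ?_) y hy
    have : compare k n ≠ .lt := by rwa [Ne, compare_lt_iff_lt]
    simp [regs, this]
  exact ⟨k, s', rfl, hk, (det_number h01 hF hk hx).acc hy⟩

/-- The label at the beginning of an entry of a list. -/
def listLabel (sec : Sec) (m : Option α) (φ : Bool × Bool) : Label α :=
  (.list sec, m, φ.1, φ.2, false)

open Classical in
/-- The flags after a transition. -/
noncomputable def upTrans (m : Option α) (p r : ℕ) (φ : Bool × Bool) (t : ℕ × α × ℕ) : Bool × Bool :=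
  (φ.1 || (decide (t.1 = p) && decide (m = some t.2.1) && decide (t.2.2 = r)), φ.2)

open Classical in
/-- The flags after an initial state. -/
noncomputable def upStart (m : Option α) (r : ℕ) (φ : Bool × Bool) (q : ℕ) : Bool × Bool :=
  (φ.1 || (decide (m = none) && decide (q = r)), φ.2)

/-- The flags after a final state. -/
def upFinal (r : ℕ) (φ : Bool × Bool) (q : ℕ) : Bool × Bool := (φ.1, φ.2 || decide (q = r))

theorem det_trans (h01 : zero ≠ one) (hF : Fits x n p r e) (φ : Bool × Bool) (t : ℕ × α × ℕ)
    (pre s : List α) (ht : t.1 < n ∧ t.2.2 < n)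
    (hx : x = pre ++ (encodeTrans zero one t ++ s)) :
    MDet zero one x (memCfg zero one x (.number .source, m, φ.1, φ.2, false) (pre.length + 1)
        (regs n p r e 0) out)
      (memCfg zero one x (listLabel .trans m (upTrans m p r φ t))
        ((pre ++ encodeTrans zero one t).length + 1) (regs n p r e 0) out) := by
  classical
  obtain ⟨k, a, k'⟩ := t
  have h1 : x = pre ++ (encodeNat zero one k ++ (a :: (encodeNat zero one k' ++ s))) := by
    rw [hx]; simp [encodeTrans]
  have h2 : x = (pre ++ encodeNat zero one k) ++ a :: (encodeNat zero one k' ++ s) := by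
    rw [h1]; simp
  have h3 : x = (pre ++ encodeNat zero one k ++ [a]) ++ (encodeNat zero one k' ++ s) := by
    rw [h1]; simp
  refine (det_number h01 hF ht.1 h1).trans ?_
  refine (det_read (l := (.letter, m, φ.1, φ.2, decide (k = p)))
    (l' := (.number .target, m, φ.1, φ.2, decide (k = p) && decide (m = some a))) rfl h2
    rfl).trans ?_
  have h4 := det_number (m := m) (out := out) (sl := .target) (f := φ.1) (g := φ.2)
    (o := decide (k = p) && decide (m = some a)) h01 hF ht.2 h3
  have h5 : pre ++ encodeNat zero one k ++ [a] ++ encodeNat zero one k' =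
      pre ++ encodeTrans zero one (k, a, k') := by simp [encodeTrans]
  rw [h5] at h4
  exact h4

theorem exists_eq_trans (h01 : zero ≠ one) (hF : Fits x n p r e) (φ : Bool × Bool)
    (pre s : List α) (hx : x = pre ++ s) (hy : MAcc zero one x
      (memCfg zero one x (.number .source, m, φ.1, φ.2, false) (pre.length + 1)
        (regs n p r e 0) out) y) :
    ∃ (t : ℕ × α × ℕ) (s' : List α), s = encodeTrans zero one t ++ s' ∧ (t.1 < n ∧ t.2.2 < n) ∧
      MAcc zero one x (memCfg zero one x (listLabel .trans m (upTrans m p r φ t))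
        ((pre ++ encodeTrans zero one t).length + 1) (regs n p r e 0) out) y := by
  classical
  obtain ⟨k, s₁, rfl, hk, hy₁⟩ := exists_eq_number h01 hF hx hy
  have h2 : x = (pre ++ encodeNat zero one k) ++ s₁ := by rw [hx]; simp
  cases s₁ with
  | nil =>
    rw [List.append_nil] at h2
    rw [← h2] at hy₁
    exact absurd hy₁ (dead_read_end (l := (.letter, m, φ.1, φ.2, decide (k = p))) rfl rfl
      (by simp [memProg]) y)
  | cons a s₁ =>
    have h3 := (det_read (l := (.letter, m, φ.1, φ.2, decide (k = p)))
      (l' := (.number .target, m, φ.1, φ.2, decide (k = p) && decide (m = some a))) rfl h2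
      rfl).acc hy₁
    obtain ⟨k', s', rfl, hk', -⟩ := exists_eq_number (s := s₁) h01 hF (by rw [h2]; simp) h3
    have hx' : x = pre ++ (encodeTrans zero one (k, a, k') ++ s') := by
      rw [hx]; simp [encodeTrans]
    exact ⟨(k, a, k'), s', by simp [encodeTrans], ⟨hk, hk'⟩,
      (det_trans h01 hF φ (k, a, k') pre s' ⟨hk, hk'⟩ hx').acc hy⟩

theorem foldl_upTrans (φ : Bool × Bool) (l : List (ℕ × α × ℕ)) :
    (l.foldl (upTrans m p r) φ).2 = φ.2 ∧ ((l.foldl (upTrans m p r) φ).1 = true ↔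
      φ.1 = true ∨ ∃ a, m = some a ∧ (p, a, r) ∈ l) := by
  induction l generalizing φ with
  | nil => simp
  | cons t l ih =>
    obtain ⟨h1, h2⟩ := ih (upTrans m p r φ t)
    refine ⟨by rw [List.foldl_cons, h1]; rfl, ?_⟩
    rw [List.foldl_cons, h2]
    obtain ⟨k, a, k'⟩ := t
    simp only [upTrans, Bool.or_eq_true, Bool.and_eq_true, decide_eq_true_eq, List.mem_cons,
      Prod.mk.injEq, or_assoc]
    refine or_congr Iff.rfl ?_
    constructor
    · rintro (⟨⟨rfl, h⟩, rfl⟩ | ⟨b, h, h'⟩)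
      · exact ⟨a, h, .inl ⟨rfl, rfl, rfl⟩⟩
      · exact ⟨b, h, .inr h'⟩
    · rintro ⟨b, h, ⟨rfl, rfl, rfl⟩ | h'⟩
      · exact .inl ⟨⟨rfl, h⟩, rfl⟩
      · exact .inr ⟨b, h, h'⟩

theorem foldl_upStart (φ : Bool × Bool) (l : List ℕ) :
    (l.foldl (upStart m r) φ).2 = φ.2 ∧ ((l.foldl (upStart m r) φ).1 = true ↔
      φ.1 = true ∨ m = none ∧ r ∈ l) := by
  induction l generalizing φ with
  | nil => simp
  | cons t l ih =>
    obtain ⟨h1, h2⟩ := ih (upStart m r φ t)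
    refine ⟨by rw [List.foldl_cons, h1]; rfl, ?_⟩
    rw [List.foldl_cons, h2]
    simp only [upStart, Bool.or_eq_true, Bool.and_eq_true, decide_eq_true_eq, List.mem_cons,
      eq_comm (a := t)]
    tauto

theorem foldl_upFinal (φ : Bool × Bool) (l : List ℕ) :
    (l.foldl (upFinal r) φ).1 = φ.1 ∧ ((l.foldl (upFinal r) φ).2 = true ↔
      φ.2 = true ∨ r ∈ l) := by
  induction l generalizing φ with
  | nil => simp
  | cons t l ih =>
    obtain ⟨h1, h2⟩ := ih (upFinal r φ t)
    refine ⟨by rw [List.foldl_cons, h1]; rfl, ?_⟩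
    rw [List.foldl_cons, h2]
    simp only [upFinal, Bool.or_eq_true, decide_eq_true_eq, List.mem_cons,
      eq_comm (a := t)]
    tauto

open Classical in
/-- The flags after the three lists. -/
noncomputable def flags (m : Option α) (p r : ℕ) (tr : List (ℕ × α × ℕ)) (st fi : List ℕ) :
    Bool × Bool :=
  fi.foldl (upFinal r) (st.foldl (upStart m r) (tr.foldl (upTrans m p r) (false, false)))

/-- The current state is allowed. -/
def StateOk (m : Option α) (p r : ℕ) (tr : List (ℕ × α × ℕ)) (st : List ℕ) : Prop :=
  match m with
  | none => r ∈ st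
  | some a => (p, a, r) ∈ tr

/-- The flag is a disjunction over all entries and the list is always read to its end. Hence
repeated entries of a list do not produce additional runs. -/
theorem flags_fst (tr : List (ℕ × α × ℕ)) (st fi : List ℕ) :
    (flags m p r tr st fi).1 = true ↔ StateOk m p r tr st := by
  rw [flags, (foldl_upFinal _ _).1, (foldl_upStart _ _).2, (foldl_upTrans _ _).2]
  cases m <;> simp [StateOk]

theorem flags_snd (tr : List (ℕ × α × ℕ)) (st fi : List ℕ) :
    (flags m p r tr st fi).2 = true ↔ r ∈ fi := by
  rw [flags, (foldl_upFinal _ _).2, (foldl_upStart _ _).1, (foldl_upTrans _ _).1]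
  simp

/-- An instance with numbers as states. -/
def RawOk (n : ℕ) (tr : List (ℕ × α × ℕ)) (st fi : List ℕ) : Prop :=
  (∀ t ∈ tr, t.1 < n ∧ t.2.2 < n) ∧ (∀ q ∈ st, q < n) ∧ ∀ q ∈ fi, q < n

/-- The value `n₀` is what the counter held before the pass, `0` in the first one; it is overwritten
by the number just read. -/
theorem det_header (h01 : zero ≠ one) {n₀ : ℕ} {l : Label α} (hl : l = (.header, m, false, false, false))
    (hF : Fits x n₀ p r e) (hx : x = encodeNat zero one n ++ s) :
    MDet zero one x (memCfg zero one x l 1 (regs n₀ p r e 0) out)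
      (memCfg zero one x (listLabel .trans m (false, false))
        ((encodeNat zero one n).length + 1) (regs n p r e 0) out) := by
  subst hl
  have hx' : x = [] ++ (encodeNat zero one n ++ s) := by rw [hx]; simp
  refine ((reads_header false false false).det (pre := []) h01 hx').trans ?_
  have h := det_cmp (zero := zero) (one := one) (x := x) (out := out) (v := regs n₀ p r e n)
    (i := ([] ++ encodeNat zero one n).length + 1)
    (l := (.headerEnd, m, false, false, false)) rfl (by rw [hx]; simp)
    (hF.lt (le_length_of_encodeNat hx')) (l' := listLabel .trans m (false, false)) rfl
  have h2 : (fun i => ((setStates i).map (regs n₀ p r e n)).getD 0) = regs n p r e 0 := by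
    funext i; cases i <;> rfl
  rwa [h2] at h

theorem det_lists (h01 : zero ≠ one) (hF : Fits x n p r e) {tr : List (ℕ × α × ℕ)} {st fi : List ℕ}
    (hok : RawOk n tr st fi)
    (hx : x = pre ++ (encodeList zero one (encodeTrans zero one) tr ++
      (encodeList zero one (encodeNat zero one) st ++
        (encodeList zero one (encodeNat zero one) fi ++ s)))) :
    MDet zero one x (memCfg zero one x (listLabel .trans m (false, false)) (pre.length + 1)
        (regs n p r e 0) out)
      (memCfg zero one x (.tail, m, (flags m p r tr st fi).1, (flags m p r tr st fi).2, false)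
        ((pre ++ encodeList zero one (encodeTrans zero one) tr ++
          encodeList zero one (encodeNat zero one) st ++
          encodeList zero one (encodeNat zero one) fi).length + 1) (regs n p r e 0) out) := by
  refine (det_list (listL := listLabel .trans m) (nextL := listLabel .starts m)
    (fun φ => rfl) h01 (det_trans h01 hF) hok.1 hx).trans ?_
  refine (det_list (listL := listLabel .starts m) (nextL := listLabel .finals m)
    (up := upStart m r) (ok := fun k => k < n)
    (elemL := fun φ => (.number .start, m, φ.1, φ.2, false)) (fun φ => rfl) h01
    (fun φ b pre s hb hx => det_number h01 hF hb hx) hok.2.1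
    (s := encodeList zero one (encodeNat zero one) fi ++ s) (by rw [hx]; simp)).trans ?_
  exact det_list (listL := listLabel .finals m) (nextL := fun φ => (.tail, m, φ.1, φ.2, false))
    (up := upFinal r) (ok := fun k => k < n)
    (elemL := fun φ => (.number .final, m, φ.1, φ.2, false)) (fun φ => rfl) h01
    (fun φ b pre s hb hx => det_number h01 hF hb hx) hok.2.2 (s := s) (by rw [hx]; simp)

theorem exists_eq_lists (h01 : zero ≠ one) (hF : Fits x n p r e) (hx : x = pre ++ s)
    (hy : MAcc zero one x (memCfg zero one x (listLabel .trans m (false, false)) (pre.length + 1)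
        (regs n p r e 0) out) y) :
    ∃ tr st fi s', s = encodeList zero one (encodeTrans zero one) tr ++
      (encodeList zero one (encodeNat zero one) st ++
        (encodeList zero one (encodeNat zero one) fi ++ s')) ∧ RawOk n tr st fi := by
  obtain ⟨tr, s₁, rfl, htr⟩ := exists_eq_encodeList (listL := listLabel .trans m)
    (nextL := listLabel .starts m) (fun φ => rfl) (by simp [listLabel, memProg])
    (exists_eq_trans h01 hF) hx hy
  have hy₁ := (det_list (listL := listLabel .trans m) (nextL := listLabel .starts m)
    (fun φ => rfl) h01 (det_trans h01 hF) htr hx).acc hy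
  have hx₁ : x = pre ++ encodeList zero one (encodeTrans zero one) tr ++ s₁ := by rw [hx]; simp
  obtain ⟨st, s₂, rfl, hst⟩ := exists_eq_encodeList (listL := listLabel .starts m)
    (nextL := listLabel .finals m) (up := upStart m r) (ok := fun k => k < n)
    (elemL := fun φ => (.number .start, m, φ.1, φ.2, false)) (fun φ => rfl)
    (by simp [listLabel, memProg]) (fun φ pre s hx hy => exists_eq_number h01 hF hx hy) hx₁ hy₁
  have hy₂ := (det_list (listL := listLabel .starts m) (nextL := listLabel .finals m)
    (up := upStart m r) (ok := fun k => k < n)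
    (elemL := fun φ => (.number .start, m, φ.1, φ.2, false)) (fun φ => rfl) h01
    (fun φ b pre s hb hx => det_number h01 hF hb hx) hst hx₁).acc hy₁
  obtain ⟨fi, s₃, rfl, hfi⟩ := exists_eq_encodeList (listL := listLabel .finals m)
    (nextL := fun φ => (.tail, m, φ.1, φ.2, false)) (up := upFinal r) (ok := fun k => k < n)
    (elemL := fun φ => (.number .final, m, φ.1, φ.2, false)) (fun φ => rfl)
    (by simp [listLabel, memProg]) (fun φ pre s hx hy => exists_eq_number h01 hF hx hy)
    (s := s₂) (by rw [hx₁]; simp) hy₂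
  exact ⟨tr, st, fi, s₃, rfl, htr, hst, hfi⟩

theorem det_tail {f g : Bool} {k : ℕ} (hx : x = pre ++ List.replicate k zero) (hf : f = true) :
    MDet zero one x (memCfg zero one x (.tail, m, f, g, false) (pre.length + 1)
        (regs n p r e 0) out)
      (memCfg zero one x (.check, m, f, g, false) (x.length + 1) (regs n p r e k) out) := by
  have h := det_count (zero := zero) (one := one) (out := out) (l := (.tail, m, f, g, false)) (c := zero)
    (l₁ := (.tailInc, m, f, g, false))
    (n := n) (p := p) (r := r) (e := e) (t := 0) rfl (by simp) rfl (s := []) (by simpa using hx)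
    (Nat.zero_le _)
  rw [← hx, Nat.zero_add] at h
  refine h.trans ?_
  have h2 := SweepProg.det_branch (p := memProg zero one) (x := x) (i := x.length + 1)
    (i' := x.length + 1) (dir := .stay) (e := none) (l' := (.check, m, f, g, false)) (out := out)
    (l := (.tail, m, f, g, false)) (cols := columns (Nat.size x.length) (regs n p r e k)) rfl
    (by rw [readInput_end]; simp [hf]) rfl le_rfl
  rwa [Option.toList_none, List.append_nil] at h2

theorem dead_tail {g : Bool} {k : ℕ} (hx : x = pre ++ List.replicate k zero) :
    MDead zero one x (memCfg zero one x (.tail, m, false, g, false) (pre.length + 1)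
        (regs n p r e 0) out) := by
  have h := det_count (zero := zero) (one := one) (out := out) (l := (.tail, m, false, g, false)) (c := zero)
    (l₁ := (.tailInc, m, false, g, false))
    (n := n) (p := p) (r := r) (e := e) (t := 0) rfl (by simp) rfl (s := []) (by simpa using hx)
    (Nat.zero_le _)
  rw [← hx, Nat.zero_add] at h
  exact h.dead (dead_read_end rfl (by simp) (by simp [memProg]))

theorem exists_eq_tail {f g : Bool} {t : ℕ} (hx : x = pre ++ s) (ht : t ≤ pre.length)
    (hy : MAcc zero one x (memCfg zero one x (.tail, m, f, g, false) (pre.length + 1)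
        (regs n p r e t) out) y) : ∃ k, s = List.replicate k zero := by
  induction s generalizing pre t with
  | nil => exact ⟨0, rfl⟩
  | cons a s ih =>
    by_cases h0 : a = zero
    · subst h0
      have hd := det_count (x := x) (zero := a) (one := one) (out := out) (l := (.tail, m, f, g, false)) (c := a)
        (l₁ := (.tailInc, m, f, g, false))
        (n := n) (p := p) (r := r) (e := e) (t := t) rfl (by simp) rfl (m := 1) (s := s)
        (pre := pre) (by rw [hx]; simp) ht
      obtain ⟨k, rfl⟩ := ih (pre := pre ++ [a]) (t := t + 1) (by rw [hx]; simp)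
        (by simpa using ht) (hd.acc hy)
      exact ⟨k + 1, rfl⟩
    · exact absurd hy (dead_read (l := (.tail, m, f, g, false)) rfl hx (by simp [h0])
        (by simp [memProg]) y)

/-- Reading an instance and checking the current state. -/
theorem det_pass (h01 : zero ≠ one) {n₀ k : ℕ} {tr : List (ℕ × α × ℕ)} {st fi : List ℕ}
    (hF : Fits x n₀ p r e) (hok : RawOk n tr st fi) (hx : x = encodeRaw zero one n tr st fi k)
    (hs : StateOk m p r tr st) :
    MDet zero one x (memCfg zero one x (.header, m, false, false, false) 1 (regs n₀ p r e 0) out)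
      (memCfg zero one x (.check, m, true, (flags m p r tr st fi).2, false) (x.length + 1)
        (regs n p r e k) out) := by
  have hn : n ≤ x.length := le_length_of_encodeNat (pre := []) hx
  have hF' : Fits x n p r e := ⟨hn, hF.2⟩
  refine (det_header h01 rfl hF hx).trans ((det_lists h01 hF' hok hx).trans ?_)
  rw [(flags_fst tr st fi).2 hs]
  exact det_tail (by rw [hx]; simp [encodeRaw]) rfl

theorem dead_pass (h01 : zero ≠ one) {n₀ k : ℕ} {tr : List (ℕ × α × ℕ)} {st fi : List ℕ}
    (hF : Fits x n₀ p r e) (hok : RawOk n tr st fi) (hx : x = encodeRaw zero one n tr st fi k)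
    (hs : ¬ StateOk m p r tr st) :
    MDead zero one x (memCfg zero one x (.header, m, false, false, false) 1 (regs n₀ p r e 0) out) := by
  have hn : n ≤ x.length := le_length_of_encodeNat (pre := []) hx
  have hF' : Fits x n p r e := ⟨hn, hF.2⟩
  refine ((det_header h01 rfl hF hx).trans (det_lists h01 hF' hok hx)).dead ?_
  rw [Bool.eq_false_iff.2 fun h => hs ((flags_fst tr st fi).1 h)]
  exact dead_tail (k := k) (by rw [hx]; simp [encodeRaw])

/-- A single pass already parses the whole input. Each part is recovered from the existence of an
accepting run, and the determinism of that part hands the run on to the next one. -/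
theorem exists_eq_encodeRaw (h01 : zero ≠ one) {n₀ : ℕ} (hF : Fits x n₀ p r e)
    (hy : MAcc zero one x
      (memCfg zero one x (.header, m, false, false, false) 1 (regs n₀ p r e 0) out) y) :
    ∃ n tr st fi k, x = encodeRaw zero one n tr st fi k ∧ RawOk n tr st fi := by
  obtain ⟨n, s, hx⟩ := (reads_header false false false).exists_eq (pre := []) (x := x) rfl
    (Nat.zero_le _) hy
  have hn : n ≤ x.length := le_length_of_encodeNat (pre := []) hx
  have hF' : Fits x n p r e := ⟨hn, hF.2⟩
  have hy₁ := (det_header h01 rfl hF hx).acc hy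
  obtain ⟨tr, st, fi, s', rfl, hok⟩ := exists_eq_lists h01 hF' hx hy₁
  have hy₂ := (det_lists h01 hF' hok hx).acc hy₁
  obtain ⟨k, rfl⟩ := exists_eq_tail (s := s') (by rw [hx]; simp) (Nat.zero_le _) hy₂
  exact ⟨n, tr, st, fi, k, hx, hok⟩

end Pass

end LogspaceRelations

namespace LogspaceRelations

/-! ### Accepting runs of the program and runs of the automaton -/

section Main

variable {α : Type} [Fintype α] {zero one : α} {x : List α} {out y : List α} {n p r e k : ℕ}
  {m : Option α} {tr : List (ℕ × α × ℕ)} {st fi : List ℕ}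

/-- At most one accepting run from `c` yields `y`. -/
abbrev MAtMostOne (zero one : α) (x : List α) (c : (memProg zero one).toTransducer.Cfg)
    (y : List α) : Prop :=
  (memProg zero one).toTransducer.AtMostOne x c y

/-- The configuration at a place where the flags are not in use. -/
noncomputable abbrev plainCfg (zero one : α) (x : List α) (pl : Place) (m : Option α) (i : ℕ)
    (v : Register → ℕ) (out : List α) : (memProg zero one).toTransducer.Cfg :=
  memCfg zero one x (pl, m, false, false, false) i v out

theorem det_rewind {v : Register → ℕ} {i : ℕ} (hi : i ≤ x.length + 1) :
    MDet zero one x (plainCfg zero one x .rewind m i v out) (plainCfg zero one x .guess m 1 v out) := by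
  induction i with
  | zero =>
    have h := SweepProg.det_branch (p := memProg zero one) (x := x) (i := 0) (i' := 1)
      (dir := .right) (e := none) (l' := (.guess, m, false, false, false)) (out := out)
      (l := (.rewind, m, false, false, false)) (cols := columns (Nat.size x.length) v) rfl rfl rfl
      (by omega)
    rwa [Option.toList_none, List.append_nil] at h
  | succ i ih =>
    have h := SweepProg.det_branch (p := memProg zero one) (x := x) (i := i + 1) (i' := i)
      (dir := .left) (e := none) (l' := (.rewind, m, false, false, false)) (out := out)
      (l := (.rewind, m, false, false, false)) (cols := columns (Nat.size x.length) v) rfl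
      (by
        have : readInput x (i + 1) ≠ .leftEnd := by simp only [readInput]; split <;> simp
        cases h : readInput x (i + 1) <;> simp_all) rfl (by omega)
    rw [Option.toList_none, List.append_nil] at h
    exact Transducer.Det.trans h (ih (by omega))

theorem step_guess (d : (memProg zero one).toTransducer.Cfg) {v : Register → ℕ} :
    (memProg zero one).toTransducer.Step x (plainCfg zero one x .guess m 1 v out) d ↔
      d = plainCfg zero one x .header m 1 v out ∨ d = plainCfg zero one x .guessInc m 1 v out := by
  have h := SweepProg.step_branch (p := memProg zero one) (x := x) (i := 1) (out := out)
    (l := (.guess, m, false, false, false)) (cols := columns (Nat.size x.length) v) rfl d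
  refine h.trans ?_
  simp [Dir.move, memCfg]

/-- The machine either settles on the present value or increases it, and an increase of the largest
value is fatal. So every `r ≥ a` within range is reached by exactly one sequence of choices.
Induction on the distance to the largest value. -/
theorem guess_spec {a : ℕ} (ha : a < 2 ^ Nat.size x.length) :
    (MAcc zero one x (plainCfg zero one x .guess m 1 (regs n p a e 0) out) y ↔
      ∃ r, a ≤ r ∧ r < 2 ^ Nat.size x.length ∧
        MAcc zero one x (plainCfg zero one x .header m 1 (regs n p r e 0) out) y) ∧
    ((∀ r < 2 ^ Nat.size x.length,
        MAtMostOne zero one x (plainCfg zero one x .header m 1 (regs n p r e 0) out) y) →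
      (∀ r r', r < 2 ^ Nat.size x.length → r' < 2 ^ Nat.size x.length →
        MAcc zero one x (plainCfg zero one x .header m 1 (regs n p r e 0) out) y →
        MAcc zero one x (plainCfg zero one x .header m 1 (regs n p r' e 0) out) y → r = r') →
      MAtMostOne zero one x (plainCfg zero one x .guess m 1 (regs n p a e 0) out) y) := by
  induction hd : 2 ^ Nat.size x.length - (a + 1) generalizing a with
  | zero =>
    have hdead : MDead zero one x (plainCfg zero one x .guessInc m 1 (regs n p a e 0) out) :=
      dead_inc (r := .cur) rfl (by omega) (by simp only [regs]; omega)
    constructor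
    · rw [MAcc, Transducer.acc_iff_of_step ((step_guess _).2 (.inl rfl))]
      simp only [step_guess]
      constructor
      · rintro ⟨d, rfl | rfl, h⟩
        · exact ⟨a, le_rfl, ha, h⟩
        · exact absurd h (hdead y)
      · rintro ⟨r, h1, h2, h⟩
        obtain rfl : r = a := by omega
        exact ⟨_, .inl rfl, h⟩
    · intro h1 h2
      refine Transducer.atMostOne_of_steps (fun d hd => ?_) fun d d' hd hd' hy hy' => ?_
      · rcases (step_guess _).1 hd with rfl | rfl
        · exact h1 a ha
        · exact Transducer.atMostOne_of_not_acc (hdead y)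
      · rcases (step_guess _).1 hd with rfl | rfl
        · rcases (step_guess _).1 hd' with rfl | rfl
          · rfl
          · exact absurd hy' (hdead y)
        · exact absurd hy (hdead y)
  | succ d ih =>
    have hdet : MDet zero one x (plainCfg zero one x .guessInc m 1 (regs n p a e 0) out)
        (plainCfg zero one x .guess m 1 (regs n p (a + 1) e 0) out) := by
      have h := det_inc (x := x) (v := regs n p a e 0) (out := out) (i := 1) (zero := zero) (one := one)
        (l := (.guessInc, m, false, false, false)) (r := .cur) rfl (by omega)
        (by simp only [regs]; omega)
      rwa [update_regs_cur] at h
    obtain ⟨ih1, ih2⟩ := ih (a := a + 1) (by omega) (by omega)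
    constructor
    · rw [MAcc, Transducer.acc_iff_of_step ((step_guess _).2 (.inl rfl))]
      simp only [step_guess]
      constructor
      · rintro ⟨d, rfl | rfl, h⟩
        · exact ⟨a, le_rfl, ha, h⟩
        · obtain ⟨r, h1, h2, h3⟩ := ih1.1 (hdet.acc h)
          exact ⟨r, by omega, h2, h3⟩
      · rintro ⟨r, h1, h2, h⟩
        rcases h1.eq_or_lt with rfl | h1
        · exact ⟨_, .inl rfl, h⟩
        · exact ⟨_, .inr rfl, (hdet y).1.2 (ih1.2 ⟨r, h1, h2, h⟩)⟩
    · intro h1 h2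
      -- The first step is determined by the value finally guessed: stop if it is `a`, increase
      -- otherwise. Uniqueness of that value therefore gives uniqueness of the step.
      have hcl : ∀ d, (memProg zero one).toTransducer.Step x
          (plainCfg zero one x .guess m 1 (regs n p a e 0) out) d → MAcc zero one x d y →
          ∃ r, r < 2 ^ Nat.size x.length ∧
            MAcc zero one x (plainCfg zero one x .header m 1 (regs n p r e 0) out) y ∧
            d = if r = a then plainCfg zero one x .header m 1 (regs n p a e 0) out else
              plainCfg zero one x .guessInc m 1 (regs n p a e 0) out := by
        intro d hd hy
        rcases (step_guess _).1 hd with rfl | rfl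
        · exact ⟨a, ha, hy, by simp⟩
        · obtain ⟨r, h3, h4, h5⟩ := ih1.1 (hdet.acc hy)
          exact ⟨r, h4, h5, by rw [if_neg (by omega)]⟩
      refine Transducer.atMostOne_of_steps (fun d hd => ?_) fun d d' hd hd' hy hy' => ?_
      · rcases (step_guess _).1 hd with rfl | rfl
        · exact h1 a ha
        · exact (hdet y).2 (ih2 h1 h2)
      · obtain ⟨r, h3, h4, rfl⟩ := hcl d hd hy
        obtain ⟨r', h3', h4', rfl⟩ := hcl d' hd' hy'
        rw [h2 r r' h3 h3' h4 h4']

theorem det_check (hF : Fits x n p r e) (hk : k ≤ x.length) (hek : e < k) {f g : Bool} :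
    MDet zero one x (memCfg zero one x (.check, m, f, g, false) (x.length + 1) (regs n p r e k) out)
      (memCfg zero one x (.emit, m, f, g, false) (x.length + 1) (regs n r 0 (e + 1) 0) out) := by
  have hx := length_lt_pow x
  have h1 := det_cmp (x := x) (zero := zero) (one := one) (out := out) (v := regs n p r e k)
    (i := x.length + 1) (l := (.check, m, f, g, false)) (l' := (.advance, m, f, g, false)) rfl le_rfl
    (hF.lt hk) (by simp [regs, compare_gt_iff_gt.2 hek])
  have h2 := det_cmp (x := x) (zero := zero) (one := one) (out := out) (v := regs n p r e k)
    (i := x.length + 1) (l := (.advance, m, f, g, false)) (l' := (.advanceInc, m, f, g, false)) rfl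
    le_rfl (hF.lt hk) rfl
  have h3 := det_inc (x := x) (zero := zero) (one := one) (v := regs n r 0 e 0) (out := out)
    (i := x.length + 1) (l := (.advanceInc, m, f, g, false)) (r := .steps)
    (l' := (.emit, m, f, g, false)) rfl le_rfl (by simp only [regs]; omega)
  have e1 : (fun i => ((some i).map (regs n p r e k)).getD 0) = regs n p r e k := by
    funext i; rfl
  have e2 : (fun i => ((shiftState i).map (regs n p r e k)).getD 0) = regs n r 0 e 0 := by
    funext i; cases i <;> rfl
  rw [e1] at h1
  rw [e2] at h2
  rw [update_regs_steps] at h3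
  exact h1.trans (h2.trans h3)

theorem det_check_accept (hF : Fits x n p r k) {f : Bool} :
    MDet zero one x (memCfg zero one x (.check, m, f, true, false) (x.length + 1)
      (regs n p r k k) out) (plainCfg zero one x .accept none (x.length + 1) (regs n p r k k) out) := by
  have h1 := det_cmp (x := x) (zero := zero) (one := one) (out := out) (v := regs n p r k k)
    (i := x.length + 1) (l := (.check, m, f, true, false)) (l' := (.accept, none, false, false, false))
    rfl le_rfl (hF.lt hF.2.2.2) (by simp [regs])
  have e1 : (fun i => ((some i).map (regs n p r k k)).getD 0) = regs n p r k k := by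
    funext i; rfl
  rwa [e1] at h1

theorem dead_check (hF : Fits x n p r k) {f : Bool} :
    MDead zero one x (memCfg zero one x (.check, m, f, false, false) (x.length + 1)
      (regs n p r k k) out) :=
  dead_cmp (v := regs n p r k k) (l := (.check, m, f, false, false)) rfl le_rfl (hF.lt hF.2.2.2)
    (by simp [regs])

theorem step_accept {i : ℕ} {v : Register → ℕ} (d : (memProg zero one).toTransducer.Cfg) :
    ¬ (memProg zero one).toTransducer.Step x (plainCfg zero one x .accept none i v out) d := by
  have h := SweepProg.step_branch (p := memProg zero one) (x := x) (i := i) (out := out)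
    (l := (.accept, none, false, false, false)) (cols := columns (Nat.size x.length) v) rfl d
  intro hd
  simpa using h.1 hd

theorem acc_accept {i : ℕ} {v : Register → ℕ} :
    MAcc zero one x (plainCfg zero one x .accept none i v out) y ↔ y = out := by
  rw [MAcc, Transducer.acc_iff]
  constructor
  · rintro (⟨-, -, h⟩ | ⟨d, h, -⟩)
    · exact h.symm
    · exact absurd h (step_accept d)
  · rintro rfl
    exact .inl ⟨step_accept, rfl, rfl⟩

theorem step_emit {i : ℕ} {v : Register → ℕ} {f g o : Bool} (hi : i ≤ x.length + 1)
    (d : (memProg zero one).toTransducer.Cfg) :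
    (memProg zero one).toTransducer.Step x (memCfg zero one x (.emit, m, f, g, o) i v out) d ↔
      ∃ a, d = plainCfg zero one x .rewind (some a) i v (out ++ [a]) := by
  have h := SweepProg.step_branch (p := memProg zero one) (x := x) (i := i) (out := out)
    (l := (.emit, m, f, g, o)) (cols := columns (Nat.size x.length) v) rfl d
  refine h.trans ?_
  simp [Dir.move, memCfg, hi]

section Instance

variable (h01 : zero ≠ one) (hok : RawOk n tr st fi) (hx : x = encodeRaw zero one n tr st fi k)
include h01 hok hx

omit [Fintype α] h01 hok in
theorem witness_le_length : k ≤ x.length := by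
  rw [hx]; simp [encodeRaw]; omega

omit h01 in
theorem StateOk.lt (h : StateOk m p r tr st) : r < 2 ^ Nat.size x.length := by
  have h1 : r < n := by
    cases m with
    | none => exact hok.2.1 r h
    | some a => exact (hok.1 _ h).2
  have h2 : n ≤ x.length := le_length_of_encodeNat (pre := []) hx
  exact h1.trans_le (h2.trans (length_lt_pow x).le)

/-- Induction on the number `j` of letters still to be written. A pass with a guessed `r` survives
only if `StateOk` holds; then the machine accepts a final `r` if `j = 0`, and otherwise writes a
letter and returns to the guess with `r` as previous state. -/
theorem acc_guess {j : ℕ} : ∀ {e n₀ p : ℕ} {m : Option α} {out : List α}, e + j = k →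
    n₀ ≤ x.length → p < 2 ^ Nat.size x.length →
    (MAcc zero one x (plainCfg zero one x .guess m 1 (regs n₀ p 0 e 0) out) y ↔
      ∃ w r qs, y = out ++ w ∧ w.length = j ∧ StateOk m p r tr st ∧ RawRun tr fi r w qs) := by
  have hk := witness_le_length hx
  have hn : n ≤ x.length := le_length_of_encodeNat (pre := []) hx
  induction j with
  | zero =>
    intro e n₀ p m out he hn₀ hp
    obtain rfl : e = k := he
    rw [(guess_spec (by positivity)).1]
    constructor
    · rintro ⟨r, -, hr, hy⟩
      have hF : Fits x n₀ p r e := ⟨hn₀, hp, hr, hk⟩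
      by_cases hs : StateOk m p r tr st
      · have hy := (det_pass h01 hF hok hx hs).acc hy
        cases hg : (flags m p r tr st fi).2 with
        | false =>
          rw [hg] at hy
          exact absurd hy (dead_check ⟨hn, hF.2⟩ y)
        | true =>
          rw [hg] at hy
          have hy := acc_accept.1 ((det_check_accept ⟨hn, hF.2⟩).acc hy)
          exact ⟨[], r, [], by simpa using hy, rfl, hs, (flags_snd tr st fi).1 hg⟩
      · exact absurd hy (dead_pass h01 hF hok hx hs y)
    · rintro ⟨w, r, qs, rfl, hw, hs, hrun⟩
      obtain rfl := List.length_eq_zero_iff.1 hw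
      have hr := hs.lt hok hx
      have hF : Fits x n₀ p r e := ⟨hn₀, hp, hr, hk⟩
      refine ⟨r, Nat.zero_le _, hr, (det_pass h01 hF hok hx hs _).1.2 ?_⟩
      cases qs with
      | cons => exact hrun.elim
      | nil =>
        rw [(flags_snd tr st fi).2 hrun]
        exact (det_check_accept ⟨hn, hF.2⟩ _).1.2 (acc_accept.2 (by simp))
  | succ j ih =>
    intro e n₀ p m out he hn₀ hp
    rw [(guess_spec (by positivity)).1]
    constructor
    · rintro ⟨r, -, hr, hy⟩
      have hF : Fits x n₀ p r e := ⟨hn₀, hp, hr, by omega⟩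
      by_cases hs : StateOk m p r tr st
      · have hy := (det_check ⟨hn, hF.2⟩ hk (by omega)).acc ((det_pass h01 hF hok hx hs).acc hy)
        -- The letter `zero` only witnesses that some step exists, so that the configuration does
        -- not halt.
        rw [MAcc, Transducer.acc_iff_of_step ((step_emit le_rfl _).2 ⟨zero, rfl⟩)] at hy
        obtain ⟨d, hd, hy⟩ := hy
        obtain ⟨a, rfl⟩ := (step_emit le_rfl _).1 hd
        obtain ⟨w, q, qs, rfl, hw, hs', hrun⟩ :=
          (ih (by omega) hn hr).1 ((det_rewind le_rfl).acc hy)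
        -- By definition `hs'` is the statement that `(r, a, q)` is a listed transition, the first
        -- one of the run.
        exact ⟨a :: w, r, q :: qs, by simp, by simp [hw], hs, hs', hrun⟩
      · exact absurd hy (dead_pass h01 hF hok hx hs y)
    · rintro ⟨w, r, qs, rfl, hw, hs, hrun⟩
      obtain ⟨a, w, rfl⟩ := List.exists_cons_of_length_eq_add_one hw
      cases qs with
      | nil => exact hrun.elim
      | cons q qs =>
        have hr := hs.lt hok hx
        have hF : Fits x n₀ p r e := ⟨hn₀, hp, hr, by omega⟩
        refine ⟨r, Nat.zero_le _, hr, ((det_pass h01 hF hok hx hs).trans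
          (det_check ⟨hn, hF.2⟩ hk (by omega)) _).1.2 ?_⟩
        rw [Transducer.acc_iff_of_step ((step_emit le_rfl _).2 ⟨zero, rfl⟩)]
        refine ⟨_, (step_emit le_rfl _).2 ⟨a, rfl⟩, (det_rewind le_rfl _).1.2
          ((ih (by omega) hn hr).2 ⟨w, q, qs, by simp, by simpa using hw, hrun.1, hrun.2⟩)⟩

/-- The only choices are states and letters. The letters can be read off from `y`, and two different
states that both lead to `y` would give two runs on the same word, against the uniqueness
hypothesis. That hypothesis is quantified over all words so that it passes to the next state. -/
theorem atMostOne_guess {j : ℕ} : ∀ {e n₀ p : ℕ} {m : Option α} {out : List α}, e + j = k →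
    n₀ ≤ x.length → p < 2 ^ Nat.size x.length →
    (∀ w r r' qs qs', StateOk m p r tr st → StateOk m p r' tr st →
      RawRun tr fi r w qs → RawRun tr fi r' w qs' → r = r' ∧ qs = qs') →
    MAtMostOne zero one x (plainCfg zero one x .guess m 1 (regs n₀ p 0 e 0) out) y := by
  have hk := witness_le_length hx
  have hn : n ≤ x.length := le_length_of_encodeNat (pre := []) hx
  induction j with
  | zero =>
    intro e n₀ p m out he hn₀ hp hu
    obtain rfl : e = k := he
    have hacc : ∀ r, r < 2 ^ Nat.size x.length →
        MAcc zero one x (plainCfg zero one x .header m 1 (regs n₀ p r e 0) out) y →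
        StateOk m p r tr st ∧ RawRun tr fi r [] [] := by
      intro r hr hy
      have hF : Fits x n₀ p r e := ⟨hn₀, hp, hr, hk⟩
      by_cases hs : StateOk m p r tr st
      · have hy := (det_pass h01 hF hok hx hs).acc hy
        cases hg : (flags m p r tr st fi).2 with
        | false =>
          rw [hg] at hy
          exact absurd hy (dead_check ⟨hn, hF.2⟩ y)
        | true => exact ⟨hs, (flags_snd tr st fi).1 hg⟩
      · exact absurd hy (dead_pass h01 hF hok hx hs y)
    refine (guess_spec (by positivity)).2 (fun r hr => ?_) fun r r' hr hr' hy hy' => ?_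
    · have hF : Fits x n₀ p r e := ⟨hn₀, hp, hr, hk⟩
      by_cases hy : MAcc zero one x (plainCfg zero one x .header m 1 (regs n₀ p r e 0) out) y
      · obtain ⟨hs, hrun⟩ := hacc r hr hy
        refine (det_pass h01 hF hok hx hs y).2 ?_
        rw [(flags_snd tr st fi).2 hrun]
        exact (det_check_accept ⟨hn, hF.2⟩ _).2 (Transducer.atMostOne_of_steps
          (fun d hd => absurd hd (step_accept d)) fun d _ hd => absurd hd (step_accept d))
      · exact Transducer.atMostOne_of_not_acc hy
    · exact (hu [] r r' [] [] (hacc r hr hy).1 (hacc r' hr' hy').1 (hacc r hr hy).2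
        (hacc r' hr' hy').2).1
  | succ j ih =>
    intro e n₀ p m out he hn₀ hp hu
    have hemit : ∀ r, r < 2 ^ Nat.size x.length → StateOk m p r tr st →
        MDet zero one x (plainCfg zero one x .header m 1 (regs n₀ p r e 0) out)
          (memCfg zero one x (.emit, m, true, (flags m p r tr st fi).2, false) (x.length + 1)
            (regs n r 0 (e + 1) 0) out) := fun r hr hs =>
      (det_pass h01 ⟨hn₀, hp, hr, by omega⟩ hok hx hs).trans
        (det_check ⟨hn, hp, hr, by omega⟩ hk (by omega))
    have hacc : ∀ r, r < 2 ^ Nat.size x.length →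
        MAcc zero one x (plainCfg zero one x .header m 1 (regs n₀ p r e 0) out) y →
        StateOk m p r tr st ∧ ∃ w qs, y = out ++ w ∧ RawRun tr fi r w qs := by
      intro r hr hy
      by_cases hs : StateOk m p r tr st
      · have hy := (hemit r hr hs).acc hy
        rw [MAcc, Transducer.acc_iff_of_step ((step_emit le_rfl _).2 ⟨zero, rfl⟩)] at hy
        obtain ⟨d, hd, hy⟩ := hy
        obtain ⟨a, rfl⟩ := (step_emit le_rfl _).1 hd
        obtain ⟨w, q, qs, rfl, hw, hs', hrun⟩ :=
          (acc_guess (j := j) h01 hok hx (by omega) hn hr).1 ((det_rewind le_rfl).acc hy)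
        exact ⟨hs, a :: w, q :: qs, by simp, hs', hrun⟩
      · exact absurd hy (dead_pass h01 ⟨hn₀, hp, hr, by omega⟩ hok hx hs y)
    refine (guess_spec (by positivity)).2 (fun r hr => ?_) fun r r' hr hr' hy hy' => ?_
    · by_cases hs : StateOk m p r tr st
      · refine (hemit r hr hs y).2 (Transducer.atMostOne_of_steps (fun d hd => ?_) ?_)
        · obtain ⟨a, rfl⟩ := (step_emit le_rfl _).1 hd
          refine (det_rewind le_rfl y).2 (ih (by omega) hn hr ?_)
          intro w q q' qs qs' h1 h2 h3 h4
          -- Two continuations after `a` become two runs from `r` by prepending the transition with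
          -- `a`.
          have := (hu (a :: w) r r (q :: qs) (q' :: qs') hs hs ⟨h1, h3⟩ ⟨h2, h4⟩).2
          simpa using this
        · intro d d' hd hd' hy hy'
          obtain ⟨a, rfl⟩ := (step_emit le_rfl _).1 hd
          obtain ⟨a', rfl⟩ := (step_emit le_rfl _).1 hd'
          obtain ⟨w, -, -, h1, -⟩ :=
            (acc_guess (j := j) h01 hok hx (by omega) hn hr).1 ((det_rewind le_rfl).acc hy)
          obtain ⟨w', -, -, h2, -⟩ :=
            (acc_guess (j := j) h01 hok hx (by omega) hn hr).1 ((det_rewind le_rfl).acc hy')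
          rw [h1] at h2
          -- Both letters stand in `y` directly after `out`.
          obtain rfl : a = a' := by simpa using congrArg List.head? (List.append_cancel_left
            ((List.append_assoc ..).symm.trans (h2.trans (List.append_assoc ..))))
          rfl
      · exact Transducer.atMostOne_of_not_acc
          (dead_pass h01 ⟨hn₀, hp, hr, by omega⟩ hok hx hs y)
    · obtain ⟨hs, w, qs, rfl, hrun⟩ := hacc r hr hy
      obtain ⟨hs', w', qs', hw', hrun'⟩ := hacc r' hr' hy'
      obtain rfl := List.append_cancel_left hw'
      exact (hu w r r' qs qs' hs hs' hrun hrun').1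

end Instance

/-- Counting the letters of the input. -/
theorem det_init : MDet zero one x (memProg zero one).toTransducer.initial
    (plainCfg zero one x .guess none 1 (regs 0 0 0 0 0) []) := by
  -- The tape widens with the count: after `t` letters there are as many columns as `t` has binary
  -- digits. At the end the width suffices for every number up to `|x|`, and then the counter is
  -- cleared.
  have key : ∀ t ≤ x.length, MDet zero one x (memProg zero one).toTransducer.initial
      ((memProg zero one).cfg (.init, none, false, false, false) (t + 1)
        (columns (Nat.size t) (regs 0 0 0 0 t)) []) := by
    intro t
    induction t with
    | zero =>
      intro _
      rw [SweepProg.initial_eq]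
      exact Transducer.Det.refl _
    | succ t ih =>
      intro ht
      refine (ih (by omega)).trans ?_
      have h1 := SweepProg.det_branch (p := memProg zero one) (x := x) (i := t + 1) (i' := t + 2)
        (dir := .right) (e := none) (l' := (.initInc, none, false, false, false)) (out := [])
        (l := (.init, none, false, false, false))
        (cols := columns (Nat.size t) (regs 0 0 0 0 t)) rfl
        (by simp [readInput, show t < x.length by omega]) rfl (by omega)
      have h2 := SweepProg.det_sweep (p := memProg zero one) (x := x) (i := t + 2) (out := [])
        (l := (.initInc, none, false, false, false)) (cols := columns (Nat.size t) (regs 0 0 0 0 t))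
        rfl (by omega) rfl (l' := (.init, none, false, false, false)) rfl
      rw [sweep_count] at h2
      exact Transducer.Det.trans h1 h2
  have h1 := SweepProg.det_branch (p := memProg zero one) (x := x) (i := x.length + 1)
    (i' := x.length + 1) (dir := .stay) (e := none) (l' := (.initEnd, none, false, false, false))
    (out := []) (l := (.init, none, false, false, false))
    (cols := columns (Nat.size x.length) (regs 0 0 0 0 x.length)) rfl
    (by rw [readInput_end]) rfl le_rfl
  have h2 := det_cmp (x := x) (zero := zero) (one := one) (out := []) (v := regs 0 0 0 0 x.length)
    (i := x.length + 1) (l := (.initEnd, none, false, false, false))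
    (l' := (.rewind, none, false, false, false)) rfl le_rfl
    (Fits.lt ⟨Nat.zero_le _, by positivity, by positivity, Nat.zero_le _⟩ le_rfl) rfl
  have e2 : (fun i => ((clearTmp i).map (regs 0 0 0 0 x.length)).getD 0) = regs 0 0 0 0 0 := by
    funext i; cases i <;> rfl
  rw [e2] at h2
  exact (key x.length le_rfl).trans (Transducer.Det.trans h1 (h2.trans (det_rewind le_rfl)))

theorem ListedNFA.rawOk (A : ListedNFA α) : RawOk A.n A.rawTrans A.rawStarts A.rawFinals := by
  refine ⟨?_, ?_, ?_⟩
  · intro t ht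
    obtain ⟨t', -, rfl⟩ := List.mem_map.1 ht
    exact ⟨t'.1.2, t'.2.2.2⟩
  · intro q hq
    obtain ⟨q', -, rfl⟩ := List.mem_map.1 hq
    exact q'.2
  · intro q hq
    obtain ⟨q', -, rfl⟩ := List.mem_map.1 hq
    exact q'.2

theorem mem_outputs_memProg (h01 : zero ≠ one) (A : ListedNFA α) (k : ℕ) (w : List α) :
    w ∈ (memProg zero one).toTransducer.outputs (encodeInstance zero one A k) ↔
      w.length = k ∧ w ∈ A.toNFA.accepts := by
  rw [Transducer.mem_outputs_iff_acc, (det_init w).1]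
  refine (acc_guess h01 A.rawOk (encodeInstance_eq A k) (Nat.zero_add k) (Nat.zero_le _)
    (by positivity)).trans ?_
  rw [A.mem_accepts_iff]
  constructor
  · rintro ⟨w, r, qs, rfl, hw, hs, hr⟩
    exact ⟨hw, r, hs, qs, hr⟩
  · rintro ⟨hw, r, hs, qs, hr⟩
    exact ⟨w, r, qs, rfl, hw, hs, hr⟩

/-- Strings that encode nothing have no outputs, since an accepting run has parsed the input in its
first pass. -/
theorem exists_instance (h01 : zero ≠ one)
    (hy : y ∈ (memProg zero one).toTransducer.outputs x) :
    ∃ (A : ListedNFA α) (k : ℕ), x = encodeInstance zero one A k := by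
  rw [Transducer.mem_outputs_iff_acc, (det_init y).1] at hy
  obtain ⟨r, -, hr, hy⟩ := (guess_spec (by positivity)).1.1 hy
  obtain ⟨n, tr, st, fi, k, rfl, h1, h2, h3⟩ := exists_eq_encodeRaw h01
    ⟨Nat.zero_le _, by positivity, hr, Nat.zero_le _⟩ hy
  refine ⟨ListedNFA.ofRaw n tr st fi h1 h2 h3, k, ?_⟩
  rw [encodeInstance_eq, ListedNFA.rawTrans_ofRaw, ListedNFA.rawStarts_ofRaw,
    ListedNFA.rawFinals_ofRaw]
  rfl

theorem unambiguousOn_memProg (h01 : zero ≠ one) {A : ListedNFA α} (hA : Unambiguous A.toNFA)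
    (k : ℕ) : (memProg zero one).toTransducer.UnambiguousOn (encodeInstance zero one A k) := by
  refine Transducer.unambiguousOn_of_atMostOne fun y => (det_init y).2 ?_
  refine atMostOne_guess h01 A.rawOk (encodeInstance_eq A k) (Nat.zero_add k) (Nat.zero_le _)
    (by positivity) fun w r r' qs qs' h1 h2 h3 h4 => ?_
  exact A.unambiguous_iff.1 hA w r h1 r' h2 qs qs' h3 h4

theorem memNFA_mem_relationNL (h01 : zero ≠ one) : memNFA zero one ∈ RelationNL α := by
  refine ⟨fixedLength_memNFA h01, _, memProg_isNL zero one, Set.ext ?_⟩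
  rintro ⟨x, y⟩
  constructor
  · intro (h : y ∈ (memProg zero one).toTransducer.outputs x)
    obtain ⟨A, k, rfl⟩ := exists_instance h01 h
    obtain ⟨h1, h2⟩ := (mem_outputs_memProg h01 A k y).1 h
    exact ⟨A, k, rfl, h1, h2⟩
  · rintro ⟨A, k, rfl : x = _, h1, h2⟩
    exact (mem_outputs_memProg h01 A k y).2 ⟨h1, h2⟩

theorem exists_transducer_memUFA (h01 : zero ≠ one) : ∃ M : Transducer α, M.IsNL ∧
    ∀ x ∈ ufaInstances zero one,
      M.outputs x = witnesses (memUFA zero one) x ∧ M.UnambiguousOn x := by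
  refine ⟨_, memProg_isNL zero one, ?_⟩
  rintro x ⟨A, k, rfl, hA⟩
  refine ⟨Set.ext fun w => ?_, unambiguousOn_memProg h01 hA k⟩
  rw [mem_outputs_memProg h01, mem_memUFA h01 hA]

end Main

end LogspaceRelations

theorem mainTheorem7 {α : Type} [Fintype α] (zero one : α) (h01 : zero ≠ one) :
    LogspaceRelations.IsComplete (LogspaceRelations.RelationNL α)
      (LogspaceRelations.memNFA zero one) ∧
    (∀ R ∈ LogspaceRelations.RelationUL α, ∃ f : List α → List α,
      LogspaceRelations.IsReduction f R (LogspaceRelations.memUFA zero one) ∧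
      ∀ x, f x ∈ LogspaceRelations.ufaInstances zero one) ∧
    (∃ M : LogspaceRelations.Transducer α, M.IsNL ∧
      ∀ x ∈ LogspaceRelations.ufaInstances zero one,
        M.outputs x = LogspaceRelations.witnesses (LogspaceRelations.memUFA zero one) x ∧
        M.UnambiguousOn x) := by
  refine ⟨⟨LogspaceRelations.memNFA_mem_relationNL h01,
      fun R hR => LogspaceRelations.exists_reduction_memNFA h01 hR⟩,
    fun R hR => LogspaceRelations.exists_reduction_memUFA h01 hR,
    LogspaceRelations.exists_transducer_memUFA h01⟩
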